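/- Let $(a_n)_{n\ge 1}$ be a sequence of positive real numbers. Let $T_1$ be a segment of length $a_1$, rooted at one of its two ends, and for $n\ge 2$ let $T_n$ be the tree obtained by gluing a segment of length $a_n$, by one of its ends, on a point of $T_{n-1}$ chosen uniformly at random (i.e. according to the normalized length measure of $T_{n-1}$), independently of the previous choices. Let $d$ be the length metric of $T_n$. The sequence $(a_n)$ is called regularly varying with index $\alpha$ if $a_{\lfloor cn\rfloor}/a_n\to c^{\alpha}$ as $n\to\infty$ for every $c>0$. Fix an integer $\ell\ge 1$ and, given $T_n$, let $X_n^{(1)},\dots,X_n^{(\ell)}$ be independent uniform random points of $T_n$. For $i\ne j$ let $B_n^{(i,j)}$ be the point at which the paths from the root to $X_n^{(i)}$ and from the root to $X_n^{(j)}$ separate, that is, the point common to both paths which is the farthest from the root. Put $M_n=\max_{1\le i\ne j\le \ell} d(B_n^{(i,j)},\mathrm{root})$ (with $M_n=0$ if $\ell=1$) and $S_n=\sum_{i=1}^n i^{-1}a_i$. (i) Assume that $(a_n)$ is regularly varying with index $\alpha>0$. There is a unique probability law on $\mathbb R$, that of a random variable denoted by $\xi_{(\alpha)}$, such that $$\mathbb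 E\big[e^{\lambda \xi_{(\alpha)}}\big]=\exp\Big(\frac{\alpha+1}{\alpha}\int_0^1\big(e^{\lambda u}-1\big)\frac{1-u}{u}\,\mathrm du\Big)\qquad\text{for all }\lambda\in\mathbb R,$$ and, as $n\to\infty$, $$\left(\Big(\frac{d(X_n^{(i)},\mathrm{root})}{a_n}\Big)_{1\le i\le \ell},\ \frac{M_n}{a_n}\right)\ \longrightarrow\ \left(\big(\xi^{(i)}_{(\alpha)}\big)_{1\le i\le \ell},\ 0\right)\quad\text{in distribution},$$ where $\xi^{(1)}_{(\alpha)},\dots,\xi^{(\ell)}_{(\alpha)}$ are i.i.d. copies of $\xi_{(\alpha)}$. (ii) Assume that $(a_n)$ is regularly varying with index $0$ and that $\sum_{i\ge 1} i^{-1}a_i=\infty$. Then, as $n\to\infty$, $$\left(\Big(\frac{d(X_n^{(i)},\mathrm{root})}{S_n}\Big)_{1\le i\le \ell},\ \frac{M_n}{S_n}\right)\ \longrightarrow\ \left(\Big(\frac12,\dots,\frac12\Big),\ 0\right)\quad\text{in probability}.$$ If moreover $a_n\to\infty$, then also $$\left(\Big(\frac{d(X_n^{(i)},\mathrm{root})}{S_n}\Big)_{1\le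 i\le \ell},\ \frac{M_n}{a_n}\right)\ \longrightarrow\ \left(\Big(\frac12,\dots,\frac12\Big),\ 0\right)\quad\text{in probability}.$$ -/

import Mathlib

open MeasureTheory ProbabilityTheory Filter Topology

/-- The sequence `(a n)`, `n ≥ 1`, is regularly varying with index `α`
(the value `a 0` plays no role). -/
def RegularlyVarying (a : ℕ → ℝ) (α : ℝ) : Prop :=
  ∀ c : ℝ, 0 < c → Tendsto (fun n : ℕ => a ⌊c * n⌋₊ / a n) atTop (𝓝 (c ^ α))

/-- The points of the tree `T_n` built from the segments `b_1, …, b_n` of lengths `a 1, …, a n`: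
the pair `(i, x)` is the point of the closed segment `b_i` at distance `x` from the end of `b_i`
which is glued (from the end chosen as the root when `i = 1`). A glued end `(i, 0)`, `i ≥ 2`, and
the point it is glued on are two names of one point: `treeDist` puts them at distance `0`. -/
def treePts (a : ℕ → ℝ) (n : ℕ) : Set (ℕ × ℝ) :=
  {p | 1 ≤ p.1 ∧ p.1 ≤ n ∧ 0 ≤ p.2 ∧ p.2 ≤ a p.1}

/-- The root: an end of the first segment. -/
def treeRoot : ℕ × ℝ := (1, 0)

/-- The length metric of `T_n` when, for every `2 ≤ i ≤ n`, the end `(i, 0)` of the segment `b_i`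
is glued on the point `g i` of `T_(i-1)`: two points of `b_n` are at their distance in `b_n`, a path
from a point of `b_n` to a point of `T_(n-1)` goes through the gluing point `g n`, and the metric
on `T_(n-1)` is unchanged. -/
def treeDist (g : ℕ → ℕ × ℝ) : ℕ → ℕ × ℝ → ℕ × ℝ → ℝ
  | 0, _, _ => 0
  | n + 1, p, q =>
    if p.1 = n + 1 then
      if q.1 = n + 1 then |p.2 - q.2| else p.2 + treeDist g n (g (n + 1)) q
    else
      if q.1 = n + 1 then q.2 + treeDist g n p (g (n + 1)) else treeDist g n p q

/-- The path in `T_n` from the root to `p`. -/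
def rootPath (a : ℕ → ℝ) (g : ℕ → ℕ × ℝ) (n : ℕ) (p : ℕ × ℝ) : Set (ℕ × ℝ) :=
  {z ∈ treePts a n |
    treeDist g n treeRoot z + treeDist g n z p = treeDist g n treeRoot p}

/-- The distance to the root of the point at which the paths in `T_n` from the root to `p` and from
the root to `q` separate, i.e. of the point of both paths that is the farthest from the root (this
point is `p` when `p` lies on the path to `q`). -/
noncomputable def branchHeight (a : ℕ → ℝ) (g : ℕ → ℕ × ℝ) (n : ℕ) (p q : ℕ × ℝ) : ℝ :=
  sSup (treeDist g n treeRoot '' (rootPath a g n p ∩ rootPath a g n q))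

/-- The largest height of a branch point of two distinct marked points among `x 1, …, x ℓ`
(it is `0` if there is only one marked point). -/
noncomputable def maxBranchHeight {ℓ : ℕ} (a : ℕ → ℝ) (g : ℕ → ℕ × ℝ) (n : ℕ)
    (x : Fin ℓ → ℕ × ℝ) : ℝ :=
  ⨆ e : {e : Fin ℓ × Fin ℓ // e.1 ≠ e.2}, branchHeight a g n (x e.1.1) (x e.1.2)

/-- Length measure on the disjoint union of the segments. -/
noncomputable def segLength : Measure (ℕ × ℝ) := (Measure.count : Measure ℕ).prod volume

/-- The random trees with marked points. For `i ≥ 2` the segment `b_i` is glued on a uniform point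
`glue i` of `T_(i-1)`, independent of the previous gluings; given `T_n`, the points
`X n 1, …, X n ℓ` are independent and uniform in `T_n`. (Nothing is imposed on the joint law of the
marked points for different `n`.) Uniform means: distributed according to the normalized length
measure, which does not depend on the gluing points. -/
structure IsMarkedGluing {Ω : Type*} [MeasurableSpace Ω] (P : Measure Ω) (a : ℕ → ℝ) (ℓ : ℕ)
    (glue : ℕ → Ω → ℕ × ℝ) (X : ℕ → Fin ℓ → Ω → ℕ × ℝ) : Prop where
  measurable_glue : ∀ i, Measurable (glue i)
  measurable_mark : ∀ n j, Measurable (X n j)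
  glue_uniform : ∀ i, 2 ≤ i → pdf.IsUniform (glue i) (treePts a (i - 1)) P segLength
  mark_uniform : ∀ n, 1 ≤ n → ∀ j, pdf.IsUniform (X n j) (treePts a n) P segLength
  indep : ∀ n, 1 ≤ n →
    iIndepFun (Sum.elim (fun i : Finset.Icc 2 n => glue i) (X n)) P

/-- The exponent `φ_(α)(t) = (α+1)/α ∫₀¹ (exp(t u) - 1) (1 - u)/u du`. -/
noncomputable def xiExponent (α t : ℝ) : ℝ :=
  (α + 1) / α * ∫ u in (0 : ℝ)..1, (Real.exp (t * u) - 1) * ((1 - u) / u)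

/-- `ν` is the law of `ξ_(α)`: `E[exp(t ξ)] = exp(φ_(α)(t))` for all real `t`. (As the right-hand
side is not `0`, the equation contains the finiteness of the exponential moment.) -/
def IsXiLaw (α : ℝ) (ν : ProbabilityMeasure ℝ) : Prop :=
  ∀ t : ℝ, mgf id (ν : Measure ℝ) t = Real.exp (xiExponent α t)

/-- The sum `∑_{i=1}^n a i / i`. -/
noncomputable def harmonicSum (a : ℕ → ℝ) (n : ℕ) : ℝ :=
  ∑ i ∈ Finset.Icc 1 n, (i : ℝ)⁻¹ * a i

/-
Recording how far the path from the root to a point runs inside each segment embeds `T_n`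
isometrically in `ℓ¹`, and there the point at which two paths separate is the coordinatewise
minimum. Put `p_k = a_k / (a_1 + ⋯ + a_k)`. A uniform point of `T_k` lies with probability `p_k` on
the last segment, uniformly, and is otherwise uniform in `T_(k-1)`, as is the gluing point. Hence a
uniform height `H_n` satisfies `E[exp(z H_n)] = ∏_(k ≤ n) (1 + p_k (U(z a_k) - 1))`, where `U` is
the Laplace transform of the uniform law on `[0, 1]`.

Regular variation gives `∑ p_k² < ∞`. Therefore, given the gluing points, the rescaled
characteristic function of the height concentrates in `L²` around its mean, which makes the marked
points asymptotically independent; and two of them branch outside `T_m` with probability at most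
`∑_(k > m) p_k²`, so the branching heights are tight.

It remains to find the limit of the product. Potter's bound and Karamata's theorem turn its
logarithm into a Riemann sum if `α > 0`, and into `(z / (2 S_n)) ∑_(k ≤ n) p_k a_k` with
`p_k ∼ 1 / k` if `α = 0`. The exponential moments converge together with the characteristic
functions, so the limit law has the moment generating function that defines `ξ_(α)`.
-/

/-- The length of the intersection of the segment `b_k` with the path in `T_n` from the root to
`p`. As a function of `k` it embeds `T_n` isometrically in `ℓ¹`, see
`treeDist_eq_sum_abs_pathLength_sub`. -/
def pathLength (g : ℕ → ℕ × ℝ) : ℕ → ℕ × ℝ → ℕ → ℝ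
  | 0, _, _ => 0
  | n + 1, p, k =>
    if p.1 = n + 1 then
      if k = n + 1 then p.2 else pathLength g n (g (n + 1)) k
    else pathLength g n p k

/-- The distance from `p` to the root of `T_n`. -/
def height (g : ℕ → ℕ × ℝ) (n : ℕ) (p : ℕ × ℝ) : ℝ := ∑ k ∈ Finset.Icc 1 n, pathLength g n p k

/-- The distance to the root of the point at which the paths in `T_n` from the root to `p` and to
`q` separate: in the `ℓ¹` embedding this point is the coordinatewise minimum of `p` and `q`. -/
def meetHeight (g : ℕ → ℕ × ℝ) (n : ℕ) (p q : ℕ × ℝ) : ℝ :=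
  ∑ k ∈ Finset.Icc 1 n, min (pathLength g n p k) (pathLength g n q k)

/-- Every gluing point used to build `T_n` is a point of the tree on which it is glued. -/
def ValidGluing (a : ℕ → ℝ) (g : ℕ → ℕ × ℝ) (n : ℕ) : Prop :=
  ∀ i ∈ Finset.Icc 2 n, g i ∈ treePts a (i - 1)

/-- The total length of `T_n`. -/
def totalLength (a : ℕ → ℝ) (n : ℕ) : ℝ := ∑ i ∈ Finset.Icc 1 n, a i

section Geometry

variable {a : ℕ → ℝ} {g : ℕ → ℕ × ℝ} {m n k : ℕ} {p q : ℕ × ℝ}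

lemma totalLength_succ (a : ℕ → ℝ) (n : ℕ) :
    totalLength a (n + 1) = totalLength a n + a (n + 1) :=
  Finset.sum_Icc_succ_top (by omega) _

lemma ValidGluing.of_succ (hg : ValidGluing a g (n + 1)) : ValidGluing a g n :=
  fun i hi => hg i (Finset.Icc_subset_Icc_right n.le_succ hi)

lemma ValidGluing.glue_mem (hg : ValidGluing a g (n + 1)) (hn : 1 ≤ n) :
    g (n + 1) ∈ treePts a n :=
  hg (n + 1) (Finset.mem_Icc.2 ⟨by omega, le_rfl⟩)

lemma one_le_of_mem_treePts (hp : p ∈ treePts a n) : 1 ≤ n := hp.1.trans hp.2.1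

lemma fst_ne_succ_of_mem_treePts (hp : p ∈ treePts a n) : p.1 ≠ n + 1 := by
  have := hp.2.1
  omega

lemma mem_treePts_succ :
    p ∈ treePts a (n + 1) ↔ p ∈ treePts a n ∨ p.1 = n + 1 ∧ 0 ≤ p.2 ∧ p.2 ≤ a (n + 1) := by
  obtain ⟨i, x⟩ := p
  simp only [treePts, Set.mem_ofPred_eq]
  constructor
  · rintro ⟨hi, hin, hx⟩
    rcases hin.eq_or_lt with rfl | hlt
    · exact Or.inr ⟨rfl, hx⟩
    · exact Or.inl ⟨hi, by omega, hx⟩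
  · rintro (⟨hi, hin, hx⟩ | ⟨rfl, hx⟩)
    · exact ⟨hi, by omega, hx⟩
    · exact ⟨by omega, le_rfl, hx⟩

lemma pathLength_succ_of_ne (hp : p.1 ≠ n + 1) :
    pathLength g (n + 1) p = pathLength g n p := by
  funext k
  simp only [pathLength, if_neg hp]

lemma pathLength_succ_top (hp : p.1 = n + 1) : pathLength g (n + 1) p (n + 1) = p.2 := by
  simp only [pathLength, if_pos hp, if_true]

lemma pathLength_succ_of_eq (hp : p.1 = n + 1) (hk : k ≠ n + 1) :
    pathLength g (n + 1) p k = pathLength g n (g (n + 1)) k := by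
  simp only [pathLength, if_pos hp, if_neg hk]

lemma pathLength_of_lt (hk : n < k) : pathLength g n p k = 0 := by
  induction n generalizing p with
  | zero => rfl
  | succ n ih => simp only [pathLength, if_neg hk.ne', ih (n.lt_succ_self.trans hk), ite_self]

lemma pathLength_treeRoot : pathLength g n treeRoot k = 0 := by
  induction n with
  | zero => rfl
  | succ n ih =>
    rcases n.eq_zero_or_pos with rfl | hn
    · simp [pathLength, treeRoot]
    · rw [pathLength_succ_of_ne (by simpa [treeRoot] using hn.ne'), ih]

lemma dependsOn_pathLength (n : ℕ) (p : ℕ × ℝ) (k : ℕ) :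
    DependsOn (fun g => pathLength g n p k) (Finset.Icc 2 n) := by
  intro g g' h
  induction n generalizing p with
  | zero => rfl
  | succ n ih =>
    have ih' (p) : pathLength g n p k = pathLength g' n p k :=
      ih p fun i hi => h i (Finset.Icc_subset_Icc_right n.le_succ hi)
    rcases n.eq_zero_or_pos with rfl | hn
    · simp [pathLength]
    · simp only [pathLength, ih', h (n + 1) (Finset.mem_Icc.2 ⟨by omega, le_rfl⟩)]

lemma pathLength_nonneg (hg : ValidGluing a g n) (hp : p ∈ treePts a n) :
    0 ≤ pathLength g n p k := by
  induction n generalizing p with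
  | zero => exact le_rfl
  | succ n ih =>
    rcases mem_treePts_succ.1 hp with hp | ⟨hp, hp0, -⟩
    · rw [pathLength_succ_of_ne (fst_ne_succ_of_mem_treePts hp)]
      exact ih hg.of_succ hp
    · rcases eq_or_ne k (n + 1) with rfl | hk
      · rwa [pathLength_succ_top hp]
      · rw [pathLength_succ_of_eq hp hk]
        rcases n.eq_zero_or_pos with rfl | hn
        · exact le_rfl
        · exact ih hg.of_succ (hg.glue_mem hn)

lemma pathLength_le (ha : ∀ n, 1 ≤ n → 0 < a n) (hk : 1 ≤ k) (hg : ValidGluing a g n)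
    (hp : p ∈ treePts a n) : pathLength g n p k ≤ a k := by
  induction n generalizing p with
  | zero => exact (ha k hk).le
  | succ n ih =>
    rcases mem_treePts_succ.1 hp with hp | ⟨hp, -, hp1⟩
    · rw [pathLength_succ_of_ne (fst_ne_succ_of_mem_treePts hp)]
      exact ih hg.of_succ hp
    · rcases eq_or_ne k (n + 1) with rfl | hkn
      · rwa [pathLength_succ_top hp]
      · rw [pathLength_succ_of_eq hp hkn]
        rcases n.eq_zero_or_pos with rfl | hn
        · exact (ha k hk).le
        · exact ih hg.of_succ (hg.glue_mem hn)

lemma sum_pathLength_succ_of_eq {β : Type*} [AddCommMonoid β] (hp : p.1 = n + 1)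
    (f : ℕ → ℝ → β) :
    ∑ k ∈ Finset.Icc 1 (n + 1), f k (pathLength g (n + 1) p k) =
      ∑ k ∈ Finset.Icc 1 n, f k (pathLength g n (g (n + 1)) k) + f (n + 1) p.2 := by
  rw [Finset.sum_Icc_succ_top (by omega), pathLength_succ_top hp]
  refine congrArg (· + _) (Finset.sum_congr rfl fun k hk => ?_)
  rw [pathLength_succ_of_eq hp (by have := Finset.mem_Icc.1 hk; omega)]

lemma sum_pathLength_succ_of_ne {β : Type*} [AddCommMonoid β] (hp : p.1 ≠ n + 1)
    (f : ℕ → ℝ → β) :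
    ∑ k ∈ Finset.Icc 1 (n + 1), f k (pathLength g (n + 1) p k) =
      ∑ k ∈ Finset.Icc 1 n, f k (pathLength g n p k) + f (n + 1) 0 := by
  rw [Finset.sum_Icc_succ_top (by omega), pathLength_succ_of_ne hp,
    pathLength_of_lt n.lt_succ_self]

lemma treeDist_comm (g : ℕ → ℕ × ℝ) (n : ℕ) (p q : ℕ × ℝ) :
    treeDist g n p q = treeDist g n q p := by
  induction n generalizing p q with
  | zero => rfl
  | succ n ih =>
    simp only [treeDist, ih (g (n + 1)), ih p q, abs_sub_comm p.2]
    split_ifs <;> rfl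

theorem treeDist_eq_sum_abs_pathLength_sub (hg : ValidGluing a g n) (hp : p ∈ treePts a n)
    (hq : q ∈ treePts a n) :
    treeDist g n p q = ∑ k ∈ Finset.Icc 1 n, |pathLength g n p k - pathLength g n q k| := by
  induction n generalizing p q with
  | zero => simp [treeDist]
  | succ n ih =>
    have new_old {p q : ℕ × ℝ} (hp : p.1 = n + 1) (hp0 : 0 ≤ p.2) (hq : q ∈ treePts a n) :
        treeDist g (n + 1) p q =
          ∑ k ∈ Finset.Icc 1 (n + 1), |pathLength g (n + 1) p k - pathLength g (n + 1) q k| := by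
      have hq' := fst_ne_succ_of_mem_treePts hq
      rw [sum_pathLength_succ_of_eq hp fun k x => |x - pathLength g (n + 1) q k|,
        pathLength_succ_of_ne hq', pathLength_of_lt n.lt_succ_self, sub_zero, abs_of_nonneg hp0,
        ← ih hg.of_succ (hg.glue_mem (one_le_of_mem_treePts hq)) hq, treeDist, if_pos hp,
        if_neg hq', add_comm]
    rcases mem_treePts_succ.1 hp with hp | ⟨hp, hp0, -⟩ <;>
    rcases mem_treePts_succ.1 hq with hq | ⟨hq, hq0, -⟩
    · have hp' := fst_ne_succ_of_mem_treePts hp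
      have hq' := fst_ne_succ_of_mem_treePts hq
      rw [sum_pathLength_succ_of_ne hp' fun k x => |x - pathLength g (n + 1) q k|,
        pathLength_succ_of_ne hq', pathLength_of_lt n.lt_succ_self, sub_zero, abs_zero, add_zero,
        ← ih hg.of_succ hp hq, treeDist, if_neg hp', if_neg hq']
    · rw [treeDist_comm, new_old hq hq0 hp]
      simp only [abs_sub_comm]
    · exact new_old hp hp0 hq
    · have same_path (k) (hk : k ∈ Finset.Icc 1 n) :
          pathLength g n (g (n + 1)) k - pathLength g (n + 1) q k = 0 := by
        rw [pathLength_succ_of_eq hq (by have := Finset.mem_Icc.1 hk; omega), sub_self]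
      rw [sum_pathLength_succ_of_eq hp fun k x => |x - pathLength g (n + 1) q k|,
        Finset.sum_eq_zero fun k hk => by rw [same_path k hk, abs_zero],
        pathLength_succ_top hq, zero_add, treeDist, if_pos hp, if_pos hq]

lemma treeRoot_mem_treePts (ha : ∀ n, 1 ≤ n → 0 < a n) (hn : 1 ≤ n) : treeRoot ∈ treePts a n :=
  ⟨le_rfl, hn, le_rfl, (ha 1 le_rfl).le⟩

lemma treeDist_treeRoot (ha : ∀ n, 1 ≤ n → 0 < a n) (hg : ValidGluing a g n)
    (hp : p ∈ treePts a n) : treeDist g n p treeRoot = height g n p := by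
  rw [treeDist_eq_sum_abs_pathLength_sub hg hp
    (treeRoot_mem_treePts ha (one_le_of_mem_treePts hp))]
  simp only [pathLength_treeRoot, sub_zero, abs_of_nonneg (pathLength_nonneg hg hp), height]

lemma height_succ_of_eq (hp : p.1 = n + 1) :
    height g (n + 1) p = height g n (g (n + 1)) + p.2 :=
  sum_pathLength_succ_of_eq hp fun _ x => x

lemma height_succ_of_ne (hp : p.1 ≠ n + 1) : height g (n + 1) p = height g n p :=
  (sum_pathLength_succ_of_ne hp fun _ x => x).trans (add_zero _)

lemma dependsOn_height (n : ℕ) (p : ℕ × ℝ) :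
    DependsOn (fun g => height g n p) (Finset.Icc 2 n) := fun _ _ h =>
  Finset.sum_congr rfl fun k _ => dependsOn_pathLength n p k h

lemma height_nonneg (hg : ValidGluing a g n) (hp : p ∈ treePts a n) : 0 ≤ height g n p :=
  Finset.sum_nonneg fun _ _ => pathLength_nonneg hg hp

lemma height_le_totalLength (ha : ∀ n, 1 ≤ n → 0 < a n) (hg : ValidGluing a g n)
    (hp : p ∈ treePts a n) : height g n p ≤ totalLength a n :=
  Finset.sum_le_sum fun _ hk => pathLength_le ha (Finset.mem_Icc.1 hk).1 hg hp

lemma meetHeight_comm (g : ℕ → ℕ × ℝ) (n : ℕ) (p q : ℕ × ℝ) :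
    meetHeight g n p q = meetHeight g n q p := by
  simp only [meetHeight, min_comm]

lemma meetHeight_succ_of_ne_of_ne (hp : p.1 ≠ n + 1) (hq : q.1 ≠ n + 1) :
    meetHeight g (n + 1) p q = meetHeight g n p q := by
  rw [meetHeight, pathLength_succ_of_ne hq,
    sum_pathLength_succ_of_ne hp fun k x => min x (pathLength g n q k),
    pathLength_of_lt n.lt_succ_self, min_self, add_zero, meetHeight]

lemma meetHeight_succ_of_eq_of_ne (hp : p.1 = n + 1) (hp0 : 0 ≤ p.2) (hq : q.1 ≠ n + 1) :
    meetHeight g (n + 1) p q = meetHeight g n (g (n + 1)) q := by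
  rw [meetHeight, pathLength_succ_of_ne hq,
    sum_pathLength_succ_of_eq hp fun k x => min x (pathLength g n q k),
    pathLength_of_lt n.lt_succ_self, min_eq_right hp0, add_zero, meetHeight]

lemma dependsOn_meetHeight (n : ℕ) (p q : ℕ × ℝ) :
    DependsOn (fun g => meetHeight g n p q) (Finset.Icc 2 n) := fun _ _ h =>
  Finset.sum_congr rfl fun k _ =>
    congrArg₂ min (dependsOn_pathLength n p k h) (dependsOn_pathLength n q k h)

lemma meetHeight_nonneg (hg : ValidGluing a g n) (hp : p ∈ treePts a n)
    (hq : q ∈ treePts a n) : 0 ≤ meetHeight g n p q :=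
  Finset.sum_nonneg fun _ _ => le_min (pathLength_nonneg hg hp) (pathLength_nonneg hg hq)

lemma meetHeight_le_totalLength (ha : ∀ n, 1 ≤ n → 0 < a n) (hg : ValidGluing a g n)
    (hp : p ∈ treePts a n) : meetHeight g n p q ≤ totalLength a n :=
  Finset.sum_le_sum fun _ hk =>
    (min_le_left _ _).trans (pathLength_le ha (Finset.mem_Icc.1 hk).1 hg hp)

lemma exists_pathLength_eq_min (hg : ValidGluing a g n) (hp : p ∈ treePts a n)
    (hq : q ∈ treePts a n) :
    ∃ z ∈ treePts a n, ∀ k, pathLength g n z k = min (pathLength g n p k) (pathLength g n q k) := by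
  induction n generalizing p q with
  | zero => exact absurd (one_le_of_mem_treePts hp) (by simp)
  | succ n ih =>
    have new_old {p q : ℕ × ℝ} (hp : p.1 = n + 1) (hp0 : 0 ≤ p.2) (hq : q ∈ treePts a n) :
        ∃ z ∈ treePts a (n + 1), ∀ k, pathLength g (n + 1) z k =
          min (pathLength g (n + 1) p k) (pathLength g (n + 1) q k) := by
      obtain ⟨z, hz, h⟩ := ih hg.of_succ (hg.glue_mem (one_le_of_mem_treePts hq)) hq
      refine ⟨z, mem_treePts_succ.2 (Or.inl hz), fun k => ?_⟩
      rw [pathLength_succ_of_ne (fst_ne_succ_of_mem_treePts hz),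
        pathLength_succ_of_ne (fst_ne_succ_of_mem_treePts hq)]
      rcases eq_or_ne k (n + 1) with rfl | hk
      · rw [pathLength_succ_top hp, pathLength_of_lt n.lt_succ_self,
          pathLength_of_lt n.lt_succ_self, min_eq_right hp0]
      · rw [pathLength_succ_of_eq hp hk, h]
    rcases mem_treePts_succ.1 hp with hp | ⟨hp, hp0, hp1⟩ <;>
    rcases mem_treePts_succ.1 hq with hq | ⟨hq, hq0, -⟩
    · obtain ⟨z, hz, h⟩ := ih hg.of_succ hp hq
      refine ⟨z, mem_treePts_succ.2 (Or.inl hz), fun k => ?_⟩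
      simpa only [pathLength_succ_of_ne (fst_ne_succ_of_mem_treePts hp),
        pathLength_succ_of_ne (fst_ne_succ_of_mem_treePts hq),
        pathLength_succ_of_ne (fst_ne_succ_of_mem_treePts hz)] using h k
    · simpa only [min_comm] using new_old hq hq0 hp
    · exact new_old hp hp0 hq
    · refine ⟨(n + 1, min p.2 q.2), mem_treePts_succ.2
        (Or.inr ⟨rfl, le_min hp0 hq0, (min_le_left _ _).trans hp1⟩), fun k => ?_⟩
      rcases eq_or_ne k (n + 1) with rfl | hk
      · rw [pathLength_succ_top rfl, pathLength_succ_top hp, pathLength_succ_top hq]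
      · rw [pathLength_succ_of_eq rfl hk, pathLength_succ_of_eq hp hk,
          pathLength_succ_of_eq hq hk, min_self]

lemma mem_rootPath_iff (ha : ∀ n, 1 ≤ n → 0 < a n) (hg : ValidGluing a g n)
    (hp : p ∈ treePts a n) :
    q ∈ rootPath a g n p ↔
      q ∈ treePts a n ∧ ∀ k ∈ Finset.Icc 1 n, pathLength g n q k ≤ pathLength g n p k := by
  refine and_congr_right fun hq => ?_
  have le_abs (k) (_ : k ∈ Finset.Icc 1 n) : pathLength g n p k ≤
      pathLength g n q k + |pathLength g n q k - pathLength g n p k| := by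
    linarith [neg_abs_le (pathLength g n q k - pathLength g n p k)]
  rw [treeDist_comm g n treeRoot q, treeDist_comm g n treeRoot p, treeDist_treeRoot ha hg hq,
    treeDist_treeRoot ha hg hp, treeDist_eq_sum_abs_pathLength_sub hg hq hp, height, height,
    ← Finset.sum_add_distrib, eq_comm, Finset.sum_eq_sum_iff_of_le le_abs]
  refine forall₂_congr fun k _ => ?_
  rw [← sub_nonpos (a := pathLength g n q k), ← abs_eq_neg_self]
  constructor <;> intro h <;> linarith

theorem branchHeight_eq_meetHeight (ha : ∀ n, 1 ≤ n → 0 < a n) (hg : ValidGluing a g n)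
    (hp : p ∈ treePts a n) (hq : q ∈ treePts a n) :
    branchHeight a g n p q = meetHeight g n p q := by
  have dist_root {z : ℕ × ℝ} (hz : z ∈ treePts a n) :
      treeDist g n treeRoot z = height g n z := by
    rw [treeDist_comm, treeDist_treeRoot ha hg hz]
  obtain ⟨z, hz, hmin⟩ := exists_pathLength_eq_min hg hp hq
  refine IsGreatest.csSup_eq ⟨⟨z, ⟨?_, ?_⟩, ?_⟩, ?_⟩
  · exact (mem_rootPath_iff ha hg hp).2 ⟨hz, fun k _ => (hmin k).trans_le (min_le_left _ _)⟩
  · exact (mem_rootPath_iff ha hg hq).2 ⟨hz, fun k _ => (hmin k).trans_le (min_le_right _ _)⟩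
  · simp only [dist_root hz, height, hmin, meetHeight]
  · rintro _ ⟨w, ⟨hwp, hwq⟩, rfl⟩
    rw [mem_rootPath_iff ha hg hp] at hwp
    rw [mem_rootPath_iff ha hg hq] at hwq
    rw [dist_root hwp.1]
    exact Finset.sum_le_sum fun k hk => le_min (hwp.2 k hk) (hwq.2 k hk)

@[fun_prop]
lemma measurable_pathLength {β : Type*} [MeasurableSpace β] {G : β → ℕ → ℕ × ℝ}
    {u : β → ℕ × ℝ} (hG : Measurable G) (hu : Measurable u) :
    Measurable fun b => pathLength (G b) n (u b) k := by
  induction n generalizing u with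
  | zero => exact measurable_const
  | succ n ih =>
    have hfst : MeasurableSet {b | (u b).1 = n + 1} :=
      (measurableSet_singleton (n + 1)).preimage (measurable_fst.comp hu)
    simp only [pathLength]
    refine Measurable.ite hfst ?_ (ih hu)
    split_ifs
    · exact measurable_snd.comp hu
    · exact ih ((measurable_pi_apply (n + 1)).comp hG)

@[fun_prop]
lemma measurable_height {β : Type*} [MeasurableSpace β] {G : β → ℕ → ℕ × ℝ} {u : β → ℕ × ℝ}
    (hG : Measurable G) (hu : Measurable u) : Measurable fun b => height (G b) n (u b) := by
  unfold height
  fun_prop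

@[fun_prop]
lemma measurable_meetHeight {β : Type*} [MeasurableSpace β] {G : β → ℕ → ℕ × ℝ}
    {u v : β → ℕ × ℝ} (hG : Measurable G) (hu : Measurable u) (hv : Measurable v) :
    Measurable fun b => meetHeight (G b) n (u b) (v b) := by
  unfold meetHeight
  fun_prop

end Geometry

/-- The normalized length measure of `T_n`. -/
noncomputable def unifLaw (a : ℕ → ℝ) (n : ℕ) : Measure (ℕ × ℝ) := segLength[|treePts a n]

/-- The normalized length measure of the segment `b_n`. -/
noncomputable def segLaw (a : ℕ → ℝ) (n : ℕ) : Measure (ℕ × ℝ) :=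
  (volume.restrict (Set.Icc (0 : ℝ) 1)).map fun u => (n, a n * u)

/-- The proportion of the length of `T_n` that is carried by `b_n`. -/
noncomputable def segProb (a : ℕ → ℝ) (n : ℕ) : ℝ := a n / totalLength a n

section UniformLaw

variable {a : ℕ → ℝ} {n : ℕ}

lemma totalLength_nonneg (ha : ∀ n, 1 ≤ n → 0 < a n) (n : ℕ) : 0 ≤ totalLength a n :=
  Finset.sum_nonneg fun i hi => (ha i (Finset.mem_Icc.1 hi).1).le

lemma totalLength_pos (ha : ∀ n, 1 ≤ n → 0 < a n) (hn : 1 ≤ n) : 0 < totalLength a n :=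
  Finset.sum_pos (fun i hi => ha i (Finset.mem_Icc.1 hi).1) ⟨1, by simp [hn]⟩

lemma le_totalLength (ha : ∀ n, 1 ≤ n → 0 < a n) (hn : 1 ≤ n) : a n ≤ totalLength a n :=
  Finset.single_le_sum (f := a) (fun i hi => (ha i (Finset.mem_Icc.1 hi).1).le) (by simp [hn])

lemma segProb_pos (ha : ∀ n, 1 ≤ n → 0 < a n) (hn : 1 ≤ n) : 0 < segProb a n :=
  div_pos (ha n hn) (totalLength_pos ha hn)

lemma segProb_le_one (ha : ∀ n, 1 ≤ n → 0 < a n) (hn : 1 ≤ n) : segProb a n ≤ 1 :=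
  (div_le_one (totalLength_pos ha hn)).2 (le_totalLength ha hn)

lemma segProb_one (ha : ∀ n, 1 ≤ n → 0 < a n) : segProb a 1 = 1 := by
  simp [segProb, totalLength, (ha 1 le_rfl).ne']

lemma one_sub_segProb_succ (ha : ∀ n, 1 ≤ n → 0 < a n) (n : ℕ) :
    1 - segProb a (n + 1) = totalLength a n / totalLength a (n + 1) := by
  have := totalLength_pos ha (show 1 ≤ n + 1 by omega)
  rw [segProb, eq_div_iff this.ne', sub_mul, div_mul_cancel₀ _ this.ne', totalLength_succ]
  ring

lemma measurableSet_treePts (a : ℕ → ℝ) (n : ℕ) : MeasurableSet (treePts a n) := by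
  have : treePts a n = ⋃ i ∈ Finset.Icc 1 n, {i} ×ˢ Set.Icc 0 (a i) := by
    ext ⟨i, x⟩
    simp [treePts, and_assoc, and_left_comm]
  rw [this]
  exact Finset.measurableSet_biUnion _ fun i _ =>
    (measurableSet_singleton i).prod measurableSet_Icc

lemma restrict_treePts_succ (a : ℕ → ℝ) (n : ℕ) :
    segLength.restrict (treePts a (n + 1)) = segLength.restrict (treePts a n) +
      (volume.restrict (Set.Icc 0 (a (n + 1)))).map (Prod.mk (n + 1)) := by
  have hunion : treePts a (n + 1) = treePts a n ∪ {n + 1} ×ˢ Set.Icc 0 (a (n + 1)) := by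
    ext p
    simp [mem_treePts_succ]
  have hdisj : Disjoint (treePts a n) ({n + 1} ×ˢ Set.Icc 0 (a (n + 1))) :=
    Set.disjoint_left.2 fun p hp hp' => fst_ne_succ_of_mem_treePts hp (by simpa using hp'.1)
  rw [hunion, Measure.restrict_union hdisj
      ((measurableSet_singleton _).prod measurableSet_Icc), segLength, ← Measure.prod_restrict,
    Measure.restrict_singleton, Measure.count_singleton, one_smul, Measure.dirac_prod]

lemma map_restrict_Icc_eq_smul_segLaw (hn : 0 < a n) :
    (volume.restrict (Set.Icc 0 (a n))).map (Prod.mk n) = ENNReal.ofReal (a n) • segLaw a n := by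
  have hscale : volume.restrict (Set.Icc 0 (a n)) =
      ENNReal.ofReal (a n) • (volume.restrict (Set.Icc (0 : ℝ) 1)).map (a n * ·) := by
    have hpre : (a n * ·) ⁻¹' Set.Icc 0 (a n) = Set.Icc 0 1 := by
      simp [Set.preimage_const_mul_Icc₀ _ _ hn, hn.ne']
    conv_lhs => rw [← Real.smul_map_volume_mul_left hn.ne', abs_of_pos hn]
    rw [Measure.restrict_smul, Measure.restrict_map (by fun_prop) measurableSet_Icc, hpre]
  rw [hscale, Measure.map_smul, Measure.map_map (by fun_prop) (by fun_prop)]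
  rfl

instance (n : ℕ) : IsProbabilityMeasure (segLaw a n) := by
  have : IsProbabilityMeasure (volume.restrict (Set.Icc (0 : ℝ) 1)) := ⟨by simp⟩
  exact Measure.isProbabilityMeasure_map (by fun_prop)

lemma ae_segLaw (ha : ∀ n, 1 ≤ n → 0 < a n) (hn : 1 ≤ n) :
    ∀ᵐ p ∂segLaw a n, p.1 = n ∧ 0 ≤ p.2 ∧ p.2 ≤ a n := by
  have hmeas : MeasurableSet {p : ℕ × ℝ | p.1 = n ∧ 0 ≤ p.2 ∧ p.2 ≤ a n} := by measurability
  refine (ae_map_iff (by fun_prop) hmeas).2 ?_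
  filter_upwards [ae_restrict_mem measurableSet_Icc] with u hu
  have := ha n hn
  exact ⟨rfl, mul_nonneg this.le hu.1, mul_le_of_le_one_right this.le hu.2⟩

lemma segLength_treePts (ha : ∀ n, 1 ≤ n → 0 < a n) (n : ℕ) :
    segLength (treePts a n) = ENNReal.ofReal (totalLength a n) := by
  induction n with
  | zero =>
    have : treePts a 0 = ∅ := Set.eq_empty_of_forall_notMem fun p hp =>
      absurd (one_le_of_mem_treePts hp) (by simp)
    simp [this, totalLength]
  | succ n ih =>
    have han := ha (n + 1) (by omega)
    rw [← Measure.restrict_apply_univ, restrict_treePts_succ,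
      map_restrict_Icc_eq_smul_segLaw han, Measure.add_apply, Measure.restrict_apply_univ, ih,
      Measure.smul_apply, measure_univ, totalLength_succ,
      ENNReal.ofReal_add (totalLength_nonneg ha n) han.le, smul_eq_mul, mul_one]

lemma unifLaw_eq_smul (ha : ∀ n, 1 ≤ n → 0 < a n) (n : ℕ) :
    unifLaw a n = (ENNReal.ofReal (totalLength a n))⁻¹ • segLength.restrict (treePts a n) := by
  rw [unifLaw, ProbabilityTheory.cond, segLength_treePts ha]

lemma isProbabilityMeasure_unifLaw (ha : ∀ n, 1 ≤ n → 0 < a n) (hn : 1 ≤ n) :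
    IsProbabilityMeasure (unifLaw a n) := by
  refine cond_isProbabilityMeasure_of_finite ?_ ?_ <;> rw [segLength_treePts ha]
  · simpa using totalLength_pos ha hn
  · exact ENNReal.ofReal_ne_top

lemma ae_mem_treePts (a : ℕ → ℝ) (n : ℕ) : ∀ᵐ x ∂unifLaw a n, x ∈ treePts a n :=
  ae_cond_mem (measurableSet_treePts a n)

lemma unifLaw_succ (ha : ∀ n, 1 ≤ n → 0 < a n) (hn : 1 ≤ n) :
    unifLaw a (n + 1) = ENNReal.ofReal (1 - segProb a (n + 1)) • unifLaw a n +
      ENNReal.ofReal (segProb a (n + 1)) • segLaw a (n + 1) := by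
  have hA := totalLength_pos ha hn
  have hA' := totalLength_pos ha (show 1 ≤ n + 1 by omega)
  rw [unifLaw_eq_smul ha, unifLaw_eq_smul ha, restrict_treePts_succ,
    map_restrict_Icc_eq_smul_segLaw (ha (n + 1) (by omega)), smul_add, smul_smul, smul_smul,
    one_sub_segProb_succ ha, segProb, ENNReal.ofReal_div_of_pos hA', ENNReal.ofReal_div_of_pos hA',
    ENNReal.div_eq_inv_mul, ENNReal.div_eq_inv_mul, mul_assoc,
    ENNReal.mul_inv_cancel (by simpa using hA) ENNReal.ofReal_ne_top, mul_one]

lemma unifLaw_one (ha : ∀ n, 1 ≤ n → 0 < a n) : unifLaw a 1 = segLaw a 1 := by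
  have htree : treePts a 0 = ∅ := Set.eq_empty_of_forall_notMem fun p hp =>
    absurd (one_le_of_mem_treePts hp) (by simp)
  have ha1 := ha 1 le_rfl
  have hA : totalLength a 1 = a 1 := by simp [totalLength]
  rw [unifLaw_eq_smul ha, restrict_treePts_succ a 0, htree, Measure.restrict_empty, zero_add,
    map_restrict_Icc_eq_smul_segLaw ha1, smul_smul, hA, ENNReal.inv_mul_cancel (by simpa using ha1)
      ENNReal.ofReal_ne_top, one_smul]

lemma integral_unifLaw_succ {E : Type*} [NormedAddCommGroup E] [NormedSpace ℝ E]
    (ha : ∀ n, 1 ≤ n → 0 < a n) (hn : 1 ≤ n) {f : ℕ × ℝ → E}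
    (hf : Integrable f (unifLaw a (n + 1))) :
    ∫ x, f x ∂unifLaw a (n + 1) = (1 - segProb a (n + 1)) • ∫ x, f x ∂unifLaw a n +
      segProb a (n + 1) • ∫ x, f x ∂segLaw a (n + 1) := by
  rw [unifLaw_succ ha hn, integrable_add_measure] at hf
  rw [unifLaw_succ ha hn, integral_add_measure hf.1 hf.2, integral_smul_measure,
    integral_smul_measure, ENNReal.toReal_ofReal (segProb_pos ha (by omega)).le,
    ENNReal.toReal_ofReal (sub_nonneg.2 (segProb_le_one ha (by omega)))]

lemma lintegral_unifLaw_succ (ha : ∀ n, 1 ≤ n → 0 < a n) (hn : 1 ≤ n) (f : ℕ × ℝ → ENNReal) :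
    ∫⁻ x, f x ∂unifLaw a (n + 1) =
      ENNReal.ofReal (1 - segProb a (n + 1)) * ∫⁻ x, f x ∂unifLaw a n +
        ENNReal.ofReal (segProb a (n + 1)) * ∫⁻ x, f x ∂segLaw a (n + 1) := by
  rw [unifLaw_succ ha hn, lintegral_add_measure, lintegral_smul_measure, lintegral_smul_measure,
    smul_eq_mul, smul_eq_mul]

lemma integral_segLaw {E : Type*} [NormedAddCommGroup E] [NormedSpace ℝ E] {f : ℕ × ℝ → E}
    (hf : StronglyMeasurable f) : ∫ x, f x ∂segLaw a n = ∫ u in (0 : ℝ)..1, f (n, a n * u) := by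
  rw [segLaw, integral_map (by fun_prop) hf.aestronglyMeasurable,
    intervalIntegral.integral_of_le zero_le_one, integral_Icc_eq_integral_Ioc]

end UniformLaw

section Independence

variable {Ω α β : Type*} [MeasurableSpace Ω] [MeasurableSpace α] [MeasurableSpace β]
  {P : Measure Ω} {Y : Ω → α} {Z : Ω → β}

lemma indepFun_of_disjoint_range {ι κ₁ κ₂ : Type*} [Finite κ₁] [Finite κ₂] {f : ι → Ω → β}
    (h : iIndepFun f P) (hf : ∀ i, Measurable (f i)) {e₁ : κ₁ → ι} {e₂ : κ₂ → ι}
    (he : ∀ k l, e₁ k ≠ e₂ l) :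
    IndepFun (fun ω k => f (e₁ k) ω) (fun ω k => f (e₂ k) ω) P := by
  classical
  cases nonempty_fintype κ₁
  cases nonempty_fintype κ₂
  have hdisj : Disjoint (Finset.univ.image e₁) (Finset.univ.image e₂) := by
    rw [Finset.disjoint_left]
    rintro i hi hi'
    obtain ⟨k, -, rfl⟩ := Finset.mem_image.1 hi
    obtain ⟨l, -, hl⟩ := Finset.mem_image.1 hi'
    exact he k l hl.symm
  exact (h.indepFun_finset _ _ hdisj hf).comp
    (φ := fun x k => x ⟨e₁ k, Finset.mem_image_of_mem e₁ (Finset.mem_univ k)⟩)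
    (ψ := fun x k => x ⟨e₂ k, Finset.mem_image_of_mem e₂ (Finset.mem_univ k)⟩)
    (by fun_prop) (by fun_prop)

lemma lintegral_comp_of_indepFun [IsProbabilityMeasure P] (h : IndepFun Y Z P)
    (hY : Measurable Y) (hZ : Measurable Z) {F : α → β → ENNReal}
    (hF : Measurable (Function.uncurry F)) :
    ∫⁻ ω, F (Y ω) (Z ω) ∂P = ∫⁻ ω, ∫⁻ z, F (Y ω) z ∂P.map Z ∂P := by
  have := Measure.isProbabilityMeasure_map (μ := P) hZ.aemeasurable
  calc ∫⁻ ω, F (Y ω) (Z ω) ∂P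
      = ∫⁻ x, Function.uncurry F x ∂P.map (fun ω => (Y ω, Z ω)) :=
        (lintegral_map hF (hY.prodMk hZ)).symm
    _ = ∫⁻ ω, ∫⁻ z, F (Y ω) z ∂P.map Z ∂P := by
        rw [(indepFun_iff_map_prod_eq_prod_map_map hY.aemeasurable hZ.aemeasurable).1 h,
          lintegral_prod _ hF.aemeasurable, lintegral_map hF.lintegral_prod_right' hY]
        rfl

lemma integral_comp_of_indepFun {E : Type*} [NormedAddCommGroup E] [NormedSpace ℝ E]
    [IsProbabilityMeasure P] (h : IndepFun Y Z P) (hY : Measurable Y) (hZ : Measurable Z)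
    {F : α → β → E} (hF : StronglyMeasurable (Function.uncurry F))
    (hint : Integrable (fun ω => F (Y ω) (Z ω)) P) :
    ∫ ω, F (Y ω) (Z ω) ∂P = ∫ ω, ∫ z, F (Y ω) z ∂P.map Z ∂P := by
  have := Measure.isProbabilityMeasure_map (μ := P) hZ.aemeasurable
  have hprod := (indepFun_iff_map_prod_eq_prod_map_map hY.aemeasurable hZ.aemeasurable).1 h
  have hint' : Integrable (Function.uncurry F) ((P.map Y).prod (P.map Z)) := by
    rw [← hprod]
    exact (integrable_map_measure hF.aestronglyMeasurable
      (hY.prodMk hZ).aemeasurable).2 hint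
  calc ∫ ω, F (Y ω) (Z ω) ∂P
      = ∫ x, Function.uncurry F x ∂P.map (fun ω => (Y ω, Z ω)) :=
        (integral_map (hY.prodMk hZ).aemeasurable hF.aestronglyMeasurable).symm
    _ = ∫ ω, ∫ z, F (Y ω) z ∂P.map Z ∂P := by
        rw [hprod, integral_prod _ hint',
          integral_map hY.aemeasurable hF.integral_prod_right'.aestronglyMeasurable]
        rfl

end Independence

lemma apply_updateFinset_of_dependsOn {ι α β : Type*} [DecidableEq ι] {s : Finset ι}
    {F : (ι → α) → β} (hF : DependsOn F s) (x g : ι → α) :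
    F (Function.updateFinset x s fun i => g i) = F g :=
  hF fun i hi => by simp [Function.updateFinset, Finset.mem_coe.1 hi]

namespace IsMarkedGluing

variable {Ω : Type*} [MeasurableSpace Ω] {P : Measure Ω} {a : ℕ → ℝ} {ℓ : ℕ}
  {glue : ℕ → Ω → ℕ × ℝ} {X : ℕ → Fin ℓ → Ω → ℕ × ℝ} {n : ℕ}

lemma measurable_gluing (hX : IsMarkedGluing P a ℓ glue X) : Measurable fun ω i => glue i ω :=
  measurable_pi_iff.2 hX.measurable_glue

lemma map_mark (hX : IsMarkedGluing P a ℓ glue X) (hn : 1 ≤ n) (j : Fin ℓ) :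
    P.map (X n j) = unifLaw a n :=
  hX.mark_uniform n hn j

lemma map_glue_succ (hX : IsMarkedGluing P a ℓ glue X) (hn : 1 ≤ n) :
    P.map (glue (n + 1)) = unifLaw a n :=
  hX.glue_uniform (n + 1) (by omega)

lemma ae_mark_mem (hX : IsMarkedGluing P a ℓ glue X) (hn : 1 ≤ n) :
    ∀ᵐ ω ∂P, ∀ j, X n j ω ∈ treePts a n :=
  ae_all_iff.2 fun j => ae_of_ae_map (hX.measurable_mark n j).aemeasurable
    (hX.map_mark hn j ▸ ae_mem_treePts a n)

lemma ae_validGluing (hX : IsMarkedGluing P a ℓ glue X) (n : ℕ) :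
    ∀ᵐ ω ∂P, ValidGluing a (fun i => glue i ω) n := by
  refine (ae_ball_iff (Finset.countable_toSet _)).2 fun i hi => ?_
  have hmap : P.map (glue i) = unifLaw a (i - 1) := hX.glue_uniform i (Finset.mem_Icc.1 hi).1
  exact ae_of_ae_map (hX.measurable_glue i).aemeasurable (hmap ▸ ae_mem_treePts a (i - 1))

lemma measurable_elim (hX : IsMarkedGluing P a ℓ glue X) (n : ℕ) :
    ∀ i, Measurable (Sum.elim (fun i : Finset.Icc 2 n => glue i) (X n) i)
  | .inl i => hX.measurable_glue i
  | .inr j => hX.measurable_mark n j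

lemma indepFun_glue_marks (hX : IsMarkedGluing P a ℓ glue X) (hn : 1 ≤ n) :
    IndepFun (fun ω (i : Finset.Icc 2 n) => glue i ω) (fun ω j => X n j ω) P :=
  indepFun_of_disjoint_range (hX.indep n hn) (hX.measurable_elim n) (e₁ := Sum.inl)
    (e₂ := Sum.inr) fun _ _ => Sum.inl_ne_inr

lemma indepFun_glue_glue_succ (hX : IsMarkedGluing P a ℓ glue X) (hn : 1 ≤ n) :
    IndepFun (fun ω (i : Finset.Icc 2 n) => glue i ω) (glue (n + 1)) P := by
  let e₁ (i : Finset.Icc 2 n) : Finset.Icc 2 (n + 1) ⊕ Fin ℓ :=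
    .inl ⟨i, Finset.mem_Icc.2 ⟨(Finset.mem_Icc.1 i.2).1, (Finset.mem_Icc.1 i.2).2.trans (by omega)⟩⟩
  let e₂ (_ : Unit) : Finset.Icc 2 (n + 1) ⊕ Fin ℓ :=
    .inl ⟨n + 1, Finset.mem_Icc.2 ⟨by omega, le_rfl⟩⟩
  have hne : ∀ k l, e₁ k ≠ e₂ l := fun k _ h => by
    have hk : (k : ℕ) = n + 1 := congrArg Subtype.val (Sum.inl_injective h)
    have := (Finset.mem_Icc.1 k.2).2
    omega
  exact (indepFun_of_disjoint_range (hX.indep (n + 1) (by omega)) (hX.measurable_elim (n + 1))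
    hne).comp (φ := id) (ψ := fun y : Unit → ℕ × ℝ => y ()) measurable_id (measurable_pi_apply _)

lemma indepFun_marks (hX : IsMarkedGluing P a ℓ glue X) (hn : 1 ≤ n) : iIndepFun (X n) P :=
  (hX.indep n hn).precomp (g := Sum.inr) Sum.inr_injective

variable [IsProbabilityMeasure P]

lemma map_marks (hX : IsMarkedGluing P a ℓ glue X) (hn : 1 ≤ n) :
    P.map (fun ω j => X n j ω) = Measure.pi fun _ => unifLaw a n := by
  rw [(iIndepFun_iff_map_fun_eq_pi_map fun j => (hX.measurable_mark n j).aemeasurable).1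
    (hX.indepFun_marks hn)]
  simp only [hX.map_mark hn]

lemma map_mark_pair (hX : IsMarkedGluing P a ℓ glue X) (hn : 1 ≤ n) {i j : Fin ℓ} (hij : i ≠ j) :
    P.map (fun ω => (X n i ω, X n j ω)) = (unifLaw a n).prod (unifLaw a n) := by
  rw [(indepFun_iff_map_prod_eq_prod_map_map (hX.measurable_mark n i).aemeasurable
      (hX.measurable_mark n j).aemeasurable).1 ((hX.indepFun_marks hn).indepFun hij),
    hX.map_mark hn, hX.map_mark hn]

section Conditioning

variable {β E : Type*} [MeasurableSpace β] [NormedAddCommGroup E] [NormedSpace ℝ E] {Z : Ω → β}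

lemma lintegral_of_indepFun_glue (hX : IsMarkedGluing P a ℓ glue X) (hZ : Measurable Z)
    (hind : IndepFun (fun ω (i : Finset.Icc 2 n) => glue i ω) Z P)
    {F : (ℕ → ℕ × ℝ) → β → ENNReal} (hF : Measurable (Function.uncurry F))
    (hdep : ∀ z, DependsOn (F · z) (Finset.Icc 2 n)) :
    ∫⁻ ω, F (fun i => glue i ω) (Z ω) ∂P = ∫⁻ ω, ∫⁻ z, F (fun i => glue i ω) z ∂P.map Z ∂P := by
  have hroot z ω := apply_updateFinset_of_dependsOn (hdep z) (fun _ => treeRoot) fun i => glue i ω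
  have := lintegral_comp_of_indepFun hind
    (measurable_pi_iff.2 fun i => hX.measurable_glue i) hZ
    (F := fun y => F (Function.updateFinset (fun _ => treeRoot) (Finset.Icc 2 n) y))
    (hF.comp ((measurable_updateFinset.comp measurable_fst).prodMk measurable_snd))
  simpa only [hroot] using this

lemma integral_of_indepFun_glue (hX : IsMarkedGluing P a ℓ glue X) (hZ : Measurable Z)
    (hind : IndepFun (fun ω (i : Finset.Icc 2 n) => glue i ω) Z P)
    {F : (ℕ → ℕ × ℝ) → β → E} (hF : StronglyMeasurable (Function.uncurry F))
    (hdep : ∀ z, DependsOn (F · z) (Finset.Icc 2 n))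
    (hint : Integrable (fun ω => F (fun i => glue i ω) (Z ω)) P) :
    ∫ ω, F (fun i => glue i ω) (Z ω) ∂P = ∫ ω, ∫ z, F (fun i => glue i ω) z ∂P.map Z ∂P := by
  have hroot z ω := apply_updateFinset_of_dependsOn (hdep z) (fun _ => treeRoot) fun i => glue i ω
  have := integral_comp_of_indepFun hind
    (measurable_pi_iff.2 fun i => hX.measurable_glue i) hZ
    (F := fun y => F (Function.updateFinset (fun _ => treeRoot) (Finset.Icc 2 n) y))
    (hF.comp_measurable ((measurable_updateFinset.comp measurable_fst).prodMk measurable_snd))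
    (by simpa only [hroot] using hint)
  simpa only [hroot] using this

lemma lintegral_glue_succ (hX : IsMarkedGluing P a ℓ glue X) (hn : 1 ≤ n)
    {F : (ℕ → ℕ × ℝ) → ℕ × ℝ → ENNReal} (hF : Measurable (Function.uncurry F))
    (hdep : ∀ y, DependsOn (F · y) (Finset.Icc 2 n)) :
    ∫⁻ ω, F (fun i => glue i ω) (glue (n + 1) ω) ∂P =
      ∫⁻ ω, ∫⁻ y, F (fun i => glue i ω) y ∂unifLaw a n ∂P := by
  rw [hX.lintegral_of_indepFun_glue (hX.measurable_glue _) (hX.indepFun_glue_glue_succ hn) hF hdep,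
    hX.map_glue_succ hn]

lemma integral_glue_succ (hX : IsMarkedGluing P a ℓ glue X) (hn : 1 ≤ n)
    {F : (ℕ → ℕ × ℝ) → ℕ × ℝ → E} (hF : StronglyMeasurable (Function.uncurry F))
    (hdep : ∀ y, DependsOn (F · y) (Finset.Icc 2 n))
    (hint : Integrable (fun ω => F (fun i => glue i ω) (glue (n + 1) ω)) P) :
    ∫ ω, F (fun i => glue i ω) (glue (n + 1) ω) ∂P =
      ∫ ω, ∫ y, F (fun i => glue i ω) y ∂unifLaw a n ∂P := by
  rw [hX.integral_of_indepFun_glue (hX.measurable_glue _) (hX.indepFun_glue_glue_succ hn) hF hdep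
    hint, hX.map_glue_succ hn]

lemma integral_marks (hX : IsMarkedGluing P a ℓ glue X) (hn : 1 ≤ n)
    {F : (ℕ → ℕ × ℝ) → (Fin ℓ → ℕ × ℝ) → E} (hF : StronglyMeasurable (Function.uncurry F))
    (hdep : ∀ x, DependsOn (F · x) (Finset.Icc 2 n))
    (hint : Integrable (fun ω => F (fun i => glue i ω) fun j => X n j ω) P) :
    ∫ ω, F (fun i => glue i ω) (fun j => X n j ω) ∂P =
      ∫ ω, ∫ x, F (fun i => glue i ω) x ∂Measure.pi (fun _ => unifLaw a n) ∂P := by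
  rw [hX.integral_of_indepFun_glue (measurable_pi_iff.2 (hX.measurable_mark n))
    (hX.indepFun_glue_marks hn) hF hdep hint, hX.map_marks hn]

lemma lintegral_mark_pair (hX : IsMarkedGluing P a ℓ glue X) (hn : 1 ≤ n) {i j : Fin ℓ}
    (hij : i ≠ j) {F : (ℕ → ℕ × ℝ) → (ℕ × ℝ) × (ℕ × ℝ) → ENNReal}
    (hF : Measurable (Function.uncurry F)) (hdep : ∀ x, DependsOn (F · x) (Finset.Icc 2 n)) :
    ∫⁻ ω, F (fun i => glue i ω) (X n i ω, X n j ω) ∂P =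
      ∫⁻ ω, ∫⁻ x, F (fun i => glue i ω) x ∂(unifLaw a n).prod (unifLaw a n) ∂P := by
  have hpair : Measurable fun x : Fin ℓ → ℕ × ℝ => (x i, x j) := by fun_prop
  rw [hX.lintegral_of_indepFun_glue ((hX.measurable_mark n i).prodMk (hX.measurable_mark n j))
    ((hX.indepFun_glue_marks hn).comp measurable_id hpair) hF hdep, hX.map_mark_pair hn hij]

end Conditioning

end IsMarkedGluing

/-- The Laplace transform of the uniform law on `[0, 1]`, on the whole complex plane. -/
noncomputable def unifMgf (z : ℂ) : ℂ := ∫ u in (0 : ℝ)..1, Complex.exp (z * u)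

/-- The Laplace transform, at a complex argument, of the height of a uniform point of the tree
`T_n` with gluing points `g`. -/
noncomputable def heightTransform (a : ℕ → ℝ) (n : ℕ) (z : ℂ) (g : ℕ → ℕ × ℝ) : ℂ :=
  ∫ x, Complex.exp (z * height g n x) ∂unifLaw a n

/-- The mean of `heightTransform a n z` over the gluing points, as a product over the segments. -/
noncomputable def heightProd (a : ℕ → ℝ) (n : ℕ) (z : ℂ) : ℂ :=
  ∏ k ∈ Finset.Icc 1 n, (1 + segProb a k * (unifMgf (z * a k) - 1))

section HeightTransform

variable {a : ℕ → ℝ} {n : ℕ} {g : ℕ → ℕ × ℝ}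

lemma heightProd_succ (a : ℕ → ℝ) (n : ℕ) (z : ℂ) : heightProd a (n + 1) z =
    heightProd a n z * (1 + segProb a (n + 1) * (unifMgf (z * a (n + 1)) - 1)) :=
  Finset.prod_Icc_succ_top (by omega) _

lemma norm_exp_mul_height_le (ha : ∀ n, 1 ≤ n → 0 < a n) (hg : ValidGluing a g n) (z : ℂ)
    {x : ℕ × ℝ} (hx : x ∈ treePts a n) :
    ‖Complex.exp (z * height g n x)‖ ≤ Real.exp (‖z‖ * totalLength a n) := by
  refine (Complex.norm_exp_le_exp_norm _).trans (Real.exp_le_exp.2 ?_)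
  rw [norm_mul, Complex.norm_real, Real.norm_of_nonneg (height_nonneg hg hx)]
  exact mul_le_mul_of_nonneg_left (height_le_totalLength ha hg hx) (norm_nonneg z)

lemma integrable_exp_mul_height (ha : ∀ n, 1 ≤ n → 0 < a n) (hn : 1 ≤ n) (hg : ValidGluing a g n)
    (z : ℂ) : Integrable (fun x => Complex.exp (z * height g n x)) (unifLaw a n) := by
  have := isProbabilityMeasure_unifLaw ha hn
  refine .of_bound (by fun_prop) (Real.exp (‖z‖ * totalLength a n)) ?_
  filter_upwards [ae_mem_treePts a n] with x hx using norm_exp_mul_height_le ha hg z hx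

lemma norm_heightTransform_le (ha : ∀ n, 1 ≤ n → 0 < a n) (hn : 1 ≤ n) (hg : ValidGluing a g n)
    (z : ℂ) : ‖heightTransform a n z g‖ ≤ Real.exp (‖z‖ * totalLength a n) := by
  have := isProbabilityMeasure_unifLaw ha hn
  refine (norm_integral_le_of_norm_le_const (C := Real.exp (‖z‖ * totalLength a n)) ?_).trans
    (by simp)
  filter_upwards [ae_mem_treePts a n] with x hx using norm_exp_mul_height_le ha hg z hx

lemma measurable_heightTransform (ha : ∀ n, 1 ≤ n → 0 < a n) (hn : 1 ≤ n) (z : ℂ) :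
    Measurable (heightTransform a n z) := by
  have := isProbabilityMeasure_unifLaw ha hn
  have hexp : Measurable fun x : (ℕ → ℕ × ℝ) × (ℕ × ℝ) => Complex.exp (z * height x.1 n x.2) := by
    fun_prop
  exact hexp.stronglyMeasurable.integral_prod_right'.measurable

lemma dependsOn_heightTransform (a : ℕ → ℝ) (n : ℕ) (z : ℂ) :
    DependsOn (heightTransform a n z) (Finset.Icc 2 n) := fun g g' h => by
  simp only [heightTransform, fun x => dependsOn_height n x h]

lemma integral_segLaw_exp_mul_height (a : ℕ → ℝ) (n : ℕ) (z : ℂ) (g : ℕ → ℕ × ℝ) :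
    ∫ x, Complex.exp (z * height g (n + 1) x) ∂segLaw a (n + 1) =
      unifMgf (z * a (n + 1)) * Complex.exp (z * height g n (g (n + 1))) := by
  have hexp : Measurable fun x => Complex.exp (z * height g (n + 1) x) := by fun_prop
  rw [integral_segLaw hexp.stronglyMeasurable, unifMgf, ← intervalIntegral.integral_mul_const]
  refine intervalIntegral.integral_congr fun u _ => ?_
  rw [height_succ_of_eq rfl, ← Complex.exp_add]
  push_cast
  ring_nf

lemma heightTransform_one (ha : ∀ n, 1 ≤ n → 0 < a n) (z : ℂ) (g : ℕ → ℕ × ℝ) :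
    heightTransform a 1 z g = unifMgf (z * a 1) := by
  rw [heightTransform, unifLaw_one ha, integral_segLaw_exp_mul_height]
  simp [height]

lemma heightTransform_succ (ha : ∀ n, 1 ≤ n → 0 < a n) (hn : 1 ≤ n)
    (hg : ValidGluing a g (n + 1)) (z : ℂ) :
    heightTransform a (n + 1) z g = (1 - segProb a (n + 1)) * heightTransform a n z g +
      segProb a (n + 1) *
        (unifMgf (z * a (n + 1)) * Complex.exp (z * height g n (g (n + 1)))) := by
  have hold : ∫ x, Complex.exp (z * height g (n + 1) x) ∂unifLaw a n = heightTransform a n z g := by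
    refine integral_congr_ae ?_
    filter_upwards [ae_mem_treePts a n] with x hx
    rw [height_succ_of_ne (fst_ne_succ_of_mem_treePts hx)]
  rw [heightTransform, integral_unifLaw_succ ha hn (integrable_exp_mul_height ha (by omega) hg z),
    hold, integral_segLaw_exp_mul_height, Complex.real_smul, Complex.real_smul]
  push_cast
  rfl

end HeightTransform

namespace IsMarkedGluing

variable {Ω : Type*} [MeasurableSpace Ω] {P : Measure Ω} {a : ℕ → ℝ}
  {ℓ : ℕ} {glue : ℕ → Ω → ℕ × ℝ} {X : ℕ → Fin ℓ → Ω → ℕ × ℝ} {n : ℕ}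

lemma measurable_height_mark (hX : IsMarkedGluing P a ℓ glue X) (n : ℕ) (j : Fin ℓ) :
    Measurable fun ω => height (fun i => glue i ω) n (X n j ω) :=
  measurable_height hX.measurable_gluing (hX.measurable_mark n j)

variable [IsProbabilityMeasure P]

lemma integrable_heightTransform (hX : IsMarkedGluing P a ℓ glue X)
    (ha : ∀ n, 1 ≤ n → 0 < a n) (hn : 1 ≤ n) (z : ℂ) :
    Integrable (fun ω => heightTransform a n z fun i => glue i ω) P := by
  refine .of_bound ((measurable_heightTransform ha hn z).comp hX.measurable_gluing
    |>.aestronglyMeasurable) (Real.exp (‖z‖ * totalLength a n)) ?_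
  filter_upwards [hX.ae_validGluing n] with ω hg using norm_heightTransform_le ha hn hg z

lemma integrable_exp_mul_height_glue_succ (hX : IsMarkedGluing P a ℓ glue X)
    (ha : ∀ n, 1 ≤ n → 0 < a n) (hn : 1 ≤ n) (z : ℂ) :
    Integrable (fun ω => Complex.exp (z * height (fun i => glue i ω) n (glue (n + 1) ω))) P := by
  have := measurable_height hX.measurable_gluing (hX.measurable_glue (n + 1)) (n := n)
  refine .of_bound (Measurable.aestronglyMeasurable (by fun_prop))
    (Real.exp (‖z‖ * totalLength a n)) ?_
  filter_upwards [hX.ae_validGluing (n + 1)] with ω hg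
  exact norm_exp_mul_height_le ha hg.of_succ z (hg.glue_mem hn)

lemma integral_heightTransform (hX : IsMarkedGluing P a ℓ glue X) (ha : ∀ n, 1 ≤ n → 0 < a n)
    (hn : 1 ≤ n) (z : ℂ) :
    ∫ ω, heightTransform a n z (fun i => glue i ω) ∂P = heightProd a n z := by
  induction n, hn using Nat.le_induction with
  | base => simp [heightTransform_one ha, heightProd, segProb_one ha]
  | succ n hn ih =>
    have hexp : Measurable fun x : (ℕ → ℕ × ℝ) × (ℕ × ℝ) =>
        Complex.exp (z * height x.1 n x.2) := by fun_prop
    have hglue : ∫ ω, Complex.exp (z * height (fun i => glue i ω) n (glue (n + 1) ω)) ∂P =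
        heightProd a n z := by
      rw [← ih]
      exact hX.integral_glue_succ hn (F := fun g y => Complex.exp (z * height g n y))
        hexp.stronglyMeasurable (fun y g g' h => by simp only [dependsOn_height n y h])
        (hX.integrable_exp_mul_height_glue_succ ha hn z)
    have hsucc : ∀ᵐ ω ∂P, heightTransform a (n + 1) z (fun i => glue i ω) = _ :=
      (hX.ae_validGluing (n + 1)).mono fun ω hg => heightTransform_succ ha hn hg z
    rw [integral_congr_ae hsucc, integral_add ((hX.integrable_heightTransform ha hn z).const_mul _)
      (((hX.integrable_exp_mul_height_glue_succ ha hn z).const_mul _).const_mul _),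
      integral_const_mul, integral_const_mul, integral_const_mul, ih, hglue, heightProd_succ]
    ring

lemma integral_prod_exp_mul_height (hX : IsMarkedGluing P a ℓ glue X)
    (ha : ∀ n, 1 ≤ n → 0 < a n) (hn : 1 ≤ n) (z : Fin ℓ → ℂ) :
    ∫ ω, ∏ j, Complex.exp (z j * height (fun i => glue i ω) n (X n j ω)) ∂P =
      ∫ ω, ∏ j, heightTransform a n (z j) (fun i => glue i ω) ∂P := by
  have := isProbabilityMeasure_unifLaw ha hn
  have := hX.measurable_height_mark n
  have hF : Measurable fun x : (ℕ → ℕ × ℝ) × (Fin ℓ → ℕ × ℝ) =>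
      ∏ j, Complex.exp (z j * height x.1 n (x.2 j)) := by fun_prop
  have hint : Integrable
      (fun ω => ∏ j, Complex.exp (z j * height (fun i => glue i ω) n (X n j ω))) P := by
    refine .of_bound (Measurable.aestronglyMeasurable (by fun_prop))
      (∏ j, Real.exp (‖z j‖ * totalLength a n)) ?_
    filter_upwards [hX.ae_validGluing n, hX.ae_mark_mem hn] with ω hg hmark
    rw [norm_prod]
    exact Finset.prod_le_prod (fun _ _ => norm_nonneg _)
      fun j _ => norm_exp_mul_height_le ha hg (z j) (hmark j)
  rw [hX.integral_marks hn (F := fun g x => ∏ j, Complex.exp (z j * height g n (x j)))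
    hF.stronglyMeasurable (fun x g g' h => by simp only [fun j => dependsOn_height n (x j) h]) hint]
  exact integral_congr_ae (.of_forall fun ω => integral_fintype_prod_eq_prod
    (μ := fun _ => unifLaw a n) (fun j x => Complex.exp (z j * height (fun i => glue i ω) n x)))

lemma integral_exp_mul_height (hX : IsMarkedGluing P a ℓ glue X)
    (ha : ∀ n, 1 ≤ n → 0 < a n) (hn : 1 ≤ n) (z : ℂ) (j : Fin ℓ) :
    ∫ ω, Complex.exp (z * height (fun i => glue i ω) n (X n j ω)) ∂P = heightProd a n z := by
  have := isProbabilityMeasure_unifLaw ha hn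
  have hsingle := hX.integral_prod_exp_mul_height ha hn (Pi.single j z)
  have hexp (g : ℕ → ℕ × ℝ) (x : Fin ℓ → ℕ × ℝ) :
      ∏ i, Complex.exp (Pi.single (M := fun _ => ℂ) j z i * height g n (x i)) =
        Complex.exp (z * height g n (x j)) := by
    rw [Finset.prod_eq_single j (fun i _ hij => by simp [hij]) (by simp), Pi.single_eq_same]
  have htransform (g : ℕ → ℕ × ℝ) :
      ∏ i, heightTransform a n (Pi.single (M := fun _ => ℂ) j z i) g = heightTransform a n z g := by
    rw [Finset.prod_eq_single j (fun i _ hij => by simp [hij, heightTransform]) (by simp),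
      Pi.single_eq_same]
  simpa only [hexp, htransform, hX.integral_heightTransform ha hn] using hsingle

end IsMarkedGluing

section Decorrelation

lemma norm_prod_sub_prod_le_sum {ι R : Type*} [NormedCommRing R] [NormOneClass R] (s : Finset ι)
    {u v : ι → R} (hu : ∀ i ∈ s, ‖u i‖ ≤ 1) (hv : ∀ i ∈ s, ‖v i‖ ≤ 1) :
    ‖∏ i ∈ s, u i - ∏ i ∈ s, v i‖ ≤ ∑ i ∈ s, ‖u i - v i‖ := by
  classical
  induction s using Finset.induction_on with
  | empty => simp
  | insert i s hi ih =>
    simp only [Finset.forall_mem_insert] at hu hv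
    have hprod : ‖∏ j ∈ s, u j‖ ≤ 1 :=
      (Finset.norm_prod_le s u).trans (Finset.prod_le_one (fun _ _ => norm_nonneg _) hu.2)
    rw [Finset.prod_insert hi, Finset.prod_insert hi, Finset.sum_insert hi]
    calc ‖u i * ∏ j ∈ s, u j - v i * ∏ j ∈ s, v j‖
        = ‖(u i - v i) * ∏ j ∈ s, u j + v i * (∏ j ∈ s, u j - ∏ j ∈ s, v j)‖ := by ring_nf
      _ ≤ ‖u i - v i‖ * ‖∏ j ∈ s, u j‖ + ‖v i‖ * ‖∏ j ∈ s, u j - ∏ j ∈ s, v j‖ :=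
          (norm_add_le _ _).trans (add_le_add (norm_mul_le _ _) (norm_mul_le _ _))
      _ ≤ ‖u i - v i‖ + ∑ j ∈ s, ‖u j - v j‖ := by
          gcongr
          · exact mul_le_of_le_one_right (norm_nonneg _) hprod
          · exact (mul_le_of_le_one_left (norm_nonneg _) hv.1).trans (ih hu.2 hv.2)

lemma integral_norm_add_sub_integral_sq_le {α E : Type*} [MeasurableSpace α] {μ : Measure α}
    [IsProbabilityMeasure μ] [NormedAddCommGroup E] [InnerProductSpace ℝ E] [CompleteSpace E]
    {f : α → E} (hf : AEStronglyMeasurable f μ) {C : ℝ} (hC : ∀ᵐ x ∂μ, ‖f x‖ ≤ C) (u : E) :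
    ∫ x, ‖u + (f x - ∫ y, f y ∂μ)‖ ^ 2 ∂μ ≤ ‖u‖ ^ 2 + C ^ 2 := by
  set m := ∫ y, f y ∂μ
  have hint : Integrable f μ := .of_bound hf C hC
  have hsq : ∀ᵐ x ∂μ, ‖f x‖ ^ 2 ≤ C ^ 2 :=
    hC.mono fun x hx => pow_le_pow_left₀ (norm_nonneg _) hx 2
  have hintsq : Integrable (fun x => ‖f x‖ ^ 2) μ :=
    .of_bound (hf.norm.pow 2) (C ^ 2) (by simpa using hsq)
  have hexpand : ∀ x, ‖u + (f x - m)‖ ^ 2 =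
      ‖u - m‖ ^ 2 + 2 * inner ℝ (u - m) (f x) + ‖f x‖ ^ 2 := fun x => by
    rw [← norm_add_sq_real, sub_add_eq_add_sub, add_sub_assoc]
  have hinner : Integrable (fun x => 2 * inner ℝ (u - m) (f x)) μ :=
    (hint.const_inner (u - m)).const_mul 2
  have hinner' : Integrable (fun x => ‖u - m‖ ^ 2 + 2 * inner ℝ (u - m) (f x)) μ :=
    (integrable_const _).add hinner
  have hmean : ∫ x, 2 * inner ℝ (u - m) (f x) ∂μ = 2 * inner ℝ (u - m) m := by
    rw [integral_const_mul, integral_inner hint]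
  calc ∫ x, ‖u + (f x - m)‖ ^ 2 ∂μ
      = ‖u - m‖ ^ 2 + 2 * inner ℝ (u - m) m + ∫ x, ‖f x‖ ^ 2 ∂μ := by
        simp only [hexpand]
        rw [integral_add hinner' hintsq,
          integral_add (integrable_const _) hinner, hmean, integral_const, probReal_univ, one_smul]
    _ = ‖u‖ ^ 2 - ‖m‖ ^ 2 + ∫ x, ‖f x‖ ^ 2 ∂μ := by
        have := norm_add_sq_real (u - m) m
        rw [sub_add_cancel] at this
        linarith
    _ ≤ ‖u‖ ^ 2 + C ^ 2 := by
        have : ∫ x, ‖f x‖ ^ 2 ∂μ ≤ C ^ 2 := by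
          simpa using integral_mono_ae hintsq (integrable_const _) hsq
        linarith [sq_nonneg ‖m‖]

lemma exists_forall_sum_Ioc_lt {f : ℕ → ℝ} (hf : Summable f) {ε : ℝ} (hε : 0 < ε) :
    ∃ m, 1 ≤ m ∧ ∀ n, ∑ k ∈ Finset.Ioc m n, f k < ε := by
  obtain ⟨s, hs⟩ := summable_iff_vanishing.1 hf _ (Iio_mem_nhds hε)
  refine ⟨s.sup id + 1, by omega, fun n => hs _ (Finset.disjoint_left.2 fun k hk hks => ?_)⟩
  have : k ≤ s.sup id := Finset.le_sup (f := id) hks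
  have := (Finset.mem_Ioc.1 hk).1
  omega

end Decorrelation

section CharacteristicFunction

variable {a : ℕ → ℝ} {n : ℕ}

lemma norm_exp_ofReal_mul_I_mul_ofReal (t x : ℝ) : ‖Complex.exp (t * Complex.I * x)‖ = 1 := by
  rw [mul_right_comm, ← Complex.ofReal_mul, Complex.norm_exp_ofReal_mul_I]

lemma norm_unifMgf_ofReal_mul_I_le (t : ℝ) : ‖unifMgf (t * Complex.I)‖ ≤ 1 :=
  (intervalIntegral.norm_integral_le_of_norm_le_const (C := 1)
    fun u _ => (norm_exp_ofReal_mul_I_mul_ofReal t u).le).trans (by simp)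

lemma norm_one_add_mul_sub_one_le {p : ℝ} (hp0 : 0 ≤ p) (hp1 : p ≤ 1) {w : ℂ} (hw : ‖w‖ ≤ 1) :
    ‖1 + p * (w - 1)‖ ≤ 1 := by
  calc ‖1 + p * (w - 1)‖ = ‖((1 - p : ℝ) : ℂ) + (p : ℝ) * w‖ := by push_cast; ring_nf
    _ ≤ (1 - p) + p * ‖w‖ := by
        refine (norm_add_le _ _).trans_eq ?_
        rw [norm_mul, Complex.norm_real, Complex.norm_real, Real.norm_of_nonneg hp0,
          Real.norm_of_nonneg (sub_nonneg.2 hp1)]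
    _ ≤ 1 := by nlinarith

lemma norm_heightTransform_ofReal_mul_I_le (ha : ∀ n, 1 ≤ n → 0 < a n) (hn : 1 ≤ n) (t : ℝ)
    (g : ℕ → ℕ × ℝ) : ‖heightTransform a n (t * Complex.I) g‖ ≤ 1 := by
  have := isProbabilityMeasure_unifLaw ha hn
  exact (norm_integral_le_of_norm_le_const (C := 1)
    (.of_forall fun x => (norm_exp_ofReal_mul_I_mul_ofReal t _).le)).trans (by simp)

lemma norm_heightTransform_ofReal_mul_I_sub_one_le (ha : ∀ n, 1 ≤ n → 0 < a n) (hn : 1 ≤ n)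
    {g : ℕ → ℕ × ℝ} (hg : ValidGluing a g n) (t : ℝ) :
    ‖heightTransform a n (t * Complex.I) g - 1‖ ≤ |t| * totalLength a n := by
  have := isProbabilityMeasure_unifLaw ha hn
  have hsub : heightTransform a n (t * Complex.I) g - 1 =
      ∫ x, (Complex.exp (t * Complex.I * height g n x) - 1) ∂unifLaw a n := by
    rw [integral_sub (integrable_exp_mul_height ha hn hg _) (integrable_const _)]
    simp [heightTransform]
  rw [hsub]
  refine (norm_integral_le_of_norm_le_const (C := |t| * totalLength a n) ?_).trans (by simp)
  filter_upwards [ae_mem_treePts a n] with x hx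
  calc ‖Complex.exp (t * Complex.I * height g n x) - 1‖ ≤ ‖t * height g n x‖ := by
        convert Real.norm_exp_I_mul_ofReal_sub_one_le using 4
        push_cast
        ring
    _ ≤ |t| * totalLength a n := by
        rw [norm_mul, Real.norm_eq_abs, Real.norm_of_nonneg (height_nonneg hg hx)]
        exact mul_le_mul_of_nonneg_left (height_le_totalLength ha hg hx) (abs_nonneg t)

lemma integral_norm_add_mul_exp_sub_sq_le (ha : ∀ n, 1 ≤ n → 0 < a n) (hn : 1 ≤ n) (t : ℝ)
    (g : ℕ → ℕ × ℝ) (u c : ℂ) :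
    ∫ y, ‖u + (c * Complex.exp (t * Complex.I * height g n y) -
      c * heightTransform a n (t * Complex.I) g)‖ ^ 2 ∂unifLaw a n ≤ ‖u‖ ^ 2 + ‖c‖ ^ 2 := by
  have := isProbabilityMeasure_unifLaw ha hn
  have hmeas : Measurable fun y => c * Complex.exp (t * Complex.I * height g n y) := by fun_prop
  have hbound (y : ℕ × ℝ) : ‖c * Complex.exp (t * Complex.I * height g n y)‖ ≤ ‖c‖ := by
    rw [norm_mul, norm_exp_ofReal_mul_I_mul_ofReal, mul_one]
  simpa only [integral_const_mul, heightTransform] using integral_norm_add_sub_integral_sq_le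
    (μ := unifLaw a n) hmeas.aestronglyMeasurable (.of_forall hbound) u

lemma integral_norm_one_add_mul_sub_one_mul_add_sq_le (ha : ∀ n, 1 ≤ n → 0 < a n) (hn : 1 ≤ n)
    (t : ℝ) (g : ℕ → ℕ × ℝ) (d : ℂ) {p : ℝ} (hp0 : 0 ≤ p) (hp1 : p ≤ 1) {w : ℂ} (hw : ‖w‖ ≤ 1) :
    ∫ y, ‖(1 + p * (w - 1)) * d + (p * w * Complex.exp (t * Complex.I * height g n y) -
      p * w * heightTransform a n (t * Complex.I) g)‖ ^ 2 ∂unifLaw a n ≤ ‖d‖ ^ 2 + p ^ 2 := by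
  refine (integral_norm_add_mul_exp_sub_sq_le ha hn t g _ (p * w)).trans ?_
  gcongr
  · exact (norm_mul_le _ _).trans (mul_le_of_le_one_left (norm_nonneg _)
      (norm_one_add_mul_sub_one_le hp0 hp1 hw))
  · rw [norm_mul, Complex.norm_real, Real.norm_of_nonneg hp0]
    exact mul_le_of_le_one_right hp0 hw

lemma heightTransform_succ_sub_heightProd_succ (ha : ∀ n, 1 ≤ n → 0 < a n) (hn : 1 ≤ n)
    {g : ℕ → ℕ × ℝ} (hg : ValidGluing a g (n + 1)) (z : ℂ) :
    heightTransform a (n + 1) z g - heightProd a (n + 1) z =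
      (1 + segProb a (n + 1) * (unifMgf (z * a (n + 1)) - 1)) *
          (heightTransform a n z g - heightProd a n z) +
        (segProb a (n + 1) * unifMgf (z * a (n + 1)) * Complex.exp (z * height g n (g (n + 1))) -
          segProb a (n + 1) * unifMgf (z * a (n + 1)) * heightTransform a n z g) := by
  rw [heightTransform_succ ha hn hg, heightProd_succ]
  ring

end CharacteristicFunction

/-- The mean square distance, over the gluing points, between the characteristic function of the
height of a uniform point of `T_n` given the gluing points and the one of its unconditional law. -/
noncomputable def heightVar {Ω : Type*} [MeasurableSpace Ω] (P : Measure Ω) (a : ℕ → ℝ)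
    (glue : ℕ → Ω → ℕ × ℝ) (n : ℕ) (t : ℝ) : ℝ :=
  ∫ ω, ‖heightTransform a n (t * Complex.I) (fun i => glue i ω) -
    heightProd a n (t * Complex.I)‖ ^ 2 ∂P

namespace IsMarkedGluing

variable {Ω : Type*} [MeasurableSpace Ω] {P : Measure Ω} [IsProbabilityMeasure P] {a : ℕ → ℝ}
  {ℓ : ℕ} {glue : ℕ → Ω → ℕ × ℝ} {X : ℕ → Fin ℓ → Ω → ℕ × ℝ} {m n : ℕ}

lemma norm_heightProd_ofReal_mul_I_le (hX : IsMarkedGluing P a ℓ glue X)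
    (ha : ∀ n, 1 ≤ n → 0 < a n) (hn : 1 ≤ n) (t : ℝ) : ‖heightProd a n (t * Complex.I)‖ ≤ 1 := by
  rw [← hX.integral_heightTransform ha hn]
  exact (norm_integral_le_of_norm_le_const (C := 1)
    (.of_forall fun ω => norm_heightTransform_ofReal_mul_I_le ha hn t _)).trans (by simp)

lemma norm_heightProd_ofReal_mul_I_sub_one_le (hX : IsMarkedGluing P a ℓ glue X)
    (ha : ∀ n, 1 ≤ n → 0 < a n) (hn : 1 ≤ n) (t : ℝ) :
    ‖heightProd a n (t * Complex.I) - 1‖ ≤ |t| * totalLength a n := by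
  have hsub : heightProd a n (t * Complex.I) - 1 =
      ∫ ω, (heightTransform a n (t * Complex.I) (fun i => glue i ω) - 1) ∂P := by
    rw [integral_sub (hX.integrable_heightTransform ha hn _) (integrable_const _),
      hX.integral_heightTransform ha hn]
    simp
  rw [hsub]
  refine (norm_integral_le_of_norm_le_const (C := |t| * totalLength a n) ?_).trans (by simp)
  filter_upwards [hX.ae_validGluing n] with ω hg
  exact norm_heightTransform_ofReal_mul_I_sub_one_le ha hn hg t

lemma integrable_norm_heightTransform_sub_heightProd_sq (hX : IsMarkedGluing P a ℓ glue X)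
    (ha : ∀ n, 1 ≤ n → 0 < a n) (hn : 1 ≤ n) (t : ℝ) :
    Integrable (fun ω => ‖heightTransform a n (t * Complex.I) (fun i => glue i ω) -
      heightProd a n (t * Complex.I)‖ ^ 2) P := by
  have := (hX.integrable_heightTransform ha hn (t * Complex.I)).aestronglyMeasurable
  refine .of_bound ((this.sub aestronglyMeasurable_const).norm.pow 2) ((1 + 1) ^ 2)
    (.of_forall fun ω => ?_)
  rw [Real.norm_of_nonneg (by positivity)]
  exact pow_le_pow_left₀ (norm_nonneg _) ((norm_sub_le _ _).trans (add_le_add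
    (norm_heightTransform_ofReal_mul_I_le ha hn t _)
    (hX.norm_heightProd_ofReal_mul_I_le ha hn t))) 2

lemma heightVar_le_sq (hX : IsMarkedGluing P a ℓ glue X) (ha : ∀ n, 1 ≤ n → 0 < a n)
    (hn : 1 ≤ n) (t : ℝ) : heightVar P a glue n t ≤ (2 * (|t| * totalLength a n)) ^ 2 := by
  have hle : ∀ᵐ ω ∂P, ‖heightTransform a n (t * Complex.I) (fun i => glue i ω) -
      heightProd a n (t * Complex.I)‖ ^ 2 ≤ (2 * (|t| * totalLength a n)) ^ 2 := by
    filter_upwards [hX.ae_validGluing n] with ω hg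
    refine pow_le_pow_left₀ (norm_nonneg _) ?_ 2
    rw [← sub_sub_sub_cancel_right _ _ (1 : ℂ), two_mul]
    exact (norm_sub_le _ _).trans (add_le_add
      (norm_heightTransform_ofReal_mul_I_sub_one_le ha hn hg t)
      (hX.norm_heightProd_ofReal_mul_I_sub_one_le ha hn t))
  simpa [heightVar] using integral_mono_ae
    (hX.integrable_norm_heightTransform_sub_heightProd_sq ha hn t) (integrable_const _) hle

/- Given the gluing points of `T_n`, the only new randomness is that of `exp(i t h)` at the gluing
point of `b_(n+1)`, whose conditional mean is the transform of `T_n`: the cross terms vanish. -/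
lemma heightVar_succ_le (hX : IsMarkedGluing P a ℓ glue X) (ha : ∀ n, 1 ≤ n → 0 < a n)
    (hn : 1 ≤ n) (t : ℝ) :
    heightVar P a glue (n + 1) t ≤ heightVar P a glue n t + segProb a (n + 1) ^ 2 := by
  set z : ℂ := t * Complex.I with hz
  set p := segProb a (n + 1)
  set w := unifMgf (z * a (n + 1)) with hw
  have hw1 : ‖w‖ ≤ 1 := by
    rw [hw, hz, mul_right_comm, ← Complex.ofReal_mul]
    exact norm_unifMgf_ofReal_mul_I_le _
  let D (g : ℕ → ℕ × ℝ) : ℂ := (1 + p * (w - 1)) * (heightTransform a n z g - heightProd a n z)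
  let F (g : ℕ → ℕ × ℝ) (y : ℕ × ℝ) : ℝ := ‖D g + (p * w * Complex.exp (z * height g n y) -
    p * w * heightTransform a n z g)‖ ^ 2
  have hF : Measurable (Function.uncurry F) := by
    have : Measurable fun x : (ℕ → ℕ × ℝ) × (ℕ × ℝ) => heightTransform a n z x.1 :=
      (measurable_heightTransform ha hn z).comp measurable_fst
    dsimp only [F, D, Function.uncurry_def]
    fun_prop
  have hdep (y : ℕ × ℝ) : DependsOn (F · y) (Finset.Icc 2 n) := fun g g' h => by
    simp only [F, D, dependsOn_height n y h, dependsOn_heightTransform a n z h]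
  have hsucc : ∀ᵐ ω ∂P, ‖heightTransform a (n + 1) z (fun i => glue i ω) -
      heightProd a (n + 1) z‖ ^ 2 = F (fun i => glue i ω) (glue (n + 1) ω) := by
    filter_upwards [hX.ae_validGluing (n + 1)] with ω hg
    rw [heightTransform_succ_sub_heightProd_succ ha hn hg]
  have hint := hX.integrable_norm_heightTransform_sub_heightProd_sq ha hn t
  have hcond (g : ℕ → ℕ × ℝ) : ∫ y, F g y ∂unifLaw a n ≤
      ‖heightTransform a n z g - heightProd a n z‖ ^ 2 + p ^ 2 :=
    integral_norm_one_add_mul_sub_one_mul_add_sq_le ha hn t g _ (segProb_pos ha (by omega)).le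
      (segProb_le_one ha (by omega)) hw1
  calc heightVar P a glue (n + 1) t
      = ∫ ω, ∫ y, F (fun i => glue i ω) y ∂unifLaw a n ∂P := by
        rw [heightVar, integral_congr_ae hsucc, hX.integral_glue_succ hn hF.stronglyMeasurable hdep
          ((hX.integrable_norm_heightTransform_sub_heightProd_sq ha (by omega) t).congr hsucc)]
    _ ≤ ∫ ω, (‖heightTransform a n z (fun i => glue i ω) - heightProd a n z‖ ^ 2 + p ^ 2) ∂P :=
        integral_mono_of_nonneg (.of_forall fun ω => integral_nonneg fun y => sq_nonneg _)
          (hint.add (integrable_const _)) (.of_forall fun ω => hcond _)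
    _ = heightVar P a glue n t + p ^ 2 := by
        rw [integral_add hint (integrable_const _)]
        simp [heightVar]

lemma heightVar_le_sum (hX : IsMarkedGluing P a ℓ glue X) (ha : ∀ n, 1 ≤ n → 0 < a n)
    (hm : 1 ≤ m) (hmn : m ≤ n) (t : ℝ) : heightVar P a glue n t ≤
      (2 * (|t| * totalLength a m)) ^ 2 + ∑ k ∈ Finset.Ioc m n, segProb a k ^ 2 := by
  induction n, hmn using Nat.le_induction with
  | base => simpa using hX.heightVar_le_sq ha hm t
  | succ n hmn ih =>
    rw [Finset.sum_Ioc_succ_top hmn, ← add_assoc]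
    exact (hX.heightVar_succ_le ha (hm.trans hmn) t).trans (add_le_add_left ih _)

lemma tendsto_heightVar (hX : IsMarkedGluing P a ℓ glue X) (ha : ∀ n, 1 ≤ n → 0 < a n)
    (hs : Summable fun k => segProb a k ^ 2) {t : ℕ → ℝ} (ht : Tendsto t atTop (𝓝 0)) :
    Tendsto (fun n => heightVar P a glue n (t n)) atTop (𝓝 0) := by
  refine tendsto_order.2 ⟨fun ε hε => .of_forall fun n => hε.trans_le
    (integral_nonneg fun ω => sq_nonneg _), fun ε hε => ?_⟩
  obtain ⟨m, hm, htail⟩ := exists_forall_sum_Ioc_lt hs (half_pos hε)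
  have hstart : Tendsto (fun n => (2 * (|t n| * totalLength a m)) ^ 2) atTop (𝓝 0) := by
    simpa using ((ht.abs.mul_const (totalLength a m)).const_mul 2).pow 2
  filter_upwards [hstart.eventually_lt_const (half_pos hε), eventually_ge_atTop m] with n hlt hmn
  linarith [hX.heightVar_le_sum ha hm hmn (t n), htail n]

lemma integral_norm_heightTransform_sub_heightProd_le (hX : IsMarkedGluing P a ℓ glue X)
    (ha : ∀ n, 1 ≤ n → 0 < a n) (hn : 1 ≤ n) (t : ℝ) :
    ∫ ω, ‖heightTransform a n (t * Complex.I) (fun i => glue i ω) -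
      heightProd a n (t * Complex.I)‖ ∂P ≤ √(heightVar P a glue n t) :=
  Real.le_sqrt_of_sq_le <| even_two.convexOn_pow.map_integral_le (continuous_pow 2).continuousOn
    isClosed_univ (by simp)
    ((hX.integrable_heightTransform ha hn _).sub (integrable_const _)).norm
    (hX.integrable_norm_heightTransform_sub_heightProd_sq ha hn t)

lemma tendsto_integral_prod_heightTransform_sub (hX : IsMarkedGluing P a ℓ glue X)
    (ha : ∀ n, 1 ≤ n → 0 < a n) (hs : Summable fun k => segProb a k ^ 2) {t : ℕ → Fin ℓ → ℝ}
    (ht : ∀ j, Tendsto (t · j) atTop (𝓝 0)) :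
    Tendsto (fun n => ∫ ω, ∏ j, heightTransform a n (t n j * Complex.I) (fun i => glue i ω) ∂P -
      ∏ j, heightProd a n (t n j * Complex.I)) atTop (𝓝 0) := by
  have hlim : Tendsto (fun n => ∑ j, √(heightVar P a glue n (t n j))) atTop (𝓝 0) := by
    simpa using tendsto_finsetSum Finset.univ fun j _ => (hX.tendsto_heightVar ha hs (ht j)).sqrt
  refine squeeze_zero_norm' ?_ hlim
  filter_upwards [eventually_ge_atTop 1] with n hn
  let H (j : Fin ℓ) (ω : Ω) : ℂ := heightTransform a n (t n j * Complex.I) fun i => glue i ω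
  have hH (j : Fin ℓ) : Integrable (H j) P := hX.integrable_heightTransform ha hn _
  have hdiff (j : Fin ℓ) := ((hH j).sub
    (integrable_const (heightProd a n (t n j * Complex.I)))).norm
  have hprod : Integrable (fun ω => ∏ j, H j ω) P := by
    refine .of_bound (Finset.aestronglyMeasurable_fun_prod _ fun j _ =>
      (hH j).aestronglyMeasurable) 1 (.of_forall fun ω => ?_)
    rw [norm_prod]
    exact Finset.prod_le_one (fun _ _ => norm_nonneg _)
      fun j _ => norm_heightTransform_ofReal_mul_I_le ha hn _ _
  calc ‖∫ ω, ∏ j, H j ω ∂P - ∏ j, heightProd a n (t n j * Complex.I)‖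
      = ‖∫ ω, (∏ j, H j ω - ∏ j, heightProd a n (t n j * Complex.I)) ∂P‖ := by
        rw [integral_sub hprod (integrable_const _)]
        simp
    _ ≤ ∫ ω, ∑ j, ‖H j ω - heightProd a n (t n j * Complex.I)‖ ∂P :=
        norm_integral_le_of_norm_le (integrable_finsetSum _ fun j _ => hdiff j) <|
          .of_forall fun ω => norm_prod_sub_prod_le_sum _
            (fun j _ => norm_heightTransform_ofReal_mul_I_le ha hn _ _)
            fun j _ => hX.norm_heightProd_ofReal_mul_I_le ha hn _
    _ = ∑ j, ∫ ω, ‖H j ω - heightProd a n (t n j * Complex.I)‖ ∂P :=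
        integral_finsetSum _ fun j _ => hdiff j
    _ ≤ ∑ j, √(heightVar P a glue n (t n j)) := Finset.sum_le_sum fun j _ =>
        hX.integral_norm_heightTransform_sub_heightProd_le ha hn (t n j)

end IsMarkedGluing

/-- The probability that the path from the root of `T_n` to a uniform point shares a part of length
more than `h` with the path to `p`. -/
noncomputable def branchProb (a : ℕ → ℝ) (h : ℝ) (n : ℕ) (g : ℕ → ℕ × ℝ) (p : ℕ × ℝ) : ENNReal :=
  unifLaw a n {q | h < meetHeight g n p q}

section Branching

variable {a : ℕ → ℝ} {h : ℝ} {n : ℕ} {g : ℕ → ℕ × ℝ} {p : ℕ × ℝ}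

lemma measurableSet_lt_meetHeight (h : ℝ) (n : ℕ) (g : ℕ → ℕ × ℝ) (p : ℕ × ℝ) :
    MeasurableSet {q | h < meetHeight g n p q} :=
  measurableSet_lt measurable_const (by fun_prop)

lemma measurable_branchProb (ha : ∀ n, 1 ≤ n → 0 < a n) (hn : 1 ≤ n) (h : ℝ) :
    Measurable (Function.uncurry (branchProb a h n)) := by
  have := isProbabilityMeasure_unifLaw ha hn
  exact measurable_measure_prodMk_left (ν := unifLaw a n)
    (s := {x : ((ℕ → ℕ × ℝ) × (ℕ × ℝ)) × (ℕ × ℝ) | h < meetHeight x.1.1 n x.1.2 x.2})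
    (measurableSet_lt measurable_const (by fun_prop))

lemma dependsOn_branchProb (a : ℕ → ℝ) (h : ℝ) (n : ℕ) (p : ℕ × ℝ) :
    DependsOn (fun g => branchProb a h n g p) (Finset.Icc 2 n) := fun g g' hgg' => by
  have hmeet (q : ℕ × ℝ) := dependsOn_meetHeight n p q hgg'
  simp only [branchProb]
  congr! 4 with q
  exact hmeet q

lemma branchProb_totalLength_of_mem (ha : ∀ n, 1 ≤ n → 0 < a n) (hg : ValidGluing a g n)
    (hp : p ∈ treePts a n) : branchProb a (totalLength a n) n g p = 0 := by
  simp [branchProb, (meetHeight_le_totalLength ha hg hp).not_gt]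

lemma branchProb_succ (ha : ∀ n, 1 ≤ n → 0 < a n) (hn : 1 ≤ n) :
    branchProb a h (n + 1) g p =
      ENNReal.ofReal (1 - segProb a (n + 1)) * unifLaw a n {q | h < meetHeight g (n + 1) p q} +
        ENNReal.ofReal (segProb a (n + 1)) *
          segLaw a (n + 1) {q | h < meetHeight g (n + 1) p q} := by
  simp [branchProb, unifLaw_succ ha hn]

lemma branchProb_succ_of_ne (ha : ∀ n, 1 ≤ n → 0 < a n) (hn : 1 ≤ n) (hp : p.1 ≠ n + 1) :
    branchProb a h (n + 1) g p = ENNReal.ofReal (1 - segProb a (n + 1)) * branchProb a h n g p +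
      ENNReal.ofReal (segProb a (n + 1)) *
        {q | h < meetHeight g n (g (n + 1)) q}.indicator 1 p := by
  rw [branchProb_succ ha hn]
  congr 2
  · refine measure_congr ?_
    filter_upwards [ae_mem_treePts a n] with q hq
    change (h < _) = (h < _)
    rw [meetHeight_succ_of_ne_of_ne hp (fst_ne_succ_of_mem_treePts hq)]
  · have hmeet : ∀ᵐ q ∂segLaw a (n + 1),
        meetHeight g (n + 1) p q = meetHeight g n (g (n + 1)) p := by
      filter_upwards [ae_segLaw ha (Nat.le_add_left 1 n)] with q hq
      rw [meetHeight_comm, meetHeight_succ_of_eq_of_ne hq.1 hq.2.1 hp]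
    have hset : ({q | h < meetHeight g (n + 1) p q} : Set (ℕ × ℝ)) =ᵐ[segLaw a (n + 1)]
        {_q | h < meetHeight g n (g (n + 1)) p} := hmeet.mono fun q hq => congrArg (h < ·) hq
    rw [measure_congr hset]
    by_cases hlt : h < meetHeight g n (g (n + 1)) p <;> simp [hlt]

lemma branchProb_succ_le_of_eq (ha : ∀ n, 1 ≤ n → 0 < a n) (hn : 1 ≤ n) (hp : p.1 = n + 1)
    (hp0 : 0 ≤ p.2) :
    branchProb a h (n + 1) g p ≤
      ENNReal.ofReal (1 - segProb a (n + 1)) * branchProb a h n g (g (n + 1)) +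
        ENNReal.ofReal (segProb a (n + 1)) := by
  rw [branchProb_succ ha hn]
  refine add_le_add (mul_le_mul_right (le_of_eq (measure_congr ?_)) _)
    (mul_le_of_le_one_right' prob_le_one)
  filter_upwards [ae_mem_treePts a n] with q hq
  change (h < _) = (h < _)
  rw [meetHeight_succ_of_eq_of_ne hp hp0 (fst_ne_succ_of_mem_treePts hq)]

lemma lintegral_branchProb_succ_le (ha : ∀ n, 1 ≤ n → 0 < a n) (hn : 1 ≤ n) (h : ℝ)
    (g : ℕ → ℕ × ℝ) :
    ∫⁻ p, branchProb a h (n + 1) g p ∂unifLaw a (n + 1) ≤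
      ENNReal.ofReal ((1 - segProb a (n + 1)) ^ 2) * ∫⁻ p, branchProb a h n g p ∂unifLaw a n +
        ENNReal.ofReal (2 * segProb a (n + 1) * (1 - segProb a (n + 1))) *
          branchProb a h n g (g (n + 1)) +
        ENNReal.ofReal (segProb a (n + 1) ^ 2) := by
  have hp0 : 0 ≤ segProb a (n + 1) := (segProb_pos ha (by omega)).le
  have hq0 : 0 ≤ 1 - segProb a (n + 1) :=
    sub_nonneg.2 (segProb_le_one ha (Nat.le_add_left 1 n))
  have hmeas : Measurable (branchProb a h n g) :=
    (measurable_branchProb ha hn h).of_uncurry_left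
  have hset := measurableSet_lt_meetHeight h n g (g (n + 1))
  have hold : ∫⁻ p, branchProb a h (n + 1) g p ∂unifLaw a n =
      ENNReal.ofReal (1 - segProb a (n + 1)) * ∫⁻ p, branchProb a h n g p ∂unifLaw a n +
        ENNReal.ofReal (segProb a (n + 1)) * branchProb a h n g (g (n + 1)) := by
    rw [lintegral_congr_ae ((ae_mem_treePts a n).mono fun p hp =>
        branchProb_succ_of_ne ha hn (fst_ne_succ_of_mem_treePts hp)),
      lintegral_add_left (hmeas.const_mul _), lintegral_const_mul _ hmeas,
      lintegral_const_mul _ (measurable_one.indicator hset), lintegral_indicator_one hset]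
    rfl
  have hnew : ∫⁻ p, branchProb a h (n + 1) g p ∂segLaw a (n + 1) ≤
      ENNReal.ofReal (1 - segProb a (n + 1)) * branchProb a h n g (g (n + 1)) +
        ENNReal.ofReal (segProb a (n + 1)) := by
    refine (lintegral_mono_ae ((ae_segLaw ha (Nat.le_add_left 1 n)).mono fun p hp =>
      branchProb_succ_le_of_eq ha hn hp.1 hp.2.1)).trans_eq ?_
    rw [lintegral_const, measure_univ, mul_one]
  rw [lintegral_unifLaw_succ ha hn, hold]
  refine (add_le_add_right (mul_le_mul_right hnew _) _).trans_eq ?_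
  rw [ENNReal.ofReal_mul (by positivity), ENNReal.ofReal_mul zero_le_two, ENNReal.ofReal_ofNat,
    ENNReal.ofReal_pow hp0, ENNReal.ofReal_pow hq0]
  ring

end Branching

namespace IsMarkedGluing

variable {Ω : Type*} [MeasurableSpace Ω] {P : Measure Ω} {a : ℕ → ℝ}
  {ℓ : ℕ} {glue : ℕ → Ω → ℕ × ℝ} {X : ℕ → Fin ℓ → Ω → ℕ × ℝ} {m n : ℕ}

lemma maxBranchHeight_ae_eq_iSup_meetHeight (hX : IsMarkedGluing P a ℓ glue X)
    (ha : ∀ n, 1 ≤ n → 0 < a n) (hn : 1 ≤ n) :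
    ∀ᵐ ω ∂P, maxBranchHeight a (fun i => glue i ω) n (fun j => X n j ω) =
      ⨆ e : {e : Fin ℓ × Fin ℓ // e.1 ≠ e.2},
        meetHeight (fun i => glue i ω) n (X n e.1.1 ω) (X n e.1.2 ω) := by
  filter_upwards [hX.ae_validGluing n, hX.ae_mark_mem hn] with ω hg hmark
  exact iSup_congr fun e => branchHeight_eq_meetHeight ha hg (hmark _) (hmark _)

lemma aemeasurable_maxBranchHeight (hX : IsMarkedGluing P a ℓ glue X)
    (ha : ∀ n, 1 ≤ n → 0 < a n) (n : ℕ) :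
    AEMeasurable (fun ω => maxBranchHeight a (fun i => glue i ω) n fun j => X n j ω) P := by
  obtain rfl | hn := n.eq_zero_or_pos
  · have hempty (g : ℕ → ℕ × ℝ) (p : ℕ × ℝ) : rootPath a g 0 p = ∅ :=
      Set.eq_empty_of_forall_notMem fun z hz => by have := hz.1.1; have := hz.1.2.1; omega
    simp [maxBranchHeight, branchHeight, hempty]
  · have hmeas : Measurable fun ω => ⨆ e : {e : Fin ℓ × Fin ℓ // e.1 ≠ e.2},
        meetHeight (fun i => glue i ω) n (X n e.1.1 ω) (X n e.1.2 ω) :=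
      .iSup fun e => measurable_meetHeight hX.measurable_gluing (hX.measurable_mark n _)
        (hX.measurable_mark n _)
    refine hmeas.aemeasurable.congr ?_
    filter_upwards [hX.maxBranchHeight_ae_eq_iSup_meetHeight ha hn] with ω h using h.symm

lemma ae_maxBranchHeight_nonneg (hX : IsMarkedGluing P a ℓ glue X)
    (ha : ∀ n, 1 ≤ n → 0 < a n) (hn : 1 ≤ n) :
    ∀ᵐ ω ∂P, 0 ≤ maxBranchHeight a (fun i => glue i ω) n (fun j => X n j ω) := by
  filter_upwards [hX.maxBranchHeight_ae_eq_iSup_meetHeight ha hn, hX.ae_validGluing n,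
    hX.ae_mark_mem hn] with ω hω hg hmark
  rw [hω]
  exact Real.iSup_nonneg fun e => meetHeight_nonneg hg (hmark _) (hmark _)

variable [IsProbabilityMeasure P]

/- Two uniform points of `T_(n+1)` which are not both in `b_(n+1)` share a path distributed as for
two uniform points of `T_n`, since the gluing point of `b_(n+1)` is itself uniform. -/
lemma lintegral_branchProb_succ_le (hX : IsMarkedGluing P a ℓ glue X)
    (ha : ∀ n, 1 ≤ n → 0 < a n) (hn : 1 ≤ n) (h : ℝ) :
    ∫⁻ ω, ∫⁻ p, branchProb a h (n + 1) (fun i => glue i ω) p ∂unifLaw a (n + 1) ∂P ≤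
      ∫⁻ ω, ∫⁻ p, branchProb a h n (fun i => glue i ω) p ∂unifLaw a n ∂P +
        ENNReal.ofReal (segProb a (n + 1) ^ 2) := by
  have := isProbabilityMeasure_unifLaw ha hn
  set p := segProb a (n + 1)
  have hp0 : 0 ≤ p := (segProb_pos ha (by omega)).le
  have hp1 : p ≤ 1 := segProb_le_one ha (Nat.le_add_left 1 n)
  have hmeas := measurable_branchProb ha hn h
  set b := ∫⁻ ω, ∫⁻ x, branchProb a h n (fun i => glue i ω) x ∂unifLaw a n ∂P
  have hglue : ∫⁻ ω, branchProb a h n (fun i => glue i ω) (glue (n + 1) ω) ∂P = b :=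
    hX.lintegral_glue_succ hn hmeas (dependsOn_branchProb a h n)
  have hold : Measurable fun ω => ∫⁻ x, branchProb a h n (fun i => glue i ω) x ∂unifLaw a n :=
    hmeas.lintegral_prod_right.comp hX.measurable_gluing
  have hnew : Measurable fun ω => branchProb a h n (fun i => glue i ω) (glue (n + 1) ω) :=
    (hmeas.comp (hX.measurable_gluing.prodMk (hX.measurable_glue _)) :)
  calc ∫⁻ ω, ∫⁻ x, branchProb a h (n + 1) (fun i => glue i ω) x ∂unifLaw a (n + 1) ∂P
      ≤ ENNReal.ofReal ((1 - p) ^ 2) * b + ENNReal.ofReal (2 * p * (1 - p)) * b +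
          ENNReal.ofReal (p ^ 2) := by
        refine (lintegral_mono fun ω =>
          _root_.lintegral_branchProb_succ_le ha hn h fun i => glue i ω).trans_eq ?_
        rw [lintegral_add_right _ measurable_const,
          lintegral_add_left (hold.const_mul _), lintegral_const_mul _ hold,
          lintegral_const_mul _ hnew, hglue, lintegral_const, measure_univ, mul_one]
    _ ≤ b + ENNReal.ofReal (p ^ 2) := by
        rw [← add_mul, ← ENNReal.ofReal_add (sq_nonneg _)
          (mul_nonneg (by positivity) (sub_nonneg.2 hp1))]
        gcongr
        exact mul_le_of_le_one_left' (ENNReal.ofReal_le_one.2 (by nlinarith))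

lemma lintegral_branchProb_le (hX : IsMarkedGluing P a ℓ glue X) (ha : ∀ n, 1 ≤ n → 0 < a n)
    (hm : 1 ≤ m) (hmn : m ≤ n) :
    ∫⁻ ω, ∫⁻ p, branchProb a (totalLength a m) n (fun i => glue i ω) p ∂unifLaw a n ∂P ≤
      ENNReal.ofReal (∑ k ∈ Finset.Ioc m n, segProb a k ^ 2) := by
  induction n, hmn using Nat.le_induction with
  | base =>
    refine le_of_eq_of_le (lintegral_eq_zero_of_ae_eq_zero ?_) zero_le
    filter_upwards [hX.ae_validGluing m] with ω hg
    exact lintegral_eq_zero_of_ae_eq_zero ((ae_mem_treePts a m).mono fun p hp =>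
      branchProb_totalLength_of_mem ha hg hp)
  | succ n hmn ih =>
    rw [Finset.sum_Ioc_succ_top hmn, ENNReal.ofReal_add
      (Finset.sum_nonneg fun _ _ => sq_nonneg _) (sq_nonneg _)]
    exact (hX.lintegral_branchProb_succ_le ha (hm.trans hmn) _).trans (add_le_add_left ih _)

lemma measure_lt_meetHeight_le (hX : IsMarkedGluing P a ℓ glue X) (ha : ∀ n, 1 ≤ n → 0 < a n)
    (hm : 1 ≤ m) (hmn : m ≤ n) {i j : Fin ℓ} (hij : i ≠ j) :
    P {ω | totalLength a m < meetHeight (fun i => glue i ω) n (X n i ω) (X n j ω)} ≤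
      ENNReal.ofReal (∑ k ∈ Finset.Ioc m n, segProb a k ^ 2) := by
  have hn := hm.trans hmn
  have := isProbabilityMeasure_unifLaw ha hn
  let S (g : ℕ → ℕ × ℝ) : Set ((ℕ × ℝ) × (ℕ × ℝ)) :=
    {x | totalLength a m < meetHeight g n x.1 x.2}
  have hS : MeasurableSet {y : (ℕ → ℕ × ℝ) × (ℕ × ℝ) × (ℕ × ℝ) |
      totalLength a m < meetHeight y.1 n y.2.1 y.2.2} :=
    measurableSet_lt measurable_const (by fun_prop)
  have hSg (g : ℕ → ℕ × ℝ) : MeasurableSet (S g) := hS.preimage measurable_prodMk_left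
  have hF : Measurable
      (Function.uncurry fun g => (S g).indicator (1 : (ℕ × ℝ) × (ℕ × ℝ) → ENNReal)) :=
    measurable_one.indicator hS
  have hdep (x : (ℕ × ℝ) × (ℕ × ℝ)) :
      DependsOn (fun g => (S g).indicator (1 : (ℕ × ℝ) × (ℕ × ℝ) → ENNReal) x) (Finset.Icc 2 n) :=
    fun g g' hgg' => by
      simp only [S, Set.indicator_apply, Set.mem_ofPred_eq, dependsOn_meetHeight n x.1 x.2 hgg']
  calc P {ω | totalLength a m < meetHeight (fun i => glue i ω) n (X n i ω) (X n j ω)}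
      = ∫⁻ ω, (S fun i => glue i ω).indicator 1 (X n i ω, X n j ω) ∂P :=
        (lintegral_indicator_one (measurableSet_lt measurable_const <| measurable_meetHeight
          hX.measurable_gluing (hX.measurable_mark n i) (hX.measurable_mark n j))).symm
    _ = ∫⁻ ω, ∫⁻ p, branchProb a (totalLength a m) n (fun i => glue i ω) p ∂unifLaw a n ∂P := by
        rw [hX.lintegral_mark_pair hn hij hF hdep]
        simp only [lintegral_indicator_one (hSg _), Measure.prod_apply (hSg _)]
        rfl
    _ ≤ _ := hX.lintegral_branchProb_le ha hm hmn

lemma measure_lt_maxBranchHeight_le (hX : IsMarkedGluing P a ℓ glue X)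
    (ha : ∀ n, 1 ≤ n → 0 < a n) (hm : 1 ≤ m) (hmn : m ≤ n) :
    P {ω | totalLength a m < maxBranchHeight a (fun i => glue i ω) n (fun j => X n j ω)} ≤
      ENNReal.ofReal (∑ k ∈ Finset.Ioc m n,
        Fintype.card {e : Fin ℓ × Fin ℓ // e.1 ≠ e.2} * segProb a k ^ 2) := by
  have hsub : ∀ᵐ ω ∂P,
      totalLength a m < maxBranchHeight a (fun i => glue i ω) n (fun j => X n j ω) →
      ω ∈ ⋃ e : {e : Fin ℓ × Fin ℓ // e.1 ≠ e.2},
        {ω | totalLength a m < meetHeight (fun i => glue i ω) n (X n e.1.1 ω) (X n e.1.2 ω)} := by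
    filter_upwards [hX.maxBranchHeight_ae_eq_iSup_meetHeight ha (hm.trans hmn)] with ω hω hlt
    rw [hω] at hlt
    contrapose! hlt
    simp only [Set.mem_iUnion, Set.mem_ofPred_eq, not_exists, not_lt] at hlt
    exact Real.iSup_le hlt (totalLength_nonneg ha m)
  refine (measure_mono_ae hsub).trans ((measure_iUnion_fintype_le _ _).trans
    ((Finset.sum_le_sum fun e _ => hX.measure_lt_meetHeight_le ha hm hmn e.2).trans_eq ?_))
  rw [Finset.sum_const, Finset.card_univ, nsmul_eq_mul, ← Finset.mul_sum,
    ENNReal.ofReal_mul (Nat.cast_nonneg _), ENNReal.ofReal_natCast]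

theorem tendstoInMeasure_maxBranchHeight_div (hX : IsMarkedGluing P a ℓ glue X)
    (ha : ∀ n, 1 ≤ n → 0 < a n) (hs : Summable fun k => segProb a k ^ 2) {c : ℕ → ℝ}
    (hc : Tendsto c atTop atTop) :
    TendstoInMeasure P (fun n ω =>
      maxBranchHeight a (fun i => glue i ω) n (fun j => X n j ω) / c n) atTop fun _ => 0 := by
  refine tendstoInMeasure_iff_measureReal_norm.2 fun ε hε => tendsto_order.2
    ⟨fun δ hδ => .of_forall fun n => hδ.trans_le measureReal_nonneg, fun δ hδ => ?_⟩
  obtain ⟨m, hm, htail⟩ := exists_forall_sum_Ioc_lt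
    (hs.mul_left (Fintype.card {e : Fin ℓ × Fin ℓ // e.1 ≠ e.2} : ℝ)) hδ
  filter_upwards [eventually_ge_atTop m, hc.eventually_gt_atTop 0,
    hc.eventually_gt_atTop (totalLength a m / ε)] with n hmn hc0 hcε
  have hsub : ∀ᵐ ω ∂P,
      ε ≤ ‖maxBranchHeight a (fun i => glue i ω) n (fun j => X n j ω) / c n - 0‖ →
      totalLength a m < maxBranchHeight a (fun i => glue i ω) n (fun j => X n j ω) := by
    filter_upwards [hX.ae_maxBranchHeight_nonneg ha (hm.trans hmn)] with ω h0 hω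
    rw [sub_zero, norm_div, Real.norm_of_nonneg h0, Real.norm_of_nonneg hc0.le,
      le_div_iff₀ hc0] at hω
    exact ((div_lt_iff₀' hε).1 hcε).trans_le hω
  exact (ENNReal.toReal_le_of_le_ofReal
    (Finset.sum_nonneg fun _ _ => by positivity)
    ((measure_mono_ae hsub).trans (hX.measure_lt_maxBranchHeight_le ha hm hmn))).trans_lt (htail n)

end IsMarkedGluing

lemma exists_mem_Ico_inv_mul_notMem {D : Set ℝ} (hD : volume D < ENNReal.ofReal (1 / 2))
    {s t : ℝ} (hs : 0 < s) (hst : s ≤ t) :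
    ∃ x ∈ Set.Ico t (2 * t), t⁻¹ * x ∉ D ∧ s⁻¹ * x ∉ D := by
  have ht := hs.trans_le hst
  by_contra! hcon
  have hsub : Set.Ico t (2 * t) ⊆ (t⁻¹ * ·) ⁻¹' D ∪ (s⁻¹ * ·) ⁻¹' D := fun x hx =>
    or_iff_not_imp_left.2 (hcon x hx)
  have hpre {r : ℝ} (hr : 0 < r) (hrt : r ≤ t) :
      volume ((r⁻¹ * ·) ⁻¹' D) < ENNReal.ofReal (t / 2) := by
    rw [Real.volume_preimage_mul_left (inv_ne_zero hr.ne'), inv_inv, abs_of_pos hr]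
    calc ENNReal.ofReal r * volume D
        < ENNReal.ofReal r * ENNReal.ofReal (1 / 2) :=
          ENNReal.mul_lt_mul_right (by simpa using hr) ENNReal.ofReal_ne_top hD
      _ = ENNReal.ofReal (r / 2) := by rw [← ENNReal.ofReal_mul hr.le, mul_one_div]
      _ ≤ ENNReal.ofReal (t / 2) := ENNReal.ofReal_le_ofReal (by linarith)
  have hlt := ((measure_mono hsub).trans (measure_union_le _ _)).trans_lt
    (ENNReal.add_lt_add (hpre ht le_rfl) (hpre hs hst))
  rw [Real.volume_Ico, ← ENNReal.ofReal_add (by positivity) (by positivity)] at hlt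
  exact hlt.ne (by ring_nf)

lemma tendsto_floor_mul_atTop {c : ℝ} (hc : 0 < c) :
    Tendsto (fun n : ℕ => ⌊c * n⌋₊) atTop atTop :=
  tendsto_nat_floor_atTop.comp (tendsto_natCast_atTop_atTop.const_mul_atTop hc)

lemma tendsto_floor_mul_div {c : ℝ} (hc : 0 < c) :
    Tendsto (fun n : ℕ => (⌊c * n⌋₊ : ℝ) / n) atTop (𝓝 c) :=
  (tendsto_nat_floor_mul_div_atTop hc.le).comp tendsto_natCast_atTop_atTop

lemma measurable_comp_floor_mul {β : Type*} [MeasurableSpace β] (f : ℕ → β) (n : ℕ) :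
    Measurable fun x : ℝ => f ⌊x * n⌋₊ :=
  measurable_from_nat.comp (Nat.measurable_floor.comp (measurable_id.mul_const _))

namespace RegularlyVarying

variable {a : ℕ → ℝ} {α : ℝ}

lemma tendsto_log_sub_log (ha : ∀ n, 1 ≤ n → 0 < a n) (h : RegularlyVarying a α) {c : ℝ}
    (hc : 0 < c) :
    Tendsto (fun n : ℕ => Real.log (a ⌊c * n⌋₊) - Real.log (a n)) atTop (𝓝 (α * Real.log c)) := by
  rw [← Real.log_rpow hc]
  refine ((h c hc).log (Real.rpow_pos_of_pos hc α).ne').congr' ?_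
  filter_upwards [eventually_ge_atTop 1, (tendsto_floor_mul_atTop hc).eventually_ge_atTop 1]
    with n hn hcn
  exact Real.log_div (ha _ hcn).ne' (ha n hn).ne'

lemma exists_abs_log_sub_log_le (ha : ∀ n, 1 ≤ n → 0 < a n) (h : RegularlyVarying a α) :
    ∃ D : Set ℝ, volume D < ENNReal.ofReal (1 / 2) ∧ ∃ (K : ℝ) (N : ℕ), 1 ≤ N ∧
      ∀ n, N ≤ n → ∀ c ∈ Set.Icc (1 : ℝ) 4 \ D,
        |Real.log (a ⌊c * n⌋₊) - Real.log (a n)| ≤ K := by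
  obtain ⟨D, -, -, hD, hunif⟩ := tendstoUniformlyOn_of_ae_tendsto (μ := volume)
    (f := fun (n : ℕ) (c : ℝ) => Real.log (a ⌊c * n⌋₊) - Real.log (a n))
    (g := fun c => α * Real.log c) (s := Set.Icc 1 4)
    (fun n => ((measurable_comp_floor_mul (fun k => Real.log (a k)) n).sub_const
      _).stronglyMeasurable)
    (Real.measurable_log.const_mul α).stronglyMeasurable measurableSet_Icc (by simp)
    (.of_forall fun c hc => h.tendsto_log_sub_log ha (zero_lt_one.trans_le hc.1))
    (ε := 1 / 4) (by norm_num)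
  obtain ⟨N, hN⟩ := eventually_atTop.1 (Metric.tendstoUniformlyOn_iff.1 hunif 1 one_pos)
  refine ⟨D, hD.trans_lt ((ENNReal.ofReal_lt_ofReal_iff (by norm_num)).2 (by norm_num)),
    |α| * Real.log 4 + 1, max N 1, le_max_right _ _, fun n hn c hc => ?_⟩
  have hdist := hN n ((le_max_left _ _).trans hn) c hc
  have hlog : |α * Real.log c| ≤ |α| * Real.log 4 := by
    rw [abs_mul, abs_of_nonneg (Real.log_nonneg hc.1.1)]
    have := Real.log_le_log (zero_lt_one.trans_le hc.1.1) hc.1.2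
    gcongr
  rw [dist_comm, Real.dist_eq] at hdist
  linarith [abs_sub_abs_le_abs_sub (Real.log (a ⌊c * n⌋₊) - Real.log (a n)) (α * Real.log c)]

-- A set of ratios of large measure being good (Egorov), some `x` has both `x / i` and `x / n` good.
lemma exists_le_mul_of_le_two_mul (ha : ∀ n, 1 ≤ n → 0 < a n) (h : RegularlyVarying a α) :
    ∃ (C : ℝ) (N : ℕ), 1 ≤ N ∧ ∀ n, N ≤ n → ∀ i, n ≤ 2 * i → i ≤ n → a i ≤ C * a n := by
  obtain ⟨D, hD, K, N, hN, hK⟩ := h.exists_abs_log_sub_log_le ha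
  refine ⟨Real.exp (2 * K), 2 * N, by omega, fun n hn i hni hin => ?_⟩
  have hi0 : (0 : ℝ) < i := by exact_mod_cast (show 0 < i by omega)
  have hin' : (i : ℝ) ≤ n := by exact_mod_cast hin
  have hni' : (n : ℝ) ≤ 2 * i := by exact_mod_cast hni
  obtain ⟨x, ⟨hnx, hxn⟩, hxn', hxi'⟩ := exists_mem_Ico_inv_mul_notMem hD hi0 hin'
  have hlog (m : ℕ) (hm : N ≤ m) (hm1 : (m : ℝ) ≤ n) (hm2 : (n : ℝ) ≤ 2 * m)
      (hmD : (m : ℝ)⁻¹ * x ∉ D) : |Real.log (a ⌊x⌋₊) - Real.log (a m)| ≤ K := by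
    have hm0 : (0 : ℝ) < m := by exact_mod_cast hN.trans hm
    have hmem : (m : ℝ)⁻¹ * x ∈ Set.Icc (1 : ℝ) 4 := by
      rw [inv_mul_eq_div, Set.mem_Icc, le_div_iff₀ hm0, div_le_iff₀ hm0]
      constructor <;> linarith
    have := hK m hm _ ⟨hmem, hmD⟩
    rwa [inv_mul_eq_div, div_mul_cancel₀ _ hm0.ne'] at this
  have hxn := abs_le.1 (hlog n (by omega) le_rfl (by linarith) hxn')
  have hxi := abs_le.1 (hlog i (by omega) hin' hni' hxi')
  rw [← Real.log_le_log_iff (ha i (by omega)) (mul_pos (Real.exp_pos _) (ha n (by omega))),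
    Real.log_mul (Real.exp_pos _).ne' (ha n (by omega)).ne', Real.log_exp]
  linarith

lemma eventually_apply_half_lt (ha : ∀ n, 1 ≤ n → 0 < a n) (h : RegularlyVarying a α)
    (hα : 0 < α) : ∀ᶠ n in atTop, a (n / 2) < a n := by
  have hlt : ((1 : ℝ) / 2) ^ α < 1 := Real.rpow_lt_one (by norm_num) (by norm_num) hα
  filter_upwards [eventually_ge_atTop 1, (h (1 / 2) (by norm_num)).eventually_lt_const hlt]
    with n hn hlt
  have hhalf : ⌊(1 / 2 : ℝ) * n⌋₊ = n / 2 := by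
    rw [one_div, inv_mul_eq_div]
    exact_mod_cast Nat.floor_div_eq_div (K := ℝ) n 2
  rwa [hhalf, div_lt_one (ha n hn)] at hlt

lemma exists_le_mul (ha : ∀ n, 1 ≤ n → 0 < a n) (h : RegularlyVarying a α) (hα : 0 < α) :
    ∃ C : ℝ, 0 < C ∧ ∀ i n, 1 ≤ i → i ≤ n → a i ≤ C * a n := by
  obtain ⟨C₁, N₁, -, hC₁⟩ := h.exists_le_mul_of_le_two_mul ha
  obtain ⟨N₂, hN₂⟩ := eventually_atTop.1 (h.eventually_apply_half_lt ha hα)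
  let N := max N₁ N₂
  obtain ⟨C₂, hC₂⟩ := ((Finset.range (N + 1) ×ˢ Finset.range (N + 1)).image
    fun e => a e.1 / a e.2).exists_le
  have hC (C : ℝ) : C ≤ max (max C₁ C₂) 1 → ∀ i n, 1 ≤ n → a i ≤ C * a n →
      a i ≤ max (max C₁ C₂) 1 * a n := fun hC i n hn hle =>
    hle.trans (mul_le_mul_of_nonneg_right hC (ha n hn).le)
  refine ⟨max (max C₁ C₂) 1, by positivity, fun i n hi => ?_⟩
  induction n using Nat.strong_induction_on with
  | _ n ih =>
    intro hin
    have hn := hi.trans hin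
    obtain hnN | hNn := le_or_gt n N
    · refine hC C₂ (by simp) i n hn ((div_le_iff₀ (ha n hn)).1 (hC₂ _ ?_))
      exact Finset.mem_image.2 ⟨(i, n), by simp; omega, rfl⟩
    obtain h2 | h2 := le_or_gt n (2 * i)
    · exact hC C₁ (by simp) i n hn (hC₁ n (by omega) i h2 hin)
    · exact (ih (n / 2) (by omega) (by omega)).trans
        (mul_le_mul_of_nonneg_left (hN₂ n (by omega)).le (by positivity))

lemma mul_rpow (h : RegularlyVarying a α) (γ : ℝ) :
    RegularlyVarying (fun n => a n * (n : ℝ) ^ γ) (α + γ) := by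
  intro c hc
  rw [Real.rpow_add hc]
  refine ((h c hc).mul ((tendsto_floor_mul_div hc).rpow_const (p := γ) (Or.inl hc.ne'))).congr
    fun n => ?_
  rw [Real.div_rpow (by positivity) (by positivity), mul_div_mul_comm]

lemma exists_div_le_mul_rpow (ha : ∀ n, 1 ≤ n → 0 < a n) (h : RegularlyVarying a α) {δ : ℝ}
    (hδ : δ < α) :
    ∃ C : ℝ, 0 < C ∧ ∀ i n, 1 ≤ i → i ≤ n → a i / a n ≤ C * ((i : ℝ) / n) ^ δ := by
  obtain ⟨C, hC, hle⟩ := (h.mul_rpow (-δ)).exists_le_mul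
    (fun n hn => mul_pos (ha n hn) (Real.rpow_pos_of_pos (by exact_mod_cast hn) _))
    (by linarith)
  refine ⟨C, hC, fun i n hi hin => ?_⟩
  have hn := hi.trans hin
  have hi0 : (0 : ℝ) < i := by exact_mod_cast hi
  have hn0 : (0 : ℝ) < n := by exact_mod_cast hn
  have hle := hle i n hi hin
  rw [Real.rpow_neg hi0.le, Real.rpow_neg hn0.le, ← div_eq_mul_inv, ← div_eq_mul_inv,
    div_le_iff₀ (Real.rpow_pos_of_pos hi0 δ)] at hle
  rw [div_le_iff₀ (ha n hn), Real.div_rpow hi0.le hn0.le]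
  exact hle.trans_eq (by ring)

lemma tendsto_atTop_of_pos (ha : ∀ n, 1 ≤ n → 0 < a n) (h : RegularlyVarying a α) (hα : 0 < α) :
    Tendsto a atTop atTop := by
  obtain ⟨C, hC, hle⟩ := h.exists_div_le_mul_rpow ha (half_lt_self hα)
  have hlim : Tendsto (fun n : ℕ => a 1 / C * (n : ℝ) ^ (α / 2)) atTop atTop :=
    ((tendsto_rpow_atTop (half_pos hα)).comp tendsto_natCast_atTop_atTop).const_mul_atTop
      (div_pos (ha 1 le_rfl) hC)
  refine tendsto_atTop_mono' _ ?_ hlim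
  filter_upwards [eventually_ge_atTop 1] with n hn
  have hn0 : (0 : ℝ) < n := by exact_mod_cast hn
  have hle := hle 1 n le_rfl hn
  rw [Nat.cast_one, Real.div_rpow zero_le_one hn0.le, Real.one_rpow, div_le_iff₀ (ha n hn),
    mul_one_div, div_mul_eq_mul_div, le_div_iff₀ (Real.rpow_pos_of_pos hn0 _)] at hle
  rw [div_mul_eq_mul_div, div_le_iff₀ hC]
  linarith

end RegularlyVarying

section RiemannSum

variable {E : Type*} [NormedAddCommGroup E] [NormedSpace ℝ E]

lemma floor_mul_eqOn_Ioo {n : ℕ} (hn : 1 ≤ n) (k : ℕ) :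
    Set.EqOn (fun x : ℝ => ⌊x * n⌋₊) (fun _ => k) (Set.Ioo (k / n) ((k + 1 : ℕ) / n)) := by
  intro x ⟨hkx, hxk⟩
  have hn0 : (0 : ℝ) < n := by exact_mod_cast hn
  rw [div_lt_iff₀ hn0] at hkx
  rw [lt_div_iff₀ hn0, Nat.cast_succ] at hxk
  exact (Nat.floor_eq_iff ((Nat.cast_nonneg k).trans hkx.le)).2 ⟨hkx.le, hxk⟩

lemma sum_range_eq_integral_floor [CompleteSpace E] {n : ℕ} (hn : 1 ≤ n) (f : ℕ → E) :
    ∑ i ∈ Finset.range n, f i = ∫ x in (0 : ℝ)..1, (n : ℝ) • f ⌊x * n⌋₊ := by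
  have hn0 : (0 : ℝ) < n := by exact_mod_cast hn
  have hle (k : ℕ) : (k : ℝ) / n ≤ ((k + 1 : ℕ) : ℝ) / n := by
    gcongr
    omega
  have hconst (k : ℕ) : Set.EqOn (fun x : ℝ => (n : ℝ) • f ⌊x * n⌋₊) (fun _ => (n : ℝ) • f k)
      (Set.Ioo (k / n) ((k + 1 : ℕ) / n)) :=
    (floor_mul_eqOn_Ioo hn k).comp_left (g := fun m => (n : ℝ) • f m)
  have hint (k : ℕ) (_ : k < n) : IntervalIntegrable (fun x : ℝ => (n : ℝ) • f ⌊x * n⌋₊) volume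
      (k / n) ((k + 1 : ℕ) / n) := by
    rw [intervalIntegrable_iff_integrableOn_Ioo_of_le (hle k)]
    exact (integrableOn_congr_fun (hconst k) measurableSet_Ioo).2 (by simp)
  have hsum := intervalIntegral.sum_integral_adjacent_intervals hint
  rw [Nat.cast_zero, zero_div, div_self hn0.ne'] at hsum
  rw [← hsum]
  refine Finset.sum_congr rfl fun k _ => ?_
  rw [intervalIntegral.integral_congr_Ioo_of_le (hle k) (hconst k),
    intervalIntegral.integral_const, smul_smul, ← sub_div, Nat.cast_succ, add_sub_cancel_left,
    one_div, inv_mul_cancel₀ hn0.ne', one_smul]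

lemma sum_Icc_one_eq_integral_floor_add [CompleteSpace E] {n : ℕ} (hn : 1 ≤ n) (f : ℕ → E) :
    ∑ i ∈ Finset.Icc 1 n, f i =
      (∫ x in (0 : ℝ)..1, (n : ℝ) • if ⌊x * n⌋₊ = 0 then 0 else f ⌊x * n⌋₊) + f n := by
  rw [← sum_range_eq_integral_floor hn fun i => if i = 0 then 0 else f i, Finset.range_eq_Ico,
    Finset.sum_eq_sum_Ico_succ_bot hn, if_pos rfl, zero_add, zero_add,
    ← Finset.sum_Ico_add_eq_sum_Icc hn]
  exact congrArg (· + f n) (Finset.sum_congr rfl fun i hi =>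
    (if_neg (Nat.one_le_iff_ne_zero.1 (Finset.mem_Ico.1 hi).1)).symm)

lemma half_le_floor_mul_div {x : ℝ} {n : ℕ} (h : 1 ≤ ⌊x * n⌋₊) :
    x / 2 ≤ (⌊x * n⌋₊ : ℝ) / n := by
  have hn0 : (0 : ℝ) < n := by
    rcases Nat.eq_zero_or_pos n with rfl | hn
    · simp at h
    · exact_mod_cast hn
  have hfloor : (1 : ℝ) ≤ ⌊x * n⌋₊ := by exact_mod_cast h
  rw [le_div_iff₀ hn0]
  linarith [Nat.lt_floor_add_one (x * n)]

lemma floor_mul_div_le {x : ℝ} (hx : 0 ≤ x) (n : ℕ) : (⌊x * n⌋₊ : ℝ) / n ≤ x :=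
  div_le_of_le_mul₀ n.cast_nonneg hx (Nat.floor_le (by positivity))

lemma tendsto_sum_Icc_of_floor_dominated [CompleteSpace E] [MeasurableSpace E] [BorelSpace E]
    [SecondCountableTopology E] {f : ℕ → ℕ → E} {g : ℝ → E} {bound : ℝ → ℝ}
    (hbound : ∀ n : ℕ, ∀ x ∈ Set.Ioo (0 : ℝ) 1, 1 ≤ ⌊x * n⌋₊ → ⌊x * n⌋₊ ≤ n →
      ‖(n : ℝ) • f n ⌊x * n⌋₊‖ ≤ bound x)
    (hbound_nonneg : ∀ x ∈ Set.Ioo (0 : ℝ) 1, 0 ≤ bound x)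
    (hint : IntervalIntegrable bound volume 0 1)
    (hlim : ∀ x ∈ Set.Ioo (0 : ℝ) 1,
      Tendsto (fun n : ℕ => (n : ℝ) • f n ⌊x * n⌋₊) atTop (𝓝 (g x)))
    (hend : Tendsto (fun n => f n n) atTop (𝓝 0)) :
    Tendsto (fun n => ∑ i ∈ Finset.Icc 1 n, f n i) atTop (𝓝 (∫ x in (0 : ℝ)..1, g x)) := by
  have hIoo : ∀ᵐ x : ℝ, x ∈ Set.uIoc 0 1 → x ∈ Set.Ioo (0 : ℝ) 1 := by
    filter_upwards [compl_mem_ae_iff.2 (measure_singleton (1 : ℝ))] with x hx1 hx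
    rw [Set.uIoc_of_le zero_le_one] at hx
    exact ⟨hx.1, hx.2.lt_of_ne hx1⟩
  have hlimint : Tendsto (fun n : ℕ =>
      ∫ x in (0 : ℝ)..1, (n : ℝ) • if ⌊x * n⌋₊ = 0 then 0 else f n ⌊x * n⌋₊) atTop
      (𝓝 (∫ x in (0 : ℝ)..1, g x)) := by
    refine intervalIntegral.tendsto_integral_filter_of_dominated_convergence bound
      (.of_forall fun n => ?_) (.of_forall fun n => ?_) hint ?_
    · exact ((measurable_comp_floor_mul (fun i => if i = 0 then 0 else f n i) n).const_smul
        (n : ℝ)).aestronglyMeasurable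
    · filter_upwards [hIoo] with x hx hx'
      specialize hx hx'
      split_ifs with h0
      · simpa using hbound_nonneg x hx
      · exact hbound n x hx (by omega)
          (Nat.floor_le_of_le (mul_le_of_le_one_left n.cast_nonneg hx.2.le))
    · filter_upwards [hIoo] with x hx hx'
      refine (hlim x (hx hx')).congr' ?_
      filter_upwards [(tendsto_floor_mul_atTop (hx hx').1).eventually_ge_atTop 1] with n hn
      rw [if_neg (Nat.one_le_iff_ne_zero.1 hn)]
  rw [← add_zero (∫ x in (0 : ℝ)..1, g x)]
  refine (hlimint.add hend).congr' ?_
  filter_upwards [eventually_ge_atTop 1] with n hn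
  exact (sum_Icc_one_eq_integral_floor_add hn (f n)).symm

end RiemannSum

section ExponentialProduct

lemma norm_prod_one_add_sub_exp_sum_le {ι : Type*} (s : Finset ι) (w : ι → ℂ) :
    ‖∏ i ∈ s, (1 + w i) - Complex.exp (∑ i ∈ s, w i)‖ ≤
      (∑ i ∈ s, ‖w i‖ ^ 2) * Real.exp (∑ i ∈ s, ‖w i‖) := by
  classical
  induction s using Finset.induction_on with
  | empty => simp
  | insert i s hi ih =>
    rw [Finset.prod_insert hi, Finset.sum_insert hi, Finset.sum_insert hi, Finset.sum_insert hi,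
      Complex.exp_add, Real.exp_add]
    set Q := ∏ j ∈ s, (1 + w j)
    set S := ∑ j ∈ s, w j
    set R := ∑ j ∈ s, ‖w j‖
    have hfactor : ‖1 + w i‖ ≤ Real.exp ‖w i‖ :=
      (norm_add_le _ _).trans (by rw [norm_one, add_comm]; exact Real.add_one_le_exp _)
    have hremainder : ‖1 + w i - Complex.exp (w i)‖ ≤ ‖w i‖ ^ 2 * Real.exp ‖w i‖ := by
      rw [norm_sub_rev]
      simpa [Finset.sum_range_succ] using Complex.norm_exp_sub_sum_le_norm_mul_exp (w i) 2
    have hexp : ‖Complex.exp S‖ ≤ Real.exp R :=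
      (Complex.norm_exp_le_exp_norm _).trans (Real.exp_le_exp.2 (norm_sum_le _ _))
    calc ‖(1 + w i) * Q - Complex.exp (w i) * Complex.exp S‖
        = ‖(1 + w i) * (Q - Complex.exp S) + (1 + w i - Complex.exp (w i)) * Complex.exp S‖ := by
          ring_nf
      _ ≤ ‖1 + w i‖ * ‖Q - Complex.exp S‖ + ‖1 + w i - Complex.exp (w i)‖ * ‖Complex.exp S‖ := by
          rw [← norm_mul, ← norm_mul]
          exact norm_add_le _ _
      _ ≤ Real.exp ‖w i‖ * ((∑ j ∈ s, ‖w j‖ ^ 2) * Real.exp R) +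
          ‖w i‖ ^ 2 * Real.exp ‖w i‖ * Real.exp R := by gcongr
      _ = _ := by ring

lemma tendsto_prod_one_add {ι κ : Type*} {l : Filter κ} {s : κ → Finset ι} {w : κ → ι → ℂ}
    (hsq : Tendsto (fun n => ∑ i ∈ s n, ‖w n i‖ ^ 2) l (𝓝 0)) {B : ℝ}
    (hB : ∀ᶠ n in l, ∑ i ∈ s n, ‖w n i‖ ≤ B) {L : ℂ}
    (hL : Tendsto (fun n => ∑ i ∈ s n, w n i) l (𝓝 L)) :
    Tendsto (fun n => ∏ i ∈ s n, (1 + w n i)) l (𝓝 (Complex.exp L)) := by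
  have hdiff : Tendsto (fun n => ∏ i ∈ s n, (1 + w n i) - Complex.exp (∑ i ∈ s n, w n i)) l
      (𝓝 0) := by
    refine squeeze_zero_norm' ?_ (by simpa using hsq.mul_const (Real.exp B))
    filter_upwards [hB] with n hn
    refine (norm_prod_one_add_sub_exp_sum_le _ _).trans ?_
    gcongr
  simpa using hdiff.add (hL.cexp)

lemma tendsto_sum_Icc_zero_of_summable_bound {f : ℕ → ℕ → ℝ} {b : ℕ → ℝ} (hb : Summable b)
    (hle : ∀ n, ∀ i ∈ Finset.Icc 1 n, ‖f n i‖ ≤ b i)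
    (hf : ∀ i, Tendsto (fun n => f n i) atTop (𝓝 0)) :
    Tendsto (fun n => ∑ i ∈ Finset.Icc 1 n, f n i) atTop (𝓝 0) := by
  have hlim : Tendsto (fun n => ∑' i, (Finset.Icc 1 n : Set ℕ).indicator (f n) i) atTop
      (𝓝 (∑' _ : ℕ, (0 : ℝ))) := by
    refine tendsto_tsum_of_dominated_convergence hb.abs (fun i => ?_)
      (.of_forall fun n i => ?_)
    · exact squeeze_zero_norm (fun n => norm_indicator_le_norm_self _ _)
        (by simpa using (hf i).norm)
    · by_cases hi : i ∈ Finset.Icc 1 n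
      · rw [Set.indicator_of_mem (Finset.mem_coe.2 hi)]
        exact (hle n i hi).trans (le_abs_self _)
      · rw [Set.indicator_of_notMem (Finset.mem_coe.not.2 hi), norm_zero]
        exact abs_nonneg _
  simpa only [tsum_zero, ← sum_eq_tsum_indicator] using hlim

end ExponentialProduct

section UnifMgf

lemma continuous_unifMgf : Continuous unifMgf :=
  intervalIntegral.continuous_parametric_intervalIntegral_of_continuous'
    (f := fun (z : ℂ) (u : ℝ) => Complex.exp (z * u)) (by fun_prop) 0 1

lemma norm_unifMgf_sub_sum_le (z : ℂ) (n : ℕ) :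
    ‖unifMgf z - ∑ k ∈ Finset.range n, z ^ k / (k + 1).factorial‖ ≤ ‖z‖ ^ n * Real.exp ‖z‖ := by
  have hterm (k : ℕ) :
      ∫ u in (0 : ℝ)..1, (z * u) ^ k / k.factorial = z ^ k / (k + 1).factorial := by
    have hpow : ∫ u in (0 : ℝ)..1, (u : ℂ) ^ k = 1 / (k + 1) := by
      simp_rw [← Complex.ofReal_pow]
      rw [intervalIntegral.integral_ofReal, integral_pow]
      simp
    simp_rw [mul_pow]
    rw [intervalIntegral.integral_div, intervalIntegral.integral_const_mul, hpow,
      Nat.factorial_succ, Nat.cast_mul, Nat.cast_succ, mul_one_div, div_div]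
  have heq : unifMgf z - ∑ k ∈ Finset.range n, z ^ k / (k + 1).factorial =
      ∫ u in (0 : ℝ)..1,
        (Complex.exp (z * u) - ∑ k ∈ Finset.range n, (z * u) ^ k / k.factorial) := by
    rw [intervalIntegral.integral_sub (Continuous.intervalIntegrable (by fun_prop) _ _)
      (Continuous.intervalIntegrable (by fun_prop) _ _),
      intervalIntegral.integral_finsetSum
        fun k _ => Continuous.intervalIntegrable (by fun_prop) _ _]
    simp only [hterm, unifMgf]
  rw [heq]
  refine (intervalIntegral.norm_integral_le_of_norm_le_const
    (C := ‖z‖ ^ n * Real.exp ‖z‖) fun u hu => ?_).trans (by simp)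
  rw [Set.uIoc_of_le zero_le_one] at hu
  have hzu : ‖z * u‖ ≤ ‖z‖ := by
    rw [norm_mul, Complex.norm_real, Real.norm_of_nonneg hu.1.le]
    exact mul_le_of_le_one_right (norm_nonneg _) hu.2
  exact (Complex.norm_exp_sub_sum_le_norm_mul_exp (z * u) n).trans (by gcongr)

lemma norm_unifMgf_sub_one_le (z : ℂ) : ‖unifMgf z - 1‖ ≤ ‖z‖ * Real.exp ‖z‖ := by
  simpa using norm_unifMgf_sub_sum_le z 1

lemma norm_unifMgf_sub_one_sub_half_le (z : ℂ) :
    ‖unifMgf z - 1 - z / 2‖ ≤ ‖z‖ ^ 2 * Real.exp ‖z‖ := by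
  simpa [Finset.sum_range_succ, sub_sub] using norm_unifMgf_sub_sum_le z 2

end UnifMgf

section HeightProdLimit

lemma norm_mul_unifMgf_sub_one_le {p r C : ℝ} (hp : 0 ≤ p) (hr : 0 ≤ r) (hrC : r ≤ C) (z : ℂ) :
    ‖(p : ℂ) * (unifMgf (z * r) - 1)‖ ≤ ‖z‖ * Real.exp (‖z‖ * C) * (p * r) := by
  have hnorm : ‖z * (r : ℂ)‖ = ‖z‖ * r := by
    rw [norm_mul, Complex.norm_real, Real.norm_of_nonneg hr]
  have hle := norm_unifMgf_sub_one_le (z * r)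
  rw [hnorm] at hle
  calc ‖(p : ℂ) * (unifMgf (z * r) - 1)‖ = p * ‖unifMgf (z * r) - 1‖ := by
        rw [norm_mul, Complex.norm_real, Real.norm_of_nonneg hp]
    _ ≤ p * (‖z‖ * r * Real.exp (‖z‖ * C)) := by
        gcongr
        exact hle.trans (by gcongr)
    _ = _ := by ring

lemma norm_mul_unifMgf_sub_one_sub_le {p r C : ℝ} (hp : 0 ≤ p) (hr : 0 ≤ r) (hrC : r ≤ C) (z : ℂ) :
    ‖(p : ℂ) * (unifMgf (z * r) - 1) - z / 2 * (p * r : ℝ)‖ ≤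
      ‖z‖ ^ 2 * Real.exp (‖z‖ * C) * (p * r ^ 2) := by
  have hnorm : ‖z * (r : ℂ)‖ = ‖z‖ * r := by
    rw [norm_mul, Complex.norm_real, Real.norm_of_nonneg hr]
  have hle := norm_unifMgf_sub_one_sub_half_le (z * r)
  rw [hnorm] at hle
  calc ‖(p : ℂ) * (unifMgf (z * r) - 1) - z / 2 * (p * r : ℝ)‖
      = ‖(p : ℂ) * (unifMgf (z * r) - 1 - z * r / 2)‖ := by
        push_cast
        ring_nf
    _ = p * ‖unifMgf (z * r) - 1 - z * r / 2‖ := by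
        rw [norm_mul, Complex.norm_real, Real.norm_of_nonneg hp]
    _ ≤ p * ((‖z‖ * r) ^ 2 * Real.exp (‖z‖ * C)) := by
        gcongr
        exact hle.trans (by gcongr)
    _ = _ := by ring

lemma tendsto_sum_mul_unifMgf_sub_one {ι κ : Type*} {l : Filter κ} {s : κ → Finset ι} {p : ι → ℝ}
    {r : κ → ι → ℝ} {C m : ℝ} (hp : ∀ n, ∀ i ∈ s n, 0 ≤ p i)
    (hr : ∀ n, ∀ i ∈ s n, 0 ≤ r n i ∧ r n i ≤ C)
    (hsum : Tendsto (fun n => ∑ i ∈ s n, p i * r n i) l (𝓝 m))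
    (hsq : Tendsto (fun n => ∑ i ∈ s n, p i * r n i ^ 2) l (𝓝 0)) (z : ℂ) :
    Tendsto (fun n => ∑ i ∈ s n, (p i : ℂ) * (unifMgf (z * r n i) - 1)) l (𝓝 (z / 2 * m)) := by
  have hdiff : Tendsto (fun n => ∑ i ∈ s n, (p i : ℂ) * (unifMgf (z * r n i) - 1) -
      z / 2 * (∑ i ∈ s n, p i * r n i : ℝ)) l (𝓝 0) := by
    refine squeeze_zero_norm (fun n => ?_)
      (by simpa using hsq.const_mul (‖z‖ ^ 2 * Real.exp (‖z‖ * C)))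
    rw [Complex.ofReal_sum, Finset.mul_sum, ← Finset.sum_sub_distrib, Finset.mul_sum]
    exact (norm_sum_le _ _).trans (Finset.sum_le_sum fun i hi =>
      norm_mul_unifMgf_sub_one_sub_le (hp n i hi) (hr n i hi).1 (hr n i hi).2 z)
  simpa using hdiff.add (hsum.ofReal.const_mul (z / 2))

variable {a : ℕ → ℝ}

lemma heightProd_div (a : ℕ → ℝ) (n : ℕ) (z : ℂ) (c : ℝ) :
    heightProd a n (z / c) =
      ∏ i ∈ Finset.Icc 1 n, (1 + segProb a i * (unifMgf (z * (a i / c : ℝ)) - 1)) := by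
  simp only [heightProd, Complex.ofReal_div, div_mul_eq_mul_div, mul_div_assoc]

lemma tendsto_sum_norm_segProb_mul_unifMgf_sub_one_sq (ha : ∀ n, 1 ≤ n → 0 < a n)
    (hs : Summable fun k => segProb a k ^ 2) {c : ℕ → ℝ} (hc : Tendsto c atTop atTop)
    (hc0 : ∀ n, 1 ≤ n → 0 < c n) {C : ℝ} (hC : ∀ i n, 1 ≤ i → i ≤ n → a i / c n ≤ C) (z : ℂ) :
    Tendsto (fun n => ∑ i ∈ Finset.Icc 1 n,
      ‖(segProb a i : ℂ) * (unifMgf (z * (a i / c n : ℝ)) - 1)‖ ^ 2) atTop (𝓝 0) := by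
  refine tendsto_sum_Icc_zero_of_summable_bound (hs.mul_left ((‖z‖ * Real.exp (‖z‖ * C) * C) ^ 2))
    (fun n i hi => ?_) fun i => ?_
  · obtain ⟨hi, hin⟩ := Finset.mem_Icc.1 hi
    have hp := segProb_pos ha hi
    rw [Real.norm_of_nonneg (by positivity), ← mul_pow]
    refine pow_le_pow_left₀ (norm_nonneg _) ((norm_mul_unifMgf_sub_one_le hp.le
      (div_pos (ha i hi) (hc0 n (hi.trans hin))).le (hC i n hi hin) z).trans ?_) 2
    rw [mul_assoc (‖z‖ * _), mul_comm C]
    gcongr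
    exact hC i n hi hin
  · have hzero : Tendsto (fun n => z * (a i / c n : ℝ)) atTop (𝓝 0) := by
      simpa using (hc.const_div_atTop (a i)).ofReal.const_mul z
    have hmgf : Tendsto (fun n => unifMgf (z * (a i / c n : ℝ)) - 1) atTop (𝓝 0) := by
      simpa [unifMgf] using ((continuous_unifMgf.tendsto 0).comp hzero).sub_const 1
    simpa using (hmgf.const_mul (segProb a i : ℂ)).norm.pow 2

lemma tendsto_heightProd_div (ha : ∀ n, 1 ≤ n → 0 < a n)
    (hs : Summable fun k => segProb a k ^ 2) {c : ℕ → ℝ} (hc : Tendsto c atTop atTop)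
    (hc0 : ∀ n, 1 ≤ n → 0 < c n) {C B : ℝ} (hC : ∀ i n, 1 ≤ i → i ≤ n → a i / c n ≤ C)
    (hB : ∀ n, ∑ i ∈ Finset.Icc 1 n, segProb a i * (a i / c n) ≤ B) {z L : ℂ}
    (hL : Tendsto (fun n => ∑ i ∈ Finset.Icc 1 n,
      (segProb a i : ℂ) * (unifMgf (z * (a i / c n : ℝ)) - 1)) atTop (𝓝 L)) :
    Tendsto (fun n => heightProd a n (z / c n)) atTop (𝓝 (Complex.exp L)) := by
  simp only [heightProd_div]
  refine tendsto_prod_one_add (B := ‖z‖ * Real.exp (‖z‖ * C) * B)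
    (tendsto_sum_norm_segProb_mul_unifMgf_sub_one_sq ha hs hc hc0 hC z) (.of_forall fun n => ?_) hL
  calc ∑ i ∈ Finset.Icc 1 n, ‖(segProb a i : ℂ) * (unifMgf (z * (a i / c n : ℝ)) - 1)‖
      ≤ ∑ i ∈ Finset.Icc 1 n, ‖z‖ * Real.exp (‖z‖ * C) * (segProb a i * (a i / c n)) := by
        refine Finset.sum_le_sum fun i hi => ?_
        obtain ⟨hi, hin⟩ := Finset.mem_Icc.1 hi
        exact norm_mul_unifMgf_sub_one_le (segProb_pos ha hi).le
          (div_pos (ha i hi) (hc0 n (hi.trans hin))).le (hC i n hi hin) z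
    _ ≤ ‖z‖ * Real.exp (‖z‖ * C) * B := by
        rw [← Finset.mul_sum]
        gcongr
        exact hB n

end HeightProdLimit

namespace RegularlyVarying

variable {a : ℕ → ℝ} {α : ℝ}

lemma tendsto_totalLength_div (ha : ∀ n, 1 ≤ n → 0 < a n) (h : RegularlyVarying a α)
    (hα : -1 < α) : Tendsto (fun n : ℕ => totalLength a n / (n * a n)) atTop (𝓝 (1 / (α + 1))) := by
  obtain ⟨δ, hδ, hδα⟩ := exists_between (lt_min hα (neg_one_lt_zero (R := ℝ)))
  obtain ⟨hδα, hδ0⟩ := lt_min_iff.1 hδα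
  obtain ⟨C, hC, hpotter⟩ := h.exists_div_le_mul_rpow ha hδα
  have hcancel (n i : ℕ) (hn : 1 ≤ n) : (n : ℝ) • (a i / (n * a n)) = a i / a n := by
    have hn0 : (n : ℝ) ≠ 0 := by exact_mod_cast (Nat.one_le_iff_ne_zero.1 hn)
    rw [smul_eq_mul, ← mul_div_assoc, mul_div_mul_left _ _ hn0]
  have hint : ∫ x in (0 : ℝ)..1, x ^ α = 1 / (α + 1) := by
    rw [integral_rpow (Or.inl hα), Real.one_rpow, Real.zero_rpow (by linarith), sub_zero]
  rw [← hint]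
  simp only [totalLength, Finset.sum_div]
  refine tendsto_sum_Icc_of_floor_dominated (f := fun n i => a i / (n * a n))
    (bound := fun x => C * (x / 2) ^ δ) (fun n x hx h1 h2 => ?_) (fun x hx => ?_) ?_
    (fun x hx => ?_) ?_
  · have hn := h1.trans h2
    rw [hcancel n _ hn, Real.norm_of_nonneg (div_pos (ha _ h1) (ha n hn)).le]
    exact (hpotter _ n h1 h2).trans (mul_le_mul_of_nonneg_left (Real.rpow_le_rpow_of_nonpos
      (half_pos hx.1) (half_le_floor_mul_div h1) hδ0.le) hC.le)
  · have := hx.1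
    positivity
  · have hpow := (intervalIntegral.intervalIntegrable_rpow' (a := 0) (b := 1) hδ).const_mul
      (C * (2⁻¹ : ℝ) ^ δ)
    refine hpow.congr fun x hx => ?_
    rw [Set.uIoc_of_le zero_le_one] at hx
    rw [div_eq_inv_mul, Real.mul_rpow (by norm_num) hx.1.le, mul_assoc]
  · refine (h x hx.1).congr' ?_
    filter_upwards [eventually_ge_atTop 1] with n hn
    rw [hcancel n _ hn]
  · refine tendsto_one_div_atTop_nhds_zero_nat.congr' ?_
    filter_upwards [eventually_ge_atTop 1] with n hn
    rw [div_mul_cancel_right₀ (ha n hn).ne', one_div]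

lemma tendsto_mul_segProb (ha : ∀ n, 1 ≤ n → 0 < a n) (h : RegularlyVarying a α)
    (hα : -1 < α) : Tendsto (fun n : ℕ => n * segProb a n) atTop (𝓝 (α + 1)) := by
  have hinv := (h.tendsto_totalLength_div ha hα).inv₀ (by simp; linarith)
  rw [one_div, inv_inv] at hinv
  refine hinv.congr fun n => ?_
  rw [inv_div, segProb, mul_div_assoc]

lemma exists_mul_segProb_le (ha : ∀ n, 1 ≤ n → 0 < a n) (h : RegularlyVarying a α)
    (hα : -1 < α) : ∃ C : ℝ, 0 ≤ C ∧ ∀ n : ℕ, n * segProb a n ≤ C := by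
  obtain ⟨C, hC⟩ := (h.tendsto_mul_segProb ha hα).bddAbove_range
  exact ⟨max C 0, le_max_right _ _, fun n => (hC ⟨n, rfl⟩).trans (le_max_left _ _)⟩

lemma summable_segProb_sq (ha : ∀ n, 1 ≤ n → 0 < a n) (h : RegularlyVarying a α) (hα : -1 < α) :
    Summable fun k => segProb a k ^ 2 := by
  obtain ⟨C, -, hC⟩ := h.exists_mul_segProb_le ha hα
  refine ((Real.summable_nat_pow_inv.2 one_lt_two).mul_left (C ^ 2)).of_norm_bounded_eventually_nat
    ?_
  filter_upwards [eventually_ge_atTop 1] with n hn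
  have hn0 : (0 : ℝ) < n := by exact_mod_cast hn
  rw [Real.norm_of_nonneg (by positivity), ← div_eq_mul_inv, ← div_pow]
  exact pow_le_pow_left₀ (segProb_pos ha hn).le ((le_div_iff₀' hn0).2 (hC n)) 2

lemma tendsto_mul_segProb_floor (ha : ∀ n, 1 ≤ n → 0 < a n) (h : RegularlyVarying a α)
    (hα : -1 < α) {x : ℝ} (hx : 0 < x) :
    Tendsto (fun n : ℕ => n * segProb a ⌊x * n⌋₊) atTop (𝓝 ((α + 1) / x)) := by
  refine (((h.tendsto_mul_segProb ha hα).comp (tendsto_floor_mul_atTop hx)).div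
    (tendsto_floor_mul_div hx) hx.ne').congr' ?_
  filter_upwards [(tendsto_floor_mul_atTop hx).eventually_ge_atTop 1, eventually_ge_atTop 1]
    with n hxn hn
  have : (0 : ℝ) < ⌊x * n⌋₊ := by exact_mod_cast hxn
  have : (0 : ℝ) < n := by exact_mod_cast hn
  simp only [Pi.div_apply, Function.comp_apply]
  field_simp

lemma exists_mul_segProb_floor_le (ha : ∀ n, 1 ≤ n → 0 < a n) (h : RegularlyVarying a α)
    (hα : -1 < α) : ∃ C : ℝ, 0 ≤ C ∧ ∀ (x : ℝ) (n : ℕ), 0 < x → 1 ≤ ⌊x * n⌋₊ →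
      n * segProb a ⌊x * n⌋₊ ≤ C / x := by
  obtain ⟨C, hC0, hC⟩ := h.exists_mul_segProb_le ha hα
  refine ⟨2 * C, by positivity, fun x n hx hxn => ?_⟩
  have hp := (segProb_pos ha hxn).le
  have hn0 : (0 : ℝ) < n := by
    refine n.cast_nonneg.lt_of_ne fun h0 => ?_
    simp [← h0] at hxn
  have hhalf := (div_le_div_iff₀ two_pos hn0).1 (half_le_floor_mul_div hxn)
  rw [le_div_iff₀ hx]
  nlinarith [hC ⌊x * n⌋₊]

lemma exists_smul_segProb_smul_floor_le {E : Type*} [NormedAddCommGroup E] [NormedSpace ℝ E]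
    (ha : ∀ n, 1 ≤ n → 0 < a n) (h : RegularlyVarying a α) (hα : 0 < α) {G : ℝ → E}
    (hG_le : ∀ C : ℝ, ∃ K : ℝ, 0 ≤ K ∧ ∀ s, 0 ≤ s → s ≤ C → ‖G s‖ ≤ K * s) :
    ∃ B : ℝ, 0 ≤ B ∧ ∀ n : ℕ, ∀ x ∈ Set.Ioo (0 : ℝ) 1, 1 ≤ ⌊x * n⌋₊ → ⌊x * n⌋₊ ≤ n →
      ‖(n : ℝ) • segProb a ⌊x * n⌋₊ • G (a ⌊x * n⌋₊ / a n)‖ ≤ B * x ^ (α / 2 - 1) := by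
  obtain ⟨C, hC, hpotter⟩ := h.exists_div_le_mul_rpow ha (half_lt_self hα)
  obtain ⟨D, hD0, hD⟩ := h.exists_mul_segProb_floor_le ha (neg_one_lt_zero.trans hα)
  obtain ⟨K, hK0, hK⟩ := hG_le C
  refine ⟨D * K * C, by positivity, fun n x ⟨hx0, hx1⟩ h1 h2 => ?_⟩
  have hn := h1.trans h2
  have hratio : a ⌊x * n⌋₊ / a n ≤ C * x ^ (α / 2) := by
    refine (hpotter _ n h1 h2).trans ?_
    gcongr
    exact floor_mul_div_le hx0.le n
  have hG := hK _ (div_pos (ha _ h1) (ha n hn)).le (hratio.trans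
    (mul_le_of_le_one_right hC.le (Real.rpow_le_one hx0.le hx1.le (by linarith))))
  calc ‖(n : ℝ) • segProb a ⌊x * n⌋₊ • G (a ⌊x * n⌋₊ / a n)‖
      = n * segProb a ⌊x * n⌋₊ * ‖G (a ⌊x * n⌋₊ / a n)‖ := by
        rw [smul_smul, norm_smul,
          Real.norm_of_nonneg (mul_nonneg n.cast_nonneg (segProb_pos ha h1).le)]
    _ ≤ D / x * (K * (C * x ^ (α / 2))) :=
        mul_le_mul (hD x n hx0 h1) (hG.trans (by gcongr)) (norm_nonneg _) (by positivity)
    _ = D * K * C * x ^ (α / 2 - 1) := by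
        rw [Real.rpow_sub_one hx0.ne']
        ring

lemma tendsto_sum_segProb_smul {E : Type*} [NormedAddCommGroup E] [NormedSpace ℝ E]
    [CompleteSpace E] [MeasurableSpace E] [BorelSpace E] [SecondCountableTopology E]
    (ha : ∀ n, 1 ≤ n → 0 < a n) (h : RegularlyVarying a α) (hα : 0 < α) {G : ℝ → E}
    (hG : Continuous G)
    (hG_le : ∀ C : ℝ, ∃ K : ℝ, 0 ≤ K ∧ ∀ s, 0 ≤ s → s ≤ C → ‖G s‖ ≤ K * s) :
    Tendsto (fun n => ∑ i ∈ Finset.Icc 1 n, segProb a i • G (a i / a n)) atTop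
      (𝓝 (∫ x in (0 : ℝ)..1, ((α + 1) / x) • G (x ^ α))) := by
  have hα1 : -1 < α := by linarith
  obtain ⟨B, hB0, hB⟩ := h.exists_smul_segProb_smul_floor_le ha hα hG_le
  refine tendsto_sum_Icc_of_floor_dominated (f := fun n i => segProb a i • G (a i / a n))
    (bound := fun x => B * x ^ (α / 2 - 1)) hB (fun x hx => ?_)
    ((intervalIntegral.intervalIntegrable_rpow' (by linarith)).const_mul _) (fun x hx => ?_) ?_
  · have := hx.1
    positivity
  · simp only [smul_smul]
    exact (h.tendsto_mul_segProb_floor ha hα1 hx.1).smul ((hG.tendsto _).comp (h x hx.1))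
  · have hp := (h.summable_segProb_sq ha hα1).tendsto_atTop_zero.sqrt
    rw [Real.sqrt_zero] at hp
    refine (zero_smul ℝ (G 1) ▸ hp.smul_const (G 1)).congr' ?_
    filter_upwards [eventually_ge_atTop 1] with n hn
    rw [div_self (ha n hn).ne', Real.sqrt_sq (segProb_pos ha hn).le]

lemma tendsto_heightProd_div_of_pos (ha : ∀ n, 1 ≤ n → 0 < a n) (h : RegularlyVarying a α)
    (hα : 0 < α) (z : ℂ) : Tendsto (fun n => heightProd a n (z / a n)) atTop
      (𝓝 (Complex.exp (∫ x in (0 : ℝ)..1,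
        ((α + 1) / x) • (unifMgf (z * (x ^ α : ℝ)) - 1)))) := by
  obtain ⟨C, -, hle⟩ := h.exists_le_mul ha hα
  obtain ⟨B, hB⟩ := (h.tendsto_sum_segProb_smul ha hα (G := fun s : ℝ => s) continuous_id
    fun C => ⟨1, zero_le_one, fun s hs _ => by rw [Real.norm_of_nonneg hs, one_mul]⟩).bddAbove_range
  refine tendsto_heightProd_div ha (h.summable_segProb_sq ha (by linarith))
    (h.tendsto_atTop_of_pos ha hα) ha
    (fun i n hi hin => (div_le_iff₀ (ha n (hi.trans hin))).2 (hle i n hi hin))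
    (fun n => hB ⟨n, rfl⟩) ?_
  simp only [← Complex.real_smul]
  refine h.tendsto_sum_segProb_smul ha hα (G := fun s : ℝ => unifMgf (z * s) - 1)
    ((continuous_unifMgf.comp (by fun_prop)).sub continuous_const)
    fun C => ⟨‖z‖ * Real.exp (‖z‖ * C), by positivity, fun s hs hsC => ?_⟩
  simpa using norm_mul_unifMgf_sub_one_le zero_le_one hs hsC z

end RegularlyVarying

section WeightedCesaro

lemma sum_Icc_one_eq_sum_range {M : Type*} [AddCommMonoid M] (f : ℕ → M) (n : ℕ) :
    ∑ i ∈ Finset.Icc 1 n, f i = ∑ i ∈ Finset.range n, f (i + 1) := by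
  rw [Finset.range_eq_Ico, Finset.sum_Ico_add' f 0 n 1]
  rfl

lemma tendsto_sum_mul_div_sum {b c : ℕ → ℝ} {L : ℝ} (hb : ∀ n, 1 ≤ n → 0 ≤ b n)
    (hsum : Tendsto (fun n => ∑ i ∈ Finset.Icc 1 n, b i) atTop atTop) (hc : Tendsto c atTop (𝓝 L)) :
    Tendsto (fun n => (∑ i ∈ Finset.Icc 1 n, c i * b i) / ∑ i ∈ Finset.Icc 1 n, b i) atTop
      (𝓝 L) := by
  have hne := hsum.eventually_ne_atTop 0
  simp only [sum_Icc_one_eq_sum_range] at hsum hne ⊢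
  have hc0 : Tendsto (fun i => c (i + 1) - L) atTop (𝓝 0) := by
    simpa using ((tendsto_add_atTop_iff_nat 1).2 hc).sub_const L
  have hlittle : (fun i => (c (i + 1) - L) * b (i + 1)) =o[atTop] fun i => b (i + 1) := by
    simpa using ((Asymptotics.isLittleO_one_iff ℝ).2 hc0).mul_isBigO
      (Asymptotics.isBigO_refl (fun i => b (i + 1)) atTop)
  have hdiff := (hlittle.sum_range (fun i => hb (i + 1) i.succ_pos) hsum).tendsto_div_nhds_zero
  refine (zero_add L ▸ hdiff.add_const L).congr' ?_
  filter_upwards [hne] with n hn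
  simp only [sub_mul, Finset.sum_sub_distrib, ← Finset.mul_sum]
  rw [sub_div, mul_div_cancel_right₀ _ hn, sub_add_cancel]

end WeightedCesaro

section SlowVariation

variable {a : ℕ → ℝ}

lemma harmonicSum_pos (ha : ∀ n, 1 ≤ n → 0 < a n) {n : ℕ} (hn : 1 ≤ n) : 0 < harmonicSum a n := by
  refine Finset.sum_pos (fun i hi => ?_) ⟨1, by simp [hn]⟩
  have hi := (Finset.mem_Icc.1 hi).1
  exact mul_pos (inv_pos.2 (by exact_mod_cast hi)) (ha i hi)

lemma harmonicSum_mono (ha : ∀ n, 1 ≤ n → 0 < a n) : Monotone (harmonicSum a) := by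
  intro m n hmn
  exact Finset.sum_le_sum_of_subset_of_nonneg (Finset.Icc_subset_Icc_right hmn)
    fun i hi _ => mul_nonneg (by positivity) (ha i (Finset.mem_Icc.1 hi).1).le

lemma totalLength_mul_rpow_le (ha : ∀ n, 1 ≤ n → 0 < a n) {η : ℝ} (hη : 0 ≤ η) (n : ℕ) :
    totalLength (fun i => a i * (i : ℝ) ^ (η - 1)) n ≤ (n : ℝ) ^ η * harmonicSum a n := by
  rw [totalLength, harmonicSum, Finset.mul_sum]
  refine Finset.sum_le_sum fun i hi => ?_
  obtain ⟨hi, hin⟩ := Finset.mem_Icc.1 hi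
  have hi0 : (0 : ℝ) < i := by exact_mod_cast hi
  have hai := ha i hi
  calc a i * (i : ℝ) ^ (η - 1) = (i : ℝ) ^ η * ((i : ℝ)⁻¹ * a i) := by
        rw [Real.rpow_sub_one hi0.ne']
        ring
    _ ≤ (n : ℝ) ^ η * ((i : ℝ)⁻¹ * a i) := by gcongr

namespace RegularlyVarying

/-- Karamata's theorem for `a n * n ^ (η - 1)`, whose index `η - 1` is close to the critical
value `-1`, bounds the limit superior of the ratio by any `η > 0`. -/
lemma tendsto_div_harmonicSum (ha : ∀ n, 1 ≤ n → 0 < a n) (h : RegularlyVarying a 0) :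
    Tendsto (fun n => a n / harmonicSum a n) atTop (𝓝 0) := by
  have hratio (η : ℝ) (hη : 0 < η) : ∀ᶠ n in atTop, a n / harmonicSum a n < 2 * η := by
    have hb (n : ℕ) (hn : 1 ≤ n) : 0 < a n * (n : ℝ) ^ (η - 1) :=
      mul_pos (ha n hn) (Real.rpow_pos_of_pos (by exact_mod_cast hn) _)
    have hlim := (h.mul_rpow (η - 1)).tendsto_totalLength_div hb (by linarith)
    have hlt : 1 / (2 * η) < 1 / (0 + (η - 1) + 1) := by
      rw [zero_add, sub_add_cancel]
      gcongr
      linarith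
    filter_upwards [hlim.eventually (lt_mem_nhds hlt), eventually_ge_atTop 1] with n hn hn1
    have hn0 : (0 : ℝ) < n := by exact_mod_cast hn1
    have hpow : n * (a n * (n : ℝ) ^ (η - 1)) = (n : ℝ) ^ η * a n := by
      rw [Real.rpow_sub_one hn0.ne']
      field_simp
    rw [hpow] at hn
    have hle := hn.trans_le
      (div_le_div_of_nonneg_right (totalLength_mul_rpow_le ha hη.le n)
        (mul_nonneg (by positivity) (ha n hn1).le))
    rw [mul_div_mul_left _ _ (Real.rpow_pos_of_pos hn0 η).ne',
      div_lt_div_iff₀ (by positivity) (ha n hn1), one_mul] at hle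
    rw [div_lt_iff₀ (harmonicSum_pos ha hn1)]
    linarith
  rw [Metric.tendsto_nhds]
  intro ε hε
  filter_upwards [hratio (ε / 2) (half_pos hε), eventually_ge_atTop 1] with n hn hn1
  rw [dist_zero_right, Real.norm_of_nonneg (div_pos (ha n hn1) (harmonicSum_pos ha hn1)).le]
  linarith

lemma tendsto_sum_segProb_mul_div_harmonicSum (ha : ∀ n, 1 ≤ n → 0 < a n)
    (h : RegularlyVarying a 0) (hS : Tendsto (harmonicSum a) atTop atTop) :
    Tendsto (fun n => ∑ i ∈ Finset.Icc 1 n, segProb a i * (a i / harmonicSum a n)) atTop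
      (𝓝 1) := by
  have hp := h.tendsto_mul_segProb ha neg_one_lt_zero
  rw [zero_add] at hp
  refine (tendsto_sum_mul_div_sum
    (fun i hi => mul_nonneg (by positivity) (ha i hi).le) hS hp).congr fun n => ?_
  rw [Finset.sum_div]
  refine Finset.sum_congr rfl fun i hi => ?_
  have hi0 : (i : ℝ) ≠ 0 := by exact_mod_cast (Nat.one_le_iff_ne_zero.1 (Finset.mem_Icc.1 hi).1)
  rw [harmonicSum]
  field_simp

lemma tendsto_sum_segProb_mul_div_harmonicSum_sq (ha : ∀ n, 1 ≤ n → 0 < a n)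
    (h : RegularlyVarying a 0) (hS : Tendsto (harmonicSum a) atTop atTop) :
    Tendsto (fun n => ∑ i ∈ Finset.Icc 1 n, segProb a i * (a i / harmonicSum a n) ^ 2) atTop
      (𝓝 0) := by
  have hp := (h.tendsto_mul_segProb ha neg_one_lt_zero).mul (h.tendsto_div_harmonicSum ha)
  rw [mul_zero] at hp
  refine squeeze_zero (fun n => Finset.sum_nonneg fun i hi =>
    mul_nonneg (segProb_pos ha (Finset.mem_Icc.1 hi).1).le (by positivity)) (fun n => ?_)
    (tendsto_sum_mul_div_sum (fun i hi => mul_nonneg (by positivity) (ha i hi).le) hS hp)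
  rw [Finset.sum_div]
  refine Finset.sum_le_sum fun i hi => ?_
  obtain ⟨hi, hin⟩ := Finset.mem_Icc.1 hi
  have hi0 : (i : ℝ) ≠ 0 := by exact_mod_cast (Nat.one_le_iff_ne_zero.1 hi)
  have hai := ha i hi
  have hpi := segProb_pos ha hi
  have hSi := harmonicSum_pos ha hi
  have hSn := harmonicSum_pos ha (hi.trans hin)
  calc segProb a i * (a i / harmonicSum a n) ^ 2
      = segProb a i * (a i / harmonicSum a n * (a i / harmonicSum a n)) := by rw [sq]
    _ ≤ segProb a i * (a i / harmonicSum a i * (a i / harmonicSum a n)) := by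
        gcongr
        exact harmonicSum_mono ha hin
    _ = i * segProb a i * (a i / harmonicSum a i) * ((i : ℝ)⁻¹ * a i) / harmonicSum a n := by
        field_simp

lemma tendsto_heightProd_div_of_zero (ha : ∀ n, 1 ≤ n → 0 < a n) (h : RegularlyVarying a 0)
    (hS : Tendsto (harmonicSum a) atTop atTop) (z : ℂ) :
    Tendsto (fun n => heightProd a n (z / harmonicSum a n)) atTop (𝓝 (Complex.exp (z / 2))) := by
  obtain ⟨C, hC⟩ := (h.tendsto_div_harmonicSum ha).bddAbove_range
  have hle (i n : ℕ) (hi : 1 ≤ i) (hin : i ≤ n) : a i / harmonicSum a n ≤ C :=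
    (div_le_div_of_nonneg_left (ha i hi).le (harmonicSum_pos ha hi)
      (harmonicSum_mono ha hin)).trans (hC ⟨i, rfl⟩)
  have hmean := h.tendsto_sum_segProb_mul_div_harmonicSum ha hS
  obtain ⟨B, hB⟩ := hmean.bddAbove_range
  refine tendsto_heightProd_div ha (h.summable_segProb_sq ha neg_one_lt_zero) hS
    (fun n hn => harmonicSum_pos ha hn) hle (fun n => hB ⟨n, rfl⟩) ?_
  have hsum := tendsto_sum_mul_unifMgf_sub_one (C := C)
    (fun n i hi => (segProb_pos ha (Finset.mem_Icc.1 hi).1).le)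
    (fun n i hi => ?_) hmean (h.tendsto_sum_segProb_mul_div_harmonicSum_sq ha hS) z
  · simpa using hsum
  · obtain ⟨hi, hin⟩ := Finset.mem_Icc.1 hi
    exact ⟨(div_pos (ha i hi) (harmonicSum_pos ha (hi.trans hin))).le, hle i n hi hin⟩

end RegularlyVarying

end SlowVariation

/-- The complex exponent of `ξ_(α)`: the extension of `xiExponent α` to complex arguments, which
gives the exponential moments on the real axis and the characteristic function on the imaginary
axis. -/
noncomputable def xiExponentComplex (α : ℝ) (z : ℂ) : ℂ :=
  (α + 1) / α * ∫ u in (0 : ℝ)..1, (Complex.exp (z * u) - 1) * ((1 - u) / u)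

section XiExponent

lemma norm_exp_sub_one_le_mul_exp (z : ℂ) : ‖Complex.exp z - 1‖ ≤ ‖z‖ * Real.exp ‖z‖ := by
  simpa using Complex.norm_exp_sub_sum_le_norm_mul_exp z 1

lemma unifMgf_of_ne_zero {z : ℂ} (hz : z ≠ 0) : unifMgf z = (Complex.exp z - 1) / z := by
  simp [unifMgf, integral_exp_mul_complex hz]

lemma hasDerivAt_unifMgf {z : ℂ} (hz : z ≠ 0) :
    HasDerivAt unifMgf ((Complex.exp z - unifMgf z) / z) z := by
  have hquot := ((Complex.hasDerivAt_exp z).sub_const 1).div (hasDerivAt_id z) hz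
  refine (hquot.congr_of_eventuallyEq ?_).congr_deriv ?_
  · filter_upwards [isOpen_ne.mem_nhds hz] with w hw using unifMgf_of_ne_zero hw
  · rw [unifMgf_of_ne_zero hz, id]
    field_simp

lemma norm_inv_smul_comp_mul_le {f : ℂ → ℂ} (hf : ∀ z, ‖f z‖ ≤ ‖z‖ * Real.exp ‖z‖) (z : ℂ) {y : ℝ}
    (hy : y ∈ Set.Ioc (0 : ℝ) 1) : ‖y⁻¹ • f (z * y)‖ ≤ ‖z‖ * Real.exp ‖z‖ := by
  have hy0 := hy.1
  have hzy : ‖z‖ * y ≤ ‖z‖ := mul_le_of_le_one_right (norm_nonneg z) hy.2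
  have hnorm : ‖z * y‖ = ‖z‖ * y := by rw [norm_mul, Complex.norm_real, Real.norm_of_nonneg hy0.le]
  calc ‖y⁻¹ • f (z * y)‖ = y⁻¹ * ‖f (z * y)‖ := by
        rw [norm_smul, Real.norm_of_nonneg (inv_pos.2 hy0).le]
    _ ≤ y⁻¹ * (‖z‖ * y * Real.exp ‖z‖) := by
        gcongr
        exact (hf _).trans (by rw [hnorm]; gcongr)
    _ = ‖z‖ * Real.exp ‖z‖ := by field_simp

lemma intervalIntegrable_inv_smul_comp_mul {f : ℂ → ℂ} (hcont : Continuous f)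
    (hf : ∀ z, ‖f z‖ ≤ ‖z‖ * Real.exp ‖z‖) (z : ℂ) :
    IntervalIntegrable (fun y : ℝ => y⁻¹ • f (z * y)) volume 0 1 := by
  rw [intervalIntegrable_iff_integrableOn_Ioc_of_le zero_le_one]
  refine Measure.integrableOn_of_bounded (M := ‖z‖ * Real.exp ‖z‖) (by simp) ?_ ?_
  · exact (measurable_inv.smul (hcont.comp (by fun_prop)).measurable).aestronglyMeasurable
  · filter_upwards [ae_restrict_mem measurableSet_Ioc] with y hy
    exact norm_inv_smul_comp_mul_le hf z hy

lemma integral_inv_smul_exp_sub_unifMgf (z : ℂ) :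
    ∫ y in (0 : ℝ)..1, (y⁻¹ • (Complex.exp (z * y) - 1) - y⁻¹ • (unifMgf (z * y) - 1)) =
      unifMgf z - 1 := by
  rcases eq_or_ne z 0 with rfl | hz
  · simp [unifMgf]
  have hexp := intervalIntegrable_inv_smul_comp_mul (f := fun w => Complex.exp w - 1)
    (by fun_prop) norm_exp_sub_one_le_mul_exp z
  have hmgf := intervalIntegrable_inv_smul_comp_mul (f := fun w => unifMgf w - 1)
    (continuous_unifMgf.sub continuous_const) norm_unifMgf_sub_one_le z
  rw [intervalIntegral.integral_eq_sub_of_hasDerivAt_of_le (f := fun y : ℝ => unifMgf (z * y))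
    zero_le_one (continuous_unifMgf.comp (by fun_prop)).continuousOn (fun y hy => ?_)
    (hexp.sub hmgf)]
  · simp [unifMgf]
  · have hy0 : (y : ℂ) ≠ 0 := by exact_mod_cast hy.1.ne'
    have hlin : HasDerivAt (fun y : ℝ => z * y) z y := by
      simpa using ((hasDerivAt_id y).ofReal_comp).const_mul z
    refine ((hasDerivAt_unifMgf (mul_ne_zero hz hy0)).comp y hlin).congr_deriv ?_
    simp only [Complex.real_smul, Complex.ofReal_inv]
    field_simp
    ring

/-- Integration by parts, in the form `y (d/dy) unifMgf (z y) = exp (z y) - unifMgf (z y)`. -/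
lemma integral_inv_smul_unifMgf_sub_one (z : ℂ) :
    ∫ y in (0 : ℝ)..1, y⁻¹ • (unifMgf (z * y) - 1) =
      ∫ u in (0 : ℝ)..1, (Complex.exp (z * u) - 1) * ((1 - u) / u) := by
  have hexp := intervalIntegrable_inv_smul_comp_mul (f := fun w => Complex.exp w - 1)
    (by fun_prop) norm_exp_sub_one_le_mul_exp z
  have hmgf := intervalIntegrable_inv_smul_comp_mul (f := fun w => unifMgf w - 1)
    (continuous_unifMgf.sub continuous_const) norm_unifMgf_sub_one_le z
  have hparts := integral_inv_smul_exp_sub_unifMgf z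
  rw [intervalIntegral.integral_sub hexp hmgf] at hparts
  have hmean : ∫ u in (0 : ℝ)..1, (Complex.exp (z * u) - 1) = unifMgf z - 1 := by
    rw [intervalIntegral.integral_sub (Continuous.intervalIntegrable (by fun_prop) _ _) (by simp)]
    simp [unifMgf]
  have hsplit : ∫ u in (0 : ℝ)..1, (Complex.exp (z * u) - 1) * ((1 - u) / u) =
      ∫ u in (0 : ℝ)..1, (u⁻¹ • (Complex.exp (z * u) - 1) - (Complex.exp (z * u) - 1)) := by
    refine intervalIntegral.integral_congr_Ioo_of_le zero_le_one fun u hu => ?_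
    have hu0 : (u : ℂ) ≠ 0 := by exact_mod_cast hu.1.ne'
    simp only [Complex.real_smul, Complex.ofReal_inv]
    field_simp
  rw [hsplit, intervalIntegral.integral_sub hexp (Continuous.intervalIntegrable (by fun_prop) _ _),
    hmean]
  linear_combination -hparts

lemma integral_inv_smul_comp_rpow {E : Type*} [NormedAddCommGroup E] [NormedSpace ℝ E] {α : ℝ}
    (hα : 0 < α) (f : ℝ → E) :
    ∫ x in (0 : ℝ)..1, x⁻¹ • f (x ^ α) = α⁻¹ • ∫ y in (0 : ℝ)..1, y⁻¹ • f y := by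
  have hunit : Set.Ioi (0 : ℝ) ∩ Set.Ioc 0 1 = Set.Ioc 0 1 :=
    Set.inter_eq_right.2 Set.Ioc_subset_Ioi_self
  have hsubst := integral_comp_rpow_Ioi_of_pos (g := (Set.Ioc (0 : ℝ) 1).indicator
    fun y => y⁻¹ • f y) hα
  rw [setIntegral_indicator measurableSet_Ioc, hunit] at hsubst
  have hind : ∫ x in Set.Ioc (0 : ℝ) 1, x⁻¹ • f (x ^ α) =
      ∫ x in Set.Ioi (0 : ℝ), (Set.Ioc (0 : ℝ) 1).indicator (fun x => x⁻¹ • f (x ^ α)) x := by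
    rw [setIntegral_indicator measurableSet_Ioc, hunit]
  rw [intervalIntegral.integral_of_le zero_le_one, intervalIntegral.integral_of_le zero_le_one,
    ← hsubst, ← integral_smul, hind]
  refine setIntegral_congr_fun measurableSet_Ioi fun x (hx : 0 < x) => ?_
  have hxα := Real.rpow_pos_of_pos hx α
  have hiff : x ^ α ∈ Set.Ioc (0 : ℝ) 1 ↔ x ∈ Set.Ioc (0 : ℝ) 1 := by
    simp only [Set.mem_Ioc, hx, hxα, true_and]
    rw [← Real.one_rpow α, Real.rpow_le_rpow_iff hx.le zero_le_one hα, Real.one_rpow]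
  by_cases hx1 : x ∈ Set.Ioc (0 : ℝ) 1
  · rw [Set.indicator_of_mem hx1, Set.indicator_of_mem (hiff.2 hx1), smul_smul, smul_smul,
      Real.rpow_sub_one hx.ne']
    congr 1
    field_simp
  · rw [Set.indicator_of_notMem hx1, Set.indicator_of_notMem (mt hiff.1 hx1), smul_zero, smul_zero]

lemma integral_unifMgf_rpow_eq_xiExponentComplex {α : ℝ} (hα : 0 < α) (z : ℂ) :
    ∫ x in (0 : ℝ)..1, ((α + 1) / x) • (unifMgf (z * (x ^ α : ℝ)) - 1) =
      xiExponentComplex α z := by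
  simp only [div_eq_mul_inv, mul_smul]
  rw [intervalIntegral.integral_smul,
    integral_inv_smul_comp_rpow hα fun y => unifMgf (z * (y : ℝ)) - 1,
    integral_inv_smul_unifMgf_sub_one, xiExponentComplex, smul_smul, Complex.real_smul]
  push_cast
  rfl

lemma xiExponentComplex_ofReal (α t : ℝ) : xiExponentComplex α t = xiExponent α t := by
  rw [xiExponentComplex, xiExponent]
  push_cast [← intervalIntegral.integral_ofReal]
  rfl

lemma continuousAt_xiExponentComplex_zero (α : ℝ) : ContinuousAt (xiExponentComplex α) 0 := by
  have hle (z : ℂ) : ‖xiExponentComplex α z‖ ≤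
      ‖((α : ℂ) + 1) / α‖ * (‖z‖ * Real.exp ‖z‖) := by
    rw [xiExponentComplex, norm_mul]
    gcongr
    refine (intervalIntegral.norm_integral_le_of_norm_le_const (C := ‖z‖ * Real.exp ‖z‖)
      fun u hu => ?_).trans (by simp)
    rw [Set.uIoc_of_le zero_le_one] at hu
    have hnorm : ‖((1 - u) / u : ℂ)‖ = (1 - u) * u⁻¹ := by
      rw [← Complex.ofReal_one, ← Complex.ofReal_sub, ← Complex.ofReal_div, Complex.norm_real,
        Real.norm_of_nonneg (div_nonneg (sub_nonneg.2 hu.2) hu.1.le), div_eq_mul_inv]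
    have hbound := norm_inv_smul_comp_mul_le norm_exp_sub_one_le_mul_exp z hu
    rw [norm_smul, Real.norm_of_nonneg (inv_pos.2 hu.1).le] at hbound
    rw [norm_mul, hnorm]
    refine le_trans ?_ hbound
    rw [mul_comm (u⁻¹)]
    gcongr
    exact mul_le_of_le_one_left (inv_pos.2 hu.1).le (by linarith [hu.1])
  have hzero : xiExponentComplex α 0 = 0 := by simp [xiExponentComplex]
  rw [ContinuousAt, hzero]
  refine squeeze_zero_norm hle ?_
  have hcont : Continuous fun z : ℂ => ‖((α : ℂ) + 1) / α‖ * (‖z‖ * Real.exp ‖z‖) := by fun_prop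
  simpa using hcont.tendsto 0

lemma continuousAt_exp_xiExponentComplex_mul_I (α : ℝ) :
    ContinuousAt (fun t : ℝ => Complex.exp (xiExponentComplex α (t * Complex.I))) 0 := by
  have hzero : ContinuousAt (xiExponentComplex α) ((0 : ℝ) * Complex.I) := by
    simpa only [Complex.ofReal_zero, zero_mul] using continuousAt_xiExponentComplex_zero α
  exact (hzero.comp (f := fun t : ℝ => (t : ℂ) * Complex.I) (by fun_prop)).cexp

lemma RegularlyVarying.tendsto_heightProd_div_xiExponentComplex {a : ℕ → ℝ} {α : ℝ}
    (ha : ∀ n, 1 ≤ n → 0 < a n) (h : RegularlyVarying a α) (hα : 0 < α) (z : ℂ) :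
    Tendsto (fun n => heightProd a n (z / a n)) atTop
      (𝓝 (Complex.exp (xiExponentComplex α z))) := by
  simpa only [integral_unifMgf_rpow_eq_xiExponentComplex hα]
    using h.tendsto_heightProd_div_of_pos ha hα z

end XiExponent

lemma integral_add_const_sq {E : Type*} [MeasurableSpace E] {ρ : Measure E}
    [IsProbabilityMeasure ρ] {f : E → ℝ} (hf : MemLp f 2 ρ) (k : ℝ) :
    ∫ x, (f x + k) ^ 2 ∂ρ = ∫ x, f x ^ 2 ∂ρ + 2 * k * ∫ x, f x ∂ρ + k ^ 2 := by
  have hlin : Integrable (fun x => 2 * k * f x) ρ := (hf.integrable one_le_two).const_mul _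
  calc ∫ x, (f x + k) ^ 2 ∂ρ = ∫ x, (f x ^ 2 + 2 * k * f x + k ^ 2) ∂ρ := by
        congr 1 with x
        ring
    _ = _ := by
        rw [integral_add (f := fun x => f x ^ 2 + 2 * k * f x) (hf.integrable_sq.add hlin)
          (integrable_const _), integral_add hf.integrable_sq hlin, integral_const_mul,
          integral_const]
        simp

section MgfLimit

variable {E : Type*} [TopologicalSpace E] [MeasurableSpace E] [OpensMeasurableSpace E]
  [HasOuterApproxClosed E] {μ : ℕ → ProbabilityMeasure E} {ν : ProbabilityMeasure E} {f : E → ℝ}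

lemma integrable_and_integral_le_of_tendsto (hμ : Tendsto μ atTop (𝓝 ν)) (hf : Continuous f)
    (hf0 : 0 ≤ f) (hint : ∀ n, Integrable f (μ n : Measure E)) {m : ℝ}
    (hm : Tendsto (fun n => ∫ x, f x ∂(μ n : Measure E)) atTop (𝓝 m)) :
    Integrable f (ν : Measure E) ∧ ∫ x, f x ∂(ν : Measure E) ≤ m := by
  have hm0 : 0 ≤ m := ge_of_tendsto' hm fun n => integral_nonneg hf0
  have hlim : Tendsto (fun n => ∫⁻ x, ENNReal.ofReal (f x) ∂(μ n : Measure E)) atTop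
      (𝓝 (ENNReal.ofReal m)) := by
    refine (ENNReal.tendsto_ofReal hm).congr fun n => ?_
    rw [ofReal_integral_eq_lintegral_ofReal (hint n) (.of_forall hf0)]
  have hle : ∫⁻ x, ENNReal.ofReal (f x) ∂(ν : Measure E) ≤ ENNReal.ofReal m := by
    rw [← hlim.liminf_eq]
    exact lintegral_le_liminf_lintegral_of_forall_isOpen_measure_le_liminf_measure hf hf0
      fun G hG => ProbabilityMeasure.le_liminf_measure_open_of_tendsto hμ hG
  have hfν : Integrable f (ν : Measure E) :=
    (lintegral_ofReal_ne_top_iff_integrable hf.aestronglyMeasurable (.of_forall hf0)).1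
      (hle.trans_lt ENNReal.ofReal_lt_top).ne
  refine ⟨hfν, ?_⟩
  rwa [← ofReal_integral_eq_lintegral_ofReal hfν (.of_forall hf0),
    ENNReal.ofReal_le_ofReal_iff hm0] at hle

-- For every `k`, the preceding lemma applied to `(f + k) ^ 2` bounds `k` times the defect of the
-- integrals by a constant, so the defect vanishes.
lemma integral_eq_of_tendsto_of_tendsto_sq (hμ : Tendsto μ atTop (𝓝 ν)) (hf : Continuous f)
    (hint : ∀ n, MemLp f 2 (μ n : Measure E)) {m V : ℝ}
    (hm : Tendsto (fun n => ∫ x, f x ∂(μ n : Measure E)) atTop (𝓝 m))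
    (hV : Tendsto (fun n => ∫ x, f x ^ 2 ∂(μ n : Measure E)) atTop (𝓝 V)) :
    ∫ x, f x ∂(ν : Measure E) = m := by
  have hν : MemLp f 2 (ν : Measure E) :=
    (memLp_two_iff_integrable_sq hf.aestronglyMeasurable).2
      (integrable_and_integral_le_of_tendsto hμ (hf.pow 2) (fun x => sq_nonneg (f x))
        (fun n => (hint n).integrable_sq) hV).1
  have defect_le (k : ℝ) : 2 * k * (∫ x, f x ∂(ν : Measure E) - m) ≤ V := by
    have hk : Tendsto (fun n => ∫ x, (f x + k) ^ 2 ∂(μ n : Measure E)) atTop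
        (𝓝 (V + 2 * k * m + k ^ 2)) := by
      simp only [fun n => integral_add_const_sq (hint n) k]
      exact (hV.add (hm.const_mul _)).add_const _
    have hle := (integrable_and_integral_le_of_tendsto (f := fun x => (f x + k) ^ 2) hμ
      (by fun_prop) (fun x => sq_nonneg (f x + k))
      (fun n => ((hint n).add (memLp_const k)).integrable_sq) hk).2
    rw [integral_add_const_sq hν k] at hle
    have hsq : 0 ≤ ∫ x, f x ^ 2 ∂(ν : Measure E) := integral_nonneg fun x => sq_nonneg (f x)
    linarith
  by_contra hne
  have hdefect := defect_le ((V + 1) / (2 * (∫ x, f x ∂(ν : Measure E) - m)))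
  field_simp [sub_ne_zero.2 hne] at hdefect
  linarith

end MgfLimit

lemma mgf_eq_of_tendsto {μ : ℕ → ProbabilityMeasure ℝ} {ν : ProbabilityMeasure ℝ} {M : ℝ → ℝ}
    (hμ : Tendsto μ atTop (𝓝 ν))
    (hint : ∀ n t, Integrable (fun x => Real.exp (t * x)) (μ n : Measure ℝ))
    (hmgf : ∀ t, Tendsto (fun n => mgf id (μ n : Measure ℝ) t) atTop (𝓝 (M t))) (t : ℝ) :
    mgf id (ν : Measure ℝ) t = M t := by
  have hsq (x : ℝ) : Real.exp (t * x) ^ 2 = Real.exp (2 * t * x) := by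
    rw [← Real.exp_nat_mul]
    push_cast
    ring_nf
  refine integral_eq_of_tendsto_of_tendsto_sq (f := fun x => Real.exp (t * x)) (V := M (2 * t))
    hμ (by fun_prop) (fun n => ?_) (hmgf t) ?_
  · rw [memLp_two_iff_integrable_sq (hint n t).aestronglyMeasurable]
    simpa only [hsq] using hint n (2 * t)
  · simpa only [hsq, mgf, id_eq] using hmgf (2 * t)

lemma exists_probabilityMeasure_of_tendsto_charFun_mgf {μ : ℕ → ProbabilityMeasure ℝ} {φ : ℝ → ℂ}
    {M : ℝ → ℝ} (hφ : ContinuousAt φ 0)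
    (hchar : ∀ t, Tendsto (fun n => charFun (μ n : Measure ℝ) t) atTop (𝓝 (φ t)))
    (hint : ∀ n t, Integrable (fun x => Real.exp (t * x)) (μ n : Measure ℝ))
    (hmgf : ∀ t, Tendsto (fun n => mgf id (μ n : Measure ℝ) t) atTop (𝓝 (M t))) :
    ∃ ν : ProbabilityMeasure ℝ, (∀ t, charFun (ν : Measure ℝ) t = φ t) ∧
      ∀ t, mgf id (ν : Measure ℝ) t = M t := by
  have hcompact : IsCompact (closure (Set.range μ)) := by
    refine isCompact_closure_of_isTightMeasureSet ?_
    convert isTightMeasureSet_of_tendsto_charFun hφ hchar using 1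
    ext m
    simp
  obtain ⟨ν, -, ψ, hψ, hν⟩ := hcompact.tendsto_subseq fun n => subset_closure (Set.mem_range_self n)
  refine ⟨ν, fun t => ?_, mgf_eq_of_tendsto hν (fun n t => hint (ψ n) t)
    fun t => (hmgf t).comp hψ.tendsto_atTop⟩
  exact tendsto_nhds_unique (ProbabilityMeasure.tendsto_iff_tendsto_charFun.1 hν t)
    ((hchar t).comp hψ.tendsto_atTop)

lemma IsXiLaw.unique {α : ℝ} {ν ν' : ProbabilityMeasure ℝ} (h : IsXiLaw α ν)
    (h' : IsXiLaw α ν') : ν = ν' := by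
  have hmgf : mgf id (ν : Measure ℝ) = mgf id (ν' : Measure ℝ) :=
    funext fun t => (h t).trans (h' t).symm
  have huniv : integrableExpSet id (ν : Measure ℝ) = Set.univ := by
    refine Set.eq_univ_of_forall fun t => ?_
    by_contra hundef
    exact (Real.exp_pos _).ne' ((h t).symm.trans (mgf_undef hundef))
  have heq : (ν : Measure ℝ) = ν' := Measure.ext_of_charFun <| funext fun t => by
    rw [← complexMGF_id_mul_I, ← complexMGF_id_mul_I]
    exact eqOn_complexMGF_of_mgf hmgf (by simp [huniv])
  exact Subtype.ext heq

section ConvergenceModes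

variable {Ω : Type*} [MeasurableSpace Ω] {P : Measure Ω}

lemma tendstoInDistribution_pi_of_tendsto_charFun [IsProbabilityMeasure P] {ι : Type*} [Fintype ι]
    {Y : ℕ → Ω → ι → ℝ} (hY : ∀ n, AEMeasurable (Y n) P) (ν : ι → Measure ℝ)
    [∀ j, IsProbabilityMeasure (ν j)]
    (h : ∀ t : ι → ℝ, Tendsto (fun n => ∫ ω, ∏ j, Complex.exp (t j * Complex.I * Y n ω j) ∂P) atTop
      (𝓝 (∏ j, charFun (ν j) (t j)))) :
    TendstoInDistribution Y atTop id (fun _ => P) (Measure.pi ν) := by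
  have hmeas (n : ℕ) : AEMeasurable (fun ω => WithLp.toLp 2 (Y n ω)) P :=
    (WithLp.measurable_toLp 2 _).comp_aemeasurable (hY n)
  have hEuclidean : TendstoInDistribution (fun n ω => WithLp.toLp 2 (Y n ω)) atTop
      (WithLp.toLp 2 : (ι → ℝ) → EuclideanSpace ℝ ι) (fun _ => P) (Measure.pi ν) := by
    refine ⟨hmeas, (WithLp.measurable_toLp 2 _).aemeasurable,
      ProbabilityMeasure.tendsto_of_tendsto_charFun fun t => ?_⟩
    simp only [ProbabilityMeasure.coe_mk]
    rw [charFun_pi (E := fun _ : ι => ℝ) t]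
    refine (h t).congr fun n => ?_
    rw [charFun_apply, integral_map (hmeas n) (by fun_prop)]
    refine integral_congr_ae (.of_forall fun ω => ?_)
    simp only [PiLp.inner_apply, ← Complex.exp_sum, Complex.ofReal_sum, Finset.sum_mul]
    congr 1
    refine Finset.sum_congr rfl fun j _ => ?_
    simp
    ring
  exact hEuclidean.continuous_comp (g := WithLp.ofLp) (PiLp.continuous_ofLp 2 _)

lemma tendstoInMeasure_const_of_tendstoInDistribution [IsProbabilityMeasure P] {Ω' E : Type*}
    [MeasurableSpace Ω'] {Q : Measure Ω'} [IsProbabilityMeasure Q] [PseudoEMetricSpace E]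
    [MeasurableSpace E] [BorelSpace E] {Y : ℕ → Ω → E} {Z : Ω' → E} {c : E}
    (h : TendstoInDistribution Y atTop Z (fun _ => P) Q) (hZ : ∀ᵐ x ∂Q, Z x = c) :
    TendstoInMeasure P Y atTop fun _ => c := by
  intro ε hε
  have hF : IsClosed {x : E | ε ≤ edist x c} := isClosed_le continuous_const (by fun_prop)
  have hlimsup := ProbabilityMeasure.limsup_measure_closed_le_of_tendsto h.tendsto hF
  have hY (n : ℕ) : P.map (Y n) {x | ε ≤ edist x c} = P {ω | ε ≤ edist (Y n ω) c} :=
    Measure.map_apply_of_aemeasurable (h.forall_aemeasurable n) hF.measurableSet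
  have hZ0 : Q.map Z {x | ε ≤ edist x c} = 0 := by
    rw [Measure.map_apply_of_aemeasurable h.aemeasurable_limit hF.measurableSet]
    refine measure_eq_zero_iff_ae_notMem.2 (hZ.mono fun x hx => ?_)
    simpa [hx] using hε.ne'
  simp only [ProbabilityMeasure.coe_mk, hY, hZ0] at hlimsup
  exact tendsto_of_le_liminf_of_limsup_le (by simp) hlimsup

lemma tendstoInMeasure_prodMk_const {E F : Type*} [PseudoEMetricSpace E] [PseudoEMetricSpace F]
    {Y : ℕ → Ω → E} {Z : ℕ → Ω → F} {c : E} {d : F} (hY : TendstoInMeasure P Y atTop fun _ => c)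
    (hZ : TendstoInMeasure P Z atTop fun _ => d) :
    TendstoInMeasure P (fun n ω => (Y n ω, Z n ω)) atTop fun _ => (c, d) := by
  intro ε hε
  have hadd := (hY ε hε).add (hZ ε hε)
  rw [add_zero] at hadd
  refine tendsto_of_tendsto_of_tendsto_of_le_of_le tendsto_const_nhds hadd (fun _ => zero_le)
    fun n => (measure_mono fun ω hω => ?_).trans (measure_union_le _ _)
  exact le_max_iff.1 (show ε ≤ max (edist (Y n ω) c) (edist (Z n ω) d) from hω)

end ConvergenceModes

namespace IsMarkedGluing

variable {Ω : Type*} [MeasurableSpace Ω] {P : Measure Ω} {a : ℕ → ℝ} {ℓ : ℕ}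
  {glue : ℕ → Ω → ℕ × ℝ} {X : ℕ → Fin ℓ → Ω → ℕ × ℝ} {n : ℕ}

lemma ae_treeDist_treeRoot_eq_height (hX : IsMarkedGluing P a ℓ glue X)
    (ha : ∀ n, 1 ≤ n → 0 < a n) (n : ℕ) :
    ∀ᵐ ω ∂P, ∀ j, treeDist (fun i => glue i ω) n (X n j ω) treeRoot =
      height (fun i => glue i ω) n (X n j ω) := by
  obtain rfl | hn := n.eq_zero_or_pos
  · simp [treeDist, height]
  · filter_upwards [hX.ae_validGluing n, hX.ae_mark_mem hn] with ω hg hmark j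
      using treeDist_treeRoot ha hg (hmark j)

variable [IsProbabilityMeasure P]

lemma integrable_exp_mul_height_div (hX : IsMarkedGluing P a ℓ glue X)
    (ha : ∀ n, 1 ≤ n → 0 < a n) (n : ℕ) (j : Fin ℓ) (c t : ℝ) :
    Integrable (fun ω => Real.exp (t * (height (fun i => glue i ω) n (X n j ω) / c))) P := by
  have := hX.measurable_height_mark n j
  refine .of_bound (Measurable.aestronglyMeasurable (by fun_prop))
    (Real.exp (|t / c| * totalLength a n)) ?_
  obtain rfl | hn := n.eq_zero_or_pos
  · simp [height, totalLength]
  filter_upwards [hX.ae_validGluing n, hX.ae_mark_mem hn] with ω hg hmark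
  rw [Real.norm_eq_abs, Real.abs_exp, Real.exp_le_exp, mul_div_left_comm, mul_comm]
  exact mul_le_mul (le_abs_self _) (height_le_totalLength ha hg (hmark j))
    (height_nonneg hg (hmark j)) (abs_nonneg _)

lemma complexMGF_height_div (hX : IsMarkedGluing P a ℓ glue X) (ha : ∀ n, 1 ≤ n → 0 < a n)
    (hn : 1 ≤ n) (j : Fin ℓ) (c : ℝ) (z : ℂ) :
    complexMGF (fun ω => height (fun i => glue i ω) n (X n j ω) / c) P z =
      heightProd a n (z / c) := by
  rw [← hX.integral_exp_mul_height ha hn (z / c) j, complexMGF]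
  congr with ω
  push_cast
  ring_nf

lemma tendstoInDistribution_heights (hX : IsMarkedGluing P a ℓ glue X)
    (ha : ∀ n, 1 ≤ n → 0 < a n) (hs : Summable fun k => segProb a k ^ 2) {c : ℕ → ℝ}
    (hc : Tendsto c atTop atTop) {ν : Measure ℝ} [IsProbabilityMeasure ν]
    (hlim : ∀ t : ℝ, Tendsto (fun n => heightProd a n (t * Complex.I / c n)) atTop
      (𝓝 (charFun ν t))) :
    TendstoInDistribution (fun n ω (j : Fin ℓ) =>
      treeDist (fun i => glue i ω) n (X n j ω) treeRoot / c n) atTop id (fun _ => P)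
      (Measure.pi fun _ => ν) := by
  have hmeas (n : ℕ) :
      Measurable fun ω (j : Fin ℓ) => height (fun i => glue i ω) n (X n j ω) / c n :=
    measurable_pi_iff.2 fun j => (hX.measurable_height_mark n j).div_const _
  refine (tendstoInDistribution_pi_of_tendsto_charFun (fun n => (hmeas n).aemeasurable)
    (fun _ => ν) fun t => ?_).congr (fun n => ?_) (ae_eq_refl _)
  · have hsub := hX.tendsto_integral_prod_heightTransform_sub ha hs (t := fun n j => t j / c n)
      fun j => hc.const_div_atTop (t j)
    have hadd := hsub.add (tendsto_finsetProd Finset.univ fun j _ => hlim (t j))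
    rw [zero_add] at hadd
    refine hadd.congr' ?_
    filter_upwards [eventually_ge_atTop 1] with n hn
    have hz (j : Fin ℓ) : ((t j / c n : ℝ) : ℂ) * Complex.I = t j * Complex.I / c n := by
      push_cast
      ring
    simp only [hz, sub_add_cancel]
    rw [← hX.integral_prod_exp_mul_height ha hn]
    refine integral_congr_ae (.of_forall fun ω => Finset.prod_congr rfl fun j _ => ?_)
    push_cast
    ring_nf
  · filter_upwards [hX.ae_treeDist_treeRoot_eq_height ha n] with ω hω
    simp only [hω]

lemma tendsto_complexMGF_height_div (hX : IsMarkedGluing P a ℓ glue X)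
    (ha : ∀ n, 1 ≤ n → 0 < a n) (j : Fin ℓ) {α : ℝ} (hα : 0 < α) (h : RegularlyVarying a α)
    (z : ℂ) :
    Tendsto (fun n => complexMGF (fun ω => height (fun i => glue i ω) n (X n j ω) / a n) P z) atTop
      (𝓝 (Complex.exp (xiExponentComplex α z))) := by
  refine (h.tendsto_heightProd_div_xiExponentComplex ha hα z).congr' ?_
  filter_upwards [eventually_ge_atTop 1] with n hn
  rw [hX.complexMGF_height_div ha hn]

lemma exists_isXiLaw (hX : IsMarkedGluing P a ℓ glue X) (ha : ∀ n, 1 ≤ n → 0 < a n)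
    (j : Fin ℓ) {α : ℝ} (hα : 0 < α) (h : RegularlyVarying a α) :
    ∃ ν : ProbabilityMeasure ℝ, IsXiLaw α ν ∧ ∀ t : ℝ,
      Tendsto (fun n => heightProd a n (t * Complex.I / a n)) atTop
        (𝓝 (charFun (ν : Measure ℝ) t)) := by
  let Y (n : ℕ) (ω : Ω) : ℝ := height (fun i => glue i ω) n (X n j ω) / a n
  have hY (n : ℕ) : AEMeasurable (Y n) P :=
    ((hX.measurable_height_mark n j).div_const _).aemeasurable
  have hcomplexMGF := hX.tendsto_complexMGF_height_div ha j hα h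
  have hcharFun (t : ℝ) : Tendsto (fun n => charFun (P.map (Y n)) t) atTop
      (𝓝 (Complex.exp (xiExponentComplex α (t * Complex.I)))) := by
    simpa only [← complexMGF_id_mul_I, complexMGF_id_map (hY _)]
      using hcomplexMGF (t * Complex.I)
  have hmgf (t : ℝ) : Tendsto (fun n => mgf id (P.map (Y n)) t) atTop
      (𝓝 (Real.exp (xiExponent α t))) := by
    have hre := (Complex.continuous_re.tendsto _).comp (hcomplexMGF t)
    rw [xiExponentComplex_ofReal, ← Complex.ofReal_exp, Complex.ofReal_re] at hre
    refine hre.congr fun n => ?_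
    rw [Function.comp_apply, re_complexMGF_ofReal, mgf_id_map (hY n)]
  obtain ⟨ν, hν, hν'⟩ := exists_probabilityMeasure_of_tendsto_charFun_mgf
    (μ := fun n => ⟨P.map (Y n), Measure.isProbabilityMeasure_map (hY n)⟩)
    (continuousAt_exp_xiExponentComplex_mul_I α) hcharFun
    (fun n t => (integrable_map_measure (by fun_prop) (hY n)).2
      (hX.integrable_exp_mul_height_div ha n j (a n) t)) hmgf
  exact ⟨ν, hν', fun t => hν t ▸ h.tendsto_heightProd_div_xiExponentComplex ha hα _⟩

lemma tendstoInMeasure_heights (hX : IsMarkedGluing P a ℓ glue X)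
    (ha : ∀ n, 1 ≤ n → 0 < a n) (h : RegularlyVarying a 0)
    (hS : Tendsto (harmonicSum a) atTop atTop) :
    TendstoInMeasure P (fun n ω (j : Fin ℓ) =>
      treeDist (fun i => glue i ω) n (X n j ω) treeRoot / harmonicSum a n) atTop
      fun _ _ => (1 / 2 : ℝ) := by
  refine tendstoInMeasure_const_of_tendstoInDistribution
    (hX.tendstoInDistribution_heights ha (h.summable_segProb_sq ha (by norm_num)) hS
      (ν := Measure.dirac (1 / 2)) fun t => ?_) ?_
  · convert h.tendsto_heightProd_div_of_zero ha hS (t * Complex.I) using 2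
    rw [charFun_dirac]
    congr 1
    simp
    ring
  · have hcoord (j : Fin ℓ) :
        ∀ᵐ x ∂(Measure.pi fun _ : Fin ℓ => Measure.dirac (1 / 2 : ℝ)), x j = 1 / 2 :=
      (Measure.quasiMeasurePreserving_eval (fun _ => Measure.dirac (1 / 2 : ℝ)) j).ae
        (p := fun y => y = 1 / 2) ((ae_dirac_iff (measurableSet_singleton _)).2 rfl)
    filter_upwards [ae_all_iff.2 hcoord] with x hx using funext hx

end IsMarkedGluing

theorem mainTheorem5 {Ω : Type*} [MeasurableSpace Ω] (P : Measure Ω) [IsProbabilityMeasure P]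
    (a : ℕ → ℝ) (ha : ∀ n, 1 ≤ n → 0 < a n) (ℓ : ℕ) (hℓ : 1 ≤ ℓ)
    (glue : ℕ → Ω → ℕ × ℝ) (X : ℕ → Fin ℓ → Ω → ℕ × ℝ)
    (hX : IsMarkedGluing P a ℓ glue X) :
    (∀ α : ℝ, 0 < α → RegularlyVarying a α →
      (∃! ν : ProbabilityMeasure ℝ, IsXiLaw α ν) ∧
      ∀ ν : ProbabilityMeasure ℝ, IsXiLaw α ν →
        TendstoInDistribution
          (fun (n : ℕ) (ω : Ω) =>
            ((fun j : Fin ℓ => treeDist (fun i => glue i ω) n (X n j ω) treeRoot / a n),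
              maxBranchHeight a (fun i => glue i ω) n (fun j => X n j ω) / a n))
          atTop
          (fun y : Fin ℓ → ℝ => (y, (0 : ℝ)))
          (fun _ => P)
          (Measure.pi fun _ : Fin ℓ => (ν : Measure ℝ))) ∧
    (RegularlyVarying a 0 → Tendsto (harmonicSum a) atTop atTop →
      TendstoInMeasure P
        (fun (n : ℕ) (ω : Ω) =>
          ((fun j : Fin ℓ =>
              treeDist (fun i => glue i ω) n (X n j ω) treeRoot / harmonicSum a n),
            maxBranchHeight a (fun i => glue i ω) n (fun j => X n j ω) / harmonicSum a n))
        atTop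
        (fun _ => ((fun _ : Fin ℓ => (1 / 2 : ℝ)), (0 : ℝ))) ∧
      (Tendsto a atTop atTop →
        TendstoInMeasure P
          (fun (n : ℕ) (ω : Ω) =>
            ((fun j : Fin ℓ =>
                treeDist (fun i => glue i ω) n (X n j ω) treeRoot / harmonicSum a n),
              maxBranchHeight a (fun i => glue i ω) n (fun j => X n j ω) / a n))
          atTop
          (fun _ => ((fun _ : Fin ℓ => (1 / 2 : ℝ)), (0 : ℝ))))) := by
  refine ⟨fun α hα h => ?_, fun h hS => ?_⟩
  · obtain ⟨ν₀, hν₀, hlim⟩ := hX.exists_isXiLaw ha ⟨0, hℓ⟩ hα h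
    refine ⟨⟨ν₀, hν₀, fun ν hν => hν.unique hν₀⟩, fun ν hν => ?_⟩
    obtain rfl := hν.unique hν₀
    have hs := h.summable_segProb_sq ha (neg_one_lt_zero.trans hα)
    have hc := h.tendsto_atTop_of_pos ha hα
    exact TendstoInDistribution.prodMk_of_tendstoInMeasure_const _ _ _
      (hX.tendstoInDistribution_heights ha hs hc hlim)
      (hX.tendstoInMeasure_maxBranchHeight_div ha hs hc)
      fun n => (hX.aemeasurable_maxBranchHeight ha n).div_const _
  · have hs := h.summable_segProb_sq ha neg_one_lt_zero
    have hheights := hX.tendstoInMeasure_heights ha h hS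
    exact ⟨tendstoInMeasure_prodMk_const hheights
        (hX.tendstoInMeasure_maxBranchHeight_div ha hs hS),
      fun hc => tendstoInMeasure_prodMk_const hheights
        (hX.tendstoInMeasure_maxBranchHeight_div ha hs hc)⟩
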